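/- Let $q\ge 1$, let $\lambda$ be a primitive $q$-th root of unity, and put $\lambda_t=(1+t)\lambda$. Let $\delta'>0$ and let $\{H_t\}_{|t|<\delta'}$ be an analytic family of germs of holomorphic diffeomorphisms of $(\mathbb{C}^2,0)$ (the parameter $t$ may be real or complex; analytic means that $H_t(x,y)$ has, near every $(t_0,0,0)$ with $|t_0|<\delta'$, a convergent power series expansion in $(t-t_0,x,y)$ with complex coefficients). Suppose that for all $|t|<\delta'$ the eigenvalues of $DH_t(0)$ are $\lambda_t$ and $\nu_t$, with $$|\nu_t|<\min(1,|\lambda_t|)\qquad\text{and}\qquad |\nu_t|\,|\lambda_t|^{2q}<1 .$$ Suppose also that $H_0$ has semi-parabolic multiplicity $1$, that is, $0$ is a solution of $H_0^{\circ q}(z)=z$ of multiplicity $q+1$: if $H_0^{\circ q}(z)-z=(F_1(z),F_2(z))$ and $\mathcal{O}_2$ is the ring of germs at $0$ of holomorphic functions on $\mathbb{C}^2$, then $\dim_{\mathbb{C}}\mathcal{O}_2/(F_1,F_2)=q+1$. Then, after decreasing $\delta'>0$, there are a ball $B$ centered at $0\in\mathbb{C}^2$, independent of $t$, and for every $|t|<\delta'$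 local coordinates $(x,y)=\varphi_t$ on $B$ (an injective holomorphic map $\varphi_t:B\to\mathbb{C}^2$ with $\varphi_t(0)=0$ and $D\varphi_t(0)$ invertible), such that $(t,z)\mapsto\varphi_t(z)$ is $C^\infty$ and in these coordinates the germ $H_t$ has the form $(x,y)\mapsto(x_1,y_1)$, $$x_1=\lambda_t\Bigl(x+x^{q+1}+C_t\,x^{2q+1}+\sum_{i\ge 2q+2}a_{t,i}(y)\,x^{i}\Bigr),\qquad y_1=\nu_t\,y+x\,h_t(x,y),$$ where $C_t\in\mathbb{C}$ is a constant depending on $t$, the $a_{t,i}$ are germs at $0$ of holomorphic functions on $\mathbb{C}$, the series converges near $(0,0)$, and $h_t$ is a germ at $(0,0)$ of a holomorphic function on $\mathbb{C}^2$ with $h_t(0,0)=0$. -/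

import Mathlib

open Topology ContDiff

/-- A holomorphic germ of diffeomorphism of `(ℂ², 0)`: a map holomorphic near the origin, fixing
the origin, with invertible derivative there. -/
def IsGermDiffeo (f : ℂ × ℂ → ℂ × ℂ) : Prop :=
  AnalyticAt ℂ f 0 ∧ f 0 = 0 ∧ (fderiv ℂ f 0).IsInvertible

/-- `{H t}`, `t ∈ T`, is an analytic family of maps at the origin of `ℂ²`: near every `(t₀, 0)` with
`t₀ ∈ T`, the map `(t, x, y) ↦ H t (x, y)`, `t ∈ T`, is the sum of a convergent power series in
`(t - t₀, x, y)` with complex coefficients. For `T` open in `ℂ` this is joint holomorphy; for `T` an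
open interval of real numbers it is real analyticity in `t` of a family of holomorphic germs. -/
def IsAnalyticFamily (T : Set ℂ) (H : ℂ → ℂ × ℂ → ℂ × ℂ) : Prop :=
  ∀ t₀ ∈ T, AnalyticWithinAt ℂ (fun p : ℂ × ℂ × ℂ => H p.1 p.2) (T ×ˢ Set.univ) (t₀, 0)

/-- The algebra of functions on `ℂ²` that are holomorphic near the origin. Identifying functions
that agree near the origin turns it into the local ring `𝓞₂` of holomorphic germs at `0`. -/
def holoAtZero : Subalgebra ℂ (ℂ × ℂ → ℂ) where
  carrier := {f | AnalyticAt ℂ f 0}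
  mul_mem' := fun hf hg => hf.mul hg
  add_mem' := fun hf hg => hf.add hg
  algebraMap_mem' := fun _ => analyticAt_const

/-- The ideal generated by the germs of the two components of `F`, pulled back to `holoAtZero`:
it is generated by the functions that agree near the origin with `0` or with a component of `F`.
So `holoAtZero ⧸ componentIdeal F` is the local algebra `𝓞₂ / (F₁, F₂)`. -/
def componentIdeal (F : ℂ × ℂ → ℂ × ℂ) : Ideal holoAtZero :=
  Ideal.span {f | (f : ℂ × ℂ → ℂ) =ᶠ[𝓝 0] 0 ∨
    (f : ℂ × ℂ → ℂ) =ᶠ[𝓝 0] (fun z => (F z).1) ∨ (f : ℂ × ℂ → ℂ) =ᶠ[𝓝 0] (fun z => (F z).2)}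

/-- The multiplicity of the origin as a solution of `G z = z` is `n`: the local algebra
`𝓞₂ / (G₁ - x, G₂ - y)` has dimension `n` over `ℂ`. -/
def HasFixedPointMultiplicity (G : ℂ × ℂ → ℂ × ℂ) (n : ℕ) : Prop :=
  Module.rank ℂ (holoAtZero ⧸ componentIdeal (fun z => G z - z)) = n

/-- The germ `H`, one of whose eigenvalues at `0` is a primitive `q`-th root of unity, has
semi-parabolic multiplicity `m`: the origin is a fixed point of `H^{∘q}` of multiplicity
`m * q + 1`. -/
def HasSemiParabolicMultiplicity (q : ℕ) (H : ℂ × ℂ → ℂ × ℂ) (m : ℕ) : Prop :=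
  HasFixedPointMultiplicity H^[q] (m * q + 1)

/-- The relation between `(x, y)` and its image `(x₁, y₁)` under the normal form:
`x₁ = lam * (x + x^(q+1) + C x^(2q+1) + ∑_{i ≥ 2q+2} a i (y) x^i)` and
`y₁ = nu * y + x * h (x, y)`. -/
def NormalFormRel (q : ℕ) (lam nu C : ℂ) (a : ℕ → ℂ → ℂ) (h : ℂ × ℂ → ℂ) (w w₁ : ℂ × ℂ) : Prop :=
  (∃ S : ℂ, HasSum (fun j : ℕ => a (2 * q + 2 + j) w.2 * w.1 ^ (2 * q + 2 + j)) S ∧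
    w₁.1 = lam * (w.1 + w.1 ^ (q + 1) + C * w.1 ^ (2 * q + 1) + S)) ∧
  w₁.2 = nu * w.2 + w.1 * h w

/-! ### Holomorphic maps of several variables: Cauchy estimates, uniform limits, smoothness. -/

section SeveralVariables

open Metric Set Filter

variable {E F : Type*} [NormedAddCommGroup E] [NormedSpace ℂ E]
  [NormedAddCommGroup F] [NormedSpace ℂ F]

/-! Only `t` near 0 matters, and a family analytic in a real parameter extends holomorphically,
together with its eigenvalues, by the identity theorem (`exists_familyGerm`). The work is therefore
done with germs at 0 of maps (t, z) ↦ (t, f_t(z)) of ℂ × ℂ²: whatever is proved for such a germ is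
uniform and analytic in t.

Since |ν_t| < 1 and |ν_t| < |λ_t|, there is a strong stable curve tangent to the ν_t-eigenline, on
which the map is conjugate to y ↦ ν_t y (`exists_invariant_curve`). Straightening it to x = 0 gives
the shape (x a, ν_t y + x h), which is preserved by every change of coordinate x ↦ x U with U a
unit.

Improving x at order j amounts to solving λ_t b(y) - λ_t^j b(ν_t y) + λ_t c = r(y). The part of r
vanishing at y = 0 is treated by a Neumann series over the contractions y ↦ ν_t^k y
(`exists_analyticAt_sub_mul_comp_eq`), convergent for t near 0 because |λ_0| = 1 and |ν_0| < 1. The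
constant part is divided by λ_t - λ_t^j, which is nonzero near t = 0 unless q ∣ j - 1. The resonant
orders q + 1 and 2q + 1 are left in place for every t, even where λ_t is not a root of unity, so
their coefficients A(t) and C(t) are analytic in t. At j = 1 a logarithmic version of the equation
makes the multiplier of x along x = 0 independent of y. Only the orders up to 2q + 1 are touched, so
the elimination is finite algebra in the ring of germs (`exists_normalForm_mod`, applied in
`exists_normalForm_coordinate`).

The multiplicity enters through A(0) ≠ 0. If A(0) = 0, consider the smooth curve on which H_0^q
fixes the second coordinate, which exists because ν_0^q ≠ 1. Along it the displacement is
O(x^(q+2)), so the local algebra has dimension at least q + 2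
(`HasFixedPointMultiplicity.le_of_conj`), a contradiction. Hence A has an analytic q-th root near 0,
and scaling x by it makes the coefficient of x^(q+1) equal to 1 (`NormalFormChart.exists_rescale`).
-/

/-- Cauchy's estimate for the derivative of a holomorphic map between normed spaces. -/
theorem norm_fderiv_le_of_differentiableOn_ball {f : E → F} {z : E} {r M : ℝ} (hr : 0 < r)
    (hf : DifferentiableOn ℂ f (ball z r)) (hM : ∀ w ∈ ball z r, ‖f w‖ ≤ M) :
    ‖fderiv ℂ f z‖ ≤ 2 * M / r := by
  have hM0 : 0 ≤ M := (norm_nonneg _).trans (hM z (mem_ball_self hr))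
  refine ContinuousLinearMap.opNorm_le_bound _ (by positivity) fun v => ?_
  rcases eq_or_ne v 0 with rfl | hv
  · simp
  have hv' : 0 < ‖v‖ := norm_pos_iff.mpr hv
  -- Half the largest admissible radius: the closed disc of the line `z + s • v` then lies in the
  -- open ball, at the price of the factor 2 in the bound.
  set R := r / (2 * ‖v‖) with hR
  have hR0 : 0 < R := by positivity
  have hmem : ∀ s ∈ closedBall (0 : ℂ) R, z + s • v ∈ ball z r := by
    intro s hs
    rw [mem_closedBall_zero_iff] at hs
    rw [mem_ball_iff_norm, add_sub_cancel_left, norm_smul]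
    calc ‖s‖ * ‖v‖ ≤ R * ‖v‖ := by gcongr
      _ = r / 2 := by rw [hR]; field_simp
      _ < r := by linarith
  have hd : ∀ s ∈ closedBall (0 : ℂ) R,
      HasDerivAt (fun s : ℂ => f (z + s • v)) (fderiv ℂ f (z + s • v) v) s := by
    intro s hs
    have h1 := ((hf _ (hmem s hs)).differentiableAt (isOpen_ball.mem_nhds (hmem s hs))).hasFDerivAt
    have h2 : HasDerivAt (fun s : ℂ => z + s • v) v s := by
      simpa using ((hasDerivAt_id s).smul_const v).const_add z
    exact h1.comp_hasDerivAt s h2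
  have hc : DiffContOnCl ℂ (fun s : ℂ => f (z + s • v)) (ball 0 R) :=
    DifferentiableOn.diffContOnCl_ball (U := closedBall 0 R)
      (fun s hs => (hd s hs).differentiableAt.differentiableWithinAt) subset_rfl
  have h := Complex.norm_deriv_le_of_forall_mem_sphere_norm_le hR0 hc
    (fun s hs => hM _ (hmem s (sphere_subset_closedBall hs)))
  rw [(hd 0 (mem_closedBall_self hR0.le)).deriv] at h
  simp only [zero_smul, add_zero] at h
  refine h.trans (le_of_eq ?_)
  rw [hR]; field_simp

/-- A uniform limit of holomorphic maps is holomorphic. -/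
theorem TendstoUniformlyOn.differentiableOn_complex [CompleteSpace F] {f : ℕ → E → F} {g : E → F}
    {U : Set E} (hU : IsOpen U) (h : TendstoUniformlyOn f g atTop U)
    (hf : ∀ n, DifferentiableOn ℂ (f n) U) : DifferentiableOn ℂ g U := by
  intro x hx
  obtain ⟨r, hr, hrU⟩ := Metric.isOpen_iff.mp hU x hx
  set ρ := r / 2
  have hρ : 0 < ρ := by positivity
  have hsub : ∀ y ∈ ball x ρ, ball y ρ ⊆ U := fun y hy =>
    (ball_subset_ball' (by rw [mem_ball] at hy; simp only [ρ] at *; linarith)).trans hrU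
  have hx' : ball x ρ ⊆ U := hsub x (mem_ball_self hρ)
  -- Cauchy's estimate on balls of radius `ρ` passes the uniform Cauchy property from `f n` to the
  -- derivatives, so the derivatives converge uniformly as well.
  have hcau : UniformCauchySeqOn (fun n => fderiv ℂ (f n)) atTop (ball x ρ) := by
    have := h.uniformCauchySeqOn
    rw [Metric.uniformCauchySeqOn_iff] at this ⊢
    intro ε hε
    obtain ⟨N, hN⟩ := this (ε * ρ / 4) (by positivity)
    refine ⟨N, fun m hm n hn y hy => ?_⟩
    have hd : ∀ k, DifferentiableAt ℂ (f k) y := fun k =>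
      (hf k).differentiableAt (hU.mem_nhds (hx' hy))
    rw [dist_eq_norm, ← fderiv_sub (hd m) (hd n)]
    refine (norm_fderiv_le_of_differentiableOn_ball hρ (M := ε * ρ / 4)
      (((hf m).sub (hf n)).mono (hsub y hy)) fun w hw => ?_).trans_lt ?_
    · have := (hN m hm n hn w (hsub y hy hw)).le
      rwa [dist_eq_norm] at this
    · rw [div_lt_iff₀ hρ]; nlinarith [mul_pos hε hρ]
  have hlim : ∀ y ∈ ball x ρ, ∃ L, Tendsto (fun n => fderiv ℂ (f n) y) atTop (𝓝 L) :=
    fun y hy => cauchySeq_tendsto_of_complete (hcau.cauchySeq hy)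
  choose! g' hg' using hlim
  exact (hasFDerivAt_of_tendstoUniformlyOn isOpen_ball
    (hcau.tendstoUniformlyOn_of_tendsto hg')
    (fun n y hy => ((hf n).differentiableAt (hU.mem_nhds (hx' hy))).hasFDerivAt)
    (fun y hy => h.tendsto_at (hx' hy)) (mem_ball_self hρ)).differentiableAt.differentiableWithinAt

/-- The directional derivatives of a holomorphic map are holomorphic. -/
theorem DifferentiableOn.fderiv_apply_complex [CompleteSpace F] {f : E → F} {U : Set E}
    (hU : IsOpen U) (hf : DifferentiableOn ℂ f U) (v : E) :
    DifferentiableOn ℂ (fun z => fderiv ℂ f z v) U := by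
  intro x hx
  have hcont := (hf.continuousOn).continuousAt (hU.mem_nhds hx)
  obtain ⟨r, hr, hrU⟩ : ∃ r > 0, ∀ w ∈ ball x r, w ∈ U ∧ ‖f w‖ ≤ ‖f x‖ + 1 := by
    have h1 : ∀ᶠ w in 𝓝 x, ‖f w‖ < ‖f x‖ + 1 :=
      hcont.norm.eventually_lt_const (by linarith)
    obtain ⟨r, hr, h⟩ := Metric.eventually_nhds_iff_ball.mp (h1.and (hU.mem_nhds hx))
    exact ⟨r, hr, fun w hw => ⟨(h w hw).2, (h w hw).1.le⟩⟩
  set M := ‖f x‖ + 1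
  have hM : 0 < M := by positivity
  set ρ := r / 4 with hρdef
  have hρ : 0 < ρ := by positivity
  have hd : ∀ w ∈ ball x r, DifferentiableAt ℂ f w := fun w hw =>
    hf.differentiableAt (hU.mem_nhds (hrU w hw).1)
  have hb : ∀ w ∈ ball x (3 * ρ), ‖fderiv ℂ f w‖ ≤ 2 * M / ρ := by
    intro w hw
    have hs : ball w ρ ⊆ ball x r := ball_subset_ball' (by rw [mem_ball] at hw; linarith)
    exact norm_fderiv_le_of_differentiableOn_ball hρ
      (fun u hu => (hd u (hs hu)).differentiableWithinAt) fun u hu => (hrU u (hs hu)).2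
  have hlip : ∀ a ∈ ball x (3 * ρ), ∀ b ∈ ball x (3 * ρ), ‖f a - f b‖ ≤ 2 * M / ρ * ‖a - b‖ :=
    fun a ha b hb' => (convex_ball x (3 * ρ)).norm_image_sub_le_of_norm_fderiv_le
      (𝕜 := ℂ) (fun w hw => hd w (ball_subset_ball (by linarith) hw)) hb hb' ha
  -- Cauchy's estimate applied to `u ↦ f (u + w) - f u`, which is O(‖w‖) by `hlip`; this makes the
  -- derivative Lipschitz.
  have hlip' : ∀ a ∈ ball x ρ, ∀ w : E, ‖w‖ < ρ →
      ‖fderiv ℂ f (a + w) - fderiv ℂ f a‖ ≤ 2 * (2 * M / ρ * ‖w‖) / ρ := by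
    intro a ha w hw
    rw [mem_ball] at ha
    have hmem : ∀ u ∈ ball a ρ, u ∈ ball x (3 * ρ) ∧ u + w ∈ ball x (3 * ρ) := by
      intro u hu
      rw [mem_ball] at hu
      have h1 : Dist.dist u x < 2 * ρ := (dist_triangle u a x).trans_lt (by linarith)
      refine ⟨by rw [mem_ball]; linarith, ?_⟩
      rw [mem_ball]
      calc Dist.dist (u + w) x ≤ Dist.dist (u + w) u + Dist.dist u x := dist_triangle _ _ _
        _ = ‖w‖ + Dist.dist u x := by rw [dist_eq_norm, add_sub_cancel_left]
        _ < 3 * ρ := by linarith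
    have hd1 : ∀ u ∈ ball a ρ, DifferentiableAt ℂ (fun u => f (u + w)) u := fun u hu =>
      (differentiableAt_comp_add_right w).mpr (hd _ (ball_subset_ball (by linarith) (hmem u hu).2))
    have hd2 : ∀ u ∈ ball a ρ, DifferentiableAt ℂ f u := fun u hu =>
      hd _ (ball_subset_ball (by linarith) (hmem u hu).1)
    have key := norm_fderiv_le_of_differentiableOn_ball hρ (f := fun u => f (u + w) - f u) (z := a)
      (M := 2 * M / ρ * ‖w‖)
      (fun u hu => ((hd1 u hu).sub (hd2 u hu)).differentiableWithinAt) fun u hu => by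
        simpa using hlip (u + w) (hmem u hu).2 u (hmem u hu).1
    rwa [fderiv_fun_sub (hd1 a (mem_ball_self hρ)) (hd2 a (mem_ball_self hρ)),
      fderiv_comp_add_right] at key
  have hquad : ∀ a ∈ ball x ρ, ∀ w : E, ‖w‖ < ρ →
      ‖f (a + w) - f a - fderiv ℂ f a w‖ ≤ 2 * (2 * M / ρ * ‖w‖) / ρ * ‖w‖ := by
    intro a ha w hw
    have hseg : ∀ u ∈ segment ℝ a (a + w), ‖u - a‖ ≤ ‖w‖ := by
      intro u hu
      have := norm_sub_le_of_mem_segment hu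
      simpa using this
    have := (convex_segment (𝕜 := ℝ) a (a + w)).norm_image_sub_le_of_norm_fderiv_le' (𝕜 := ℂ) (f := f)
      (φ := fderiv ℂ f a) (C := 2 * (2 * M / ρ * ‖w‖) / ρ) (x := a) (y := a + w)
      (fun u hu => hd u ?_) (fun u hu => ?_) (left_mem_segment ℝ a _) (right_mem_segment ℝ a _)
    · simpa using this
    · rw [mem_ball] at ha ⊢
      have := hseg u hu
      calc Dist.dist u x ≤ Dist.dist u a + Dist.dist a x := dist_triangle _ _ _
        _ < r := by rw [dist_eq_norm]; linarith
    · have h1 := hlip' a ha (u - a) ((hseg u hu).trans_lt hw)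
      rw [add_sub_cancel] at h1
      refine h1.trans ?_
      gcongr
      exact hseg u hu
  -- The directional derivative is the uniform limit of the difference quotients with increments `v
  -- / (n + N + 1)`; the shift by `N` keeps every increment shorter than `ρ`.
  obtain ⟨N, hN⟩ := exists_nat_gt (‖v‖ / ρ)
  have hpos : ∀ n : ℕ, (0 : ℝ) < n + N + 1 := fun n => by positivity
  have hsm : ∀ n : ℕ, ‖((n + N + 1 : ℝ) : ℂ)⁻¹ • v‖ = ‖v‖ / (n + N + 1) := fun n => by
    rw [norm_smul, norm_inv, Complex.norm_real, Real.norm_of_nonneg (hpos n).le]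
    rw [div_eq_inv_mul]
  have hsm' : ∀ n : ℕ, ‖((n + N + 1 : ℝ) : ℂ)⁻¹ • v‖ < ρ := fun n => by
    rw [hsm, div_lt_iff₀ (hpos n)]
    rw [div_lt_iff₀ hρ] at hN
    nlinarith [(Nat.cast_nonneg n : (0 : ℝ) ≤ n)]
  have hunif : TendstoUniformlyOn
      (fun (n : ℕ) a => ((n + N + 1 : ℝ) : ℂ) • (f (a + ((n + N + 1 : ℝ) : ℂ)⁻¹ • v) - f a))
      (fun a => fderiv ℂ f a v) atTop (ball x ρ) := by
    rw [Metric.tendstoUniformlyOn_iff]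
    intro ε hε
    have ht : Tendsto (fun n : ℕ => 2 * (2 * M / ρ) / ρ * ‖v‖ * ‖v‖ / (n + N + 1 : ℝ)) atTop (𝓝 0) := by
      refine Tendsto.div_atTop tendsto_const_nhds ?_
      exact tendsto_atTop_add_const_right _ _ (tendsto_atTop_add_const_right _ _
        tendsto_natCast_atTop_atTop)
    filter_upwards [ht.eventually_lt_const hε] with n hn a ha
    have hq := hquad a ha _ (hsm' n)
    rw [hsm] at hq
    have hne : ((n + N + 1 : ℝ) : ℂ) ≠ 0 := by exact_mod_cast (hpos n).ne'
    have heq : fderiv ℂ f a v - ((n + N + 1 : ℝ) : ℂ) • (f (a + ((n + N + 1 : ℝ) : ℂ)⁻¹ • v) - f a)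
        = -(((n + N + 1 : ℝ) : ℂ) • (f (a + ((n + N + 1 : ℝ) : ℂ)⁻¹ • v) - f a
          - fderiv ℂ f a (((n + N + 1 : ℝ) : ℂ)⁻¹ • v))) := by
      rw [map_smul, smul_sub _ _ (((n + N + 1 : ℝ) : ℂ)⁻¹ • _), smul_smul, mul_inv_cancel₀ hne,
        one_smul, neg_sub]
    rw [dist_eq_norm, heq, norm_neg, norm_smul, Complex.norm_real, Real.norm_of_nonneg (hpos n).le]
    refine lt_of_le_of_lt ?_ hn
    refine (mul_le_mul_of_nonneg_left hq (hpos n).le).trans (le_of_eq ?_)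
    have := (hpos n).ne'
    field_simp
  have hres := hunif.differentiableOn_complex isOpen_ball fun n => by
    intro a ha
    refine DifferentiableAt.differentiableWithinAt ?_
    refine DifferentiableAt.const_smul (DifferentiableAt.sub ?_ ?_) _
    · refine (differentiableAt_comp_add_right _).mpr (hd _ ?_)
      rw [mem_ball] at ha ⊢
      calc _ ≤ Dist.dist (a + ((n + N + 1 : ℝ) : ℂ)⁻¹ • v) a + Dist.dist a x := dist_triangle _ _ _
        _ < r := by
          have := hsm' n
          rw [dist_eq_norm, add_sub_cancel_left]; linarith
    · exact hd a (ball_subset_ball (by linarith) ha)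
  exact ((hres x (mem_ball_self hρ)).differentiableAt
    (isOpen_ball.mem_nhds (mem_ball_self hρ))).differentiableWithinAt

/-- In finite dimension, smoothness of the derivative can be tested on directional derivatives,
which are again holomorphic; so the order can be raised by induction. -/
theorem DifferentiableOn.contDiffOn_complex [FiniteDimensional ℂ E] [CompleteSpace F] {f : E → F}
    {U : Set E} (hU : IsOpen U) (hf : DifferentiableOn ℂ f U) (n : ℕ) : ContDiffOn ℂ n f U := by
  induction n generalizing f with
  | zero => exact contDiffOn_zero.mpr hf.continuousOn
  | succ n ih =>
    push_cast
    rw [contDiffOn_succ_iff_fderiv_of_isOpen hU]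
    refine ⟨hf, by simp, ?_⟩
    rw [contDiffOn_clm_apply]
    exact fun v => ih (hf.fderiv_apply_complex hU v)

end SeveralVariables

/-! ### Power series of holomorphic maps of several variables and division by a linear form. -/

section SeveralVariablesAnalytic

open Metric Set Filter

variable {E F : Type*} [NormedAddCommGroup E] [NormedSpace ℂ E]
  [NormedAddCommGroup F] [NormedSpace ℂ F]

@[fun_prop]
theorem AnalyticAt.fst_apply {G : Type*} [NormedAddCommGroup G] [NormedSpace ℂ G] {f : E → F × G}
    {x : E} (hf : AnalyticAt ℂ f x) : AnalyticAt ℂ (fun z => (f z).1) x :=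
  AnalyticAt.fun_comp (g := Prod.fst) analyticAt_fst hf

@[fun_prop]
theorem AnalyticAt.snd_apply {G : Type*} [NormedAddCommGroup G] [NormedSpace ℂ G] {f : E → F × G}
    {x : E} (hf : AnalyticAt ℂ f x) : AnalyticAt ℂ (fun z => (f z).2) x :=
  AnalyticAt.fun_comp (g := Prod.snd) analyticAt_snd hf

/-- Cauchy's estimate for the iterated derivatives of a holomorphic map. -/
theorem norm_iteratedFDeriv_le_of_differentiableOn [FiniteDimensional ℂ E] [CompleteSpace F]
    {f : E → F} {U : Set E} (hU : IsOpen U) (hf : DifferentiableOn ℂ f U) {M s : ℝ} (hs : 0 < s)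
    (hM : ∀ w ∈ U, ‖f w‖ ≤ M) (k : ℕ) {z : E} (hz : z ∈ U) (hzU : ball z (k * s) ⊆ U) :
    ‖iteratedFDeriv ℂ k f z‖ ≤ M * (2 / s) ^ k := by
  induction k generalizing z with
  | zero => simpa using hM z hz
  | succ k ih =>
    rw [← norm_fderiv_iteratedFDeriv]
    have hsub : ∀ w ∈ ball z s, w ∈ U ∧ ball w (k * s) ⊆ U := by
      intro w hw
      refine ⟨hzU (ball_subset_ball ?_ hw), (ball_subset_ball' ?_).trans hzU⟩
      · push_cast; nlinarith [(Nat.cast_nonneg k : (0 : ℝ) ≤ k)]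
      · rw [mem_ball] at hw; push_cast; linarith
    have hd : ∀ w ∈ ball z s, DifferentiableAt ℂ (iteratedFDeriv ℂ k f) w := fun w hw =>
      ((hf.contDiffOn_complex hU (k + 1)).contDiffAt
        (hU.mem_nhds (hsub w hw).1)).differentiableAt_iteratedFDeriv (by exact_mod_cast k.lt_succ_self)
    refine (norm_fderiv_le_of_differentiableOn_ball hs
      (fun w hw => (hd w hw).differentiableWithinAt)
      (fun w hw => ih (hsub w hw).1 (hsub w hw).2)).trans (le_of_eq ?_)
    rw [pow_succ]; ring

/-- Through this identity one-variable Taylor series and Cauchy estimates on complex lines apply to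
the iterated derivatives. -/
theorem DifferentiableOn.iteratedDeriv_line [FiniteDimensional ℂ E] [CompleteSpace F]
    {f : E → F} {U : Set E} (hU : IsOpen U) (hf : DifferentiableOn ℂ f U) (z v : E) (k : ℕ) {s : ℂ}
    (hs : z + s • v ∈ U) :
    iteratedDeriv k (fun s : ℂ => f (z + s • v)) s
      = iteratedFDeriv ℂ k f (z + s • v) (fun _ => v) := by
  induction k generalizing s with
  | zero => simp
  | succ k ih =>
    have hV : ∀ᶠ u in 𝓝 s, z + u • v ∈ U :=
      (Continuous.continuousAt (by fun_prop)).eventually (hU.mem_nhds hs)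
    have heq : iteratedDeriv k (fun s : ℂ => f (z + s • v)) =ᶠ[𝓝 s]
        fun s => iteratedFDeriv ℂ k f (z + s • v) (fun _ => v) := hV.mono fun u hu => ih hu
    rw [iteratedDeriv_succ, heq.deriv_eq]
    exact ContDiffAt.deriv_fderiv_add_smul
      ((hf.contDiffOn_complex hU (k + 1)).contDiffAt (hU.mem_nhds hs))

/-- A holomorphic map on an open subset of a finite-dimensional complex space is analytic. -/
theorem DifferentiableOn.analyticOnNhd_complex [FiniteDimensional ℂ E] [CompleteSpace F]
    {f : E → F} {U : Set E} (hU : IsOpen U) (hf : DifferentiableOn ℂ f U) :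
    AnalyticOnNhd ℂ f U := by
  intro x hx
  have hcont := (hf.continuousOn).continuousAt (hU.mem_nhds hx)
  obtain ⟨r, hr, hrU⟩ : ∃ r > 0, ∀ w ∈ ball x r, w ∈ U ∧ ‖f w‖ ≤ ‖f x‖ + 1 := by
    have h1 : ∀ᶠ w in 𝓝 x, ‖f w‖ < ‖f x‖ + 1 :=
      hcont.norm.eventually_lt_const (by linarith)
    obtain ⟨r, hr, h⟩ := Metric.eventually_nhds_iff_ball.mp (h1.and (hU.mem_nhds hx))
    exact ⟨r, hr, fun w hw => ⟨(h w hw).2, (h w hw).1.le⟩⟩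
  set M := ‖f x‖ + 1
  have hM : 0 < M := by positivity
  have hfb : DifferentiableOn ℂ f (ball x r) := hf.mono fun w hw => (hrU w hw).1
  let p : FormalMultilinearSeries ℂ E F := fun n => ((n.factorial : ℂ)⁻¹) • iteratedFDeriv ℂ n f x
  have hp : ∀ n, ‖p n‖ ≤ M * (2 / r * Real.exp 1) ^ n := by
    intro n
    simp only [p]
    rw [norm_smul, norm_inv, Complex.norm_natCast]
    rcases Nat.eq_zero_or_pos n with rfl | hn
    · simpa using (hrU x (mem_ball_self hr)).2
    have hn' : (0 : ℝ) < n := by exact_mod_cast hn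
    -- Dividing the radius into `n` steps of length `r / n` gives the factor (2n/r)^n; since n^n /
    -- n! ≤ e^n, the Taylor coefficients grow at most geometrically.
    have h1 := norm_iteratedFDeriv_le_of_differentiableOn isOpen_ball hfb (s := r / n)
      (by positivity) (fun w hw => (hrU w hw).2) n (mem_ball_self hr)
      (by rw [mul_div_cancel₀ _ hn'.ne'])
    have h2 := Real.pow_div_factorial_le_exp (n : ℝ) hn'.le n
    have h3 : Real.exp (n : ℝ) = Real.exp 1 ^ n := by rw [← Real.exp_nat_mul, mul_one]
    calc (n.factorial : ℝ)⁻¹ * ‖iteratedFDeriv ℂ n f x‖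
        ≤ (n.factorial : ℝ)⁻¹ * (M * (2 / (r / n)) ^ n) := by gcongr
      _ = M * (2 / r) ^ n * ((n : ℝ) ^ n / n.factorial) := by
          rw [show 2 / (r / n) = (2 / r) * n by field_simp, mul_pow]; ring
      _ ≤ M * (2 / r) ^ n * Real.exp 1 ^ n := by rw [← h3]; gcongr
      _ = _ := by rw [mul_pow]; ring
  set ρ : ℝ := (2 / r * Real.exp 1)⁻¹ with hρdef
  have hρ : 0 < ρ := by positivity
  have hρr : ρ < r := by
    rw [hρdef, inv_lt_iff_one_lt_mul₀ (by positivity)]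
    have : 1 < Real.exp 1 := by simp
    rw [← mul_assoc, mul_div_cancel₀ _ hr.ne']
    linarith
  have hball : HasFPowerSeriesOnBall f p x (ENNReal.ofReal ρ) := by
    refine ⟨?_, by simpa using hρ, ?_⟩
    · have := p.le_radius_of_bound M (r := ρ.toNNReal) fun n => by
        rw [Real.coe_toNNReal _ hρ.le]
        calc ‖p n‖ * ρ ^ n ≤ M * (2 / r * Real.exp 1) ^ n * ρ ^ n := by gcongr; exact hp n
          _ = M := by
            rw [mul_assoc, ← mul_pow, hρdef, mul_inv_cancel₀ (by positivity), one_pow, mul_one]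
      exact this
    · intro y hy
      rw [eball_ofReal, mem_ball_zero_iff] at hy
      have hy' : ‖y‖ < r := hy.trans hρr
      -- `R > 1`, so the point `s = 1` lies inside the disc on which the restriction to the line is
      -- holomorphic.
      set R := r / (‖y‖ + (r - ‖y‖) / 2) with hR
      have hpos : 0 < ‖y‖ + (r - ‖y‖) / 2 := by
        have := norm_nonneg y; linarith
      have hR1 : 1 < R := by rw [hR, one_lt_div hpos]; linarith
      have hmem : ∀ s ∈ ball (0 : ℂ) R, x + s • y ∈ ball x r := by
        intro s hs
        rw [mem_ball_zero_iff] at hs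
        rw [mem_ball_iff_norm, add_sub_cancel_left, norm_smul]
        calc ‖s‖ * ‖y‖ ≤ R * ‖y‖ := by gcongr
          _ < R * (‖y‖ + (r - ‖y‖) / 2) := by gcongr; linarith
          _ = r := by rw [hR]; exact div_mul_cancel₀ _ hpos.ne'
      have hd : DifferentiableOn ℂ (fun s : ℂ => f (x + s • y)) (ball 0 R) :=
        hfb.comp (by fun_prop) hmem
      have := Complex.hasSum_taylorSeries_on_ball hd (z := 1) (by simpa using hR1)
      simp only [sub_zero, one_pow, one_smul] at this
      refine this.congr_fun ?_
      intro n
      rw [hfb.iteratedDeriv_line isOpen_ball x y n (by simpa using hr)]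
      simp [p]
  exact ⟨p, _, hball⟩

theorem AnalyticAt.exists_ball_bound {f : E → F} [CompleteSpace F] {x : E} (hf : AnalyticAt ℂ f x) :
    ∃ R M : ℝ, 0 < R ∧ 0 < M ∧ AnalyticOnNhd ℂ f (ball x R) ∧ ∀ w ∈ ball x R, ‖f w‖ ≤ M := by
  have h1 : ∀ᶠ w in 𝓝 x, ‖f w‖ < ‖f x‖ + 1 :=
    hf.continuousAt.norm.eventually_lt_const (by linarith)
  obtain ⟨r, hr, h⟩ := Metric.eventually_nhds_iff_ball.mp (h1.and hf.eventually_analyticAt)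
  exact ⟨r, ‖f x‖ + 1, hr, by positivity, fun w hw => (h w hw).2, fun w hw => (h w hw).1.le⟩

/-- A series of holomorphic maps that is dominated by a convergent series is analytic. -/
theorem analyticOnNhd_tsum_of_bound [FiniteDimensional ℂ E] [CompleteSpace F] {f : ℕ → E → F}
    {U : Set E} (hU : IsOpen U) (hf : ∀ n, AnalyticOnNhd ℂ (f n) U) {u : ℕ → ℝ} (hu : Summable u)
    (hb : ∀ n, ∀ z ∈ U, ‖f n z‖ ≤ u n) : AnalyticOnNhd ℂ (fun z => ∑' n, f n z) U := by
  refine DifferentiableOn.analyticOnNhd_complex hU ?_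
  refine (tendstoUniformlyOn_tsum_nat hu hb).differentiableOn_complex hU fun n => ?_
  exact DifferentiableOn.fun_sum fun i _ => (hf i).differentiableOn

/-- Taylor expansion of an analytic map in a direction `v`; the coefficients are analytic and
obey Cauchy's estimates. -/
theorem AnalyticAt.exists_hasSum_direction [FiniteDimensional ℂ E] [CompleteSpace F] {f : E → F}
    {x : E} (hf : AnalyticAt ℂ f x) (v : E) :
    ∃ (c : ℕ → E → F) (r M : ℝ), 0 < r ∧ 0 < M ∧ (∀ j, AnalyticOnNhd ℂ (c j) (ball x r)) ∧
      (∀ j, ∀ z ∈ ball x r, ‖c j z‖ ≤ M / r ^ j) ∧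
      ∀ z ∈ ball x r, ∀ s : ℂ, ‖s‖ < r → HasSum (fun j => s ^ j • c j z) (f (z + s • v)) := by
  obtain ⟨R, M, hR, hM, han, hb⟩ := hf.exists_ball_bound
  have hv := norm_nonneg v
  -- Ensures `r + 2 * r * ‖v‖ < R`: the restriction to each line is holomorphic on the disc of
  -- radius `2 * r`, leaving room for Cauchy's estimate on the circle of radius `r`.
  set r := R / (2 * ‖v‖ + 2) with hrdef
  have hr : 0 < r := by positivity
  have hrR : r * (2 * ‖v‖ + 2) = R := by rw [hrdef]; field_simp
  have hmem : ∀ z ∈ ball x r, ∀ s ∈ ball (0 : ℂ) (2 * r), z + s • v ∈ ball x R := by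
    intro z hz s hs
    rw [mem_ball_zero_iff] at hs
    rw [mem_ball_iff_norm] at hz ⊢
    calc ‖z + s • v - x‖ = ‖(z - x) + s • v‖ := by congr 1; abel
      _ ≤ ‖z - x‖ + ‖s‖ * ‖v‖ := (norm_add_le _ _).trans_eq (by rw [norm_smul])
      _ < R := by nlinarith
  have hmem0 : ∀ z ∈ ball x r, z ∈ ball x R := fun z hz => by
    simpa using hmem z hz 0 (by simpa using hr)
  have hd := han.differentiableOn
  have hline : ∀ z ∈ ball x r, DifferentiableOn ℂ (fun s : ℂ => f (z + s • v)) (ball 0 (2 * r)) :=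
    fun z hz => hd.comp (by fun_prop) (hmem z hz)
  have hit : ∀ j, ∀ z ∈ ball x r, iteratedDeriv j (fun s : ℂ => f (z + s • v)) 0
      = iteratedFDeriv ℂ j f z (fun _ => v) := by
    intro j z hz
    have := hd.iteratedDeriv_line isOpen_ball z v j (s := 0) (by simpa using hmem0 z hz)
    simpa using this
  refine ⟨fun j z => (j.factorial : ℂ)⁻¹ • iteratedFDeriv ℂ j f z (fun _ => v), r, M, hr, hM,
    fun j => ?_, fun j z hz => ?_, fun z hz s hs => ?_⟩
  · refine (DifferentiableOn.analyticOnNhd_complex isOpen_ball ?_).mono fun z hz => hmem0 z hz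
    refine DifferentiableOn.const_smul ?_ _
    intro z hz
    have := ((hd.contDiffOn_complex isOpen_ball (j + 1)).contDiffAt
      (isOpen_ball.mem_nhds hz)).differentiableAt_iteratedFDeriv
        (by exact_mod_cast j.lt_succ_self)
    exact (this.continuousMultilinear_apply_const _).differentiableWithinAt
  · have h1 := Complex.norm_iteratedDeriv_le_of_forall_mem_sphere_norm_le j hr
      (DifferentiableOn.diffContOnCl_ball (hline z hz) (closedBall_subset_ball (by linarith)))
      (C := M) fun s hs => hb _ (hmem z hz s (by
        rw [mem_sphere_zero_iff_norm] at hs; rw [mem_ball_zero_iff]; linarith))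
    rw [hit j z hz] at h1
    have hj : (0 : ℝ) < j.factorial := by exact_mod_cast j.factorial_pos
    rw [norm_smul, norm_inv, Complex.norm_natCast, inv_mul_le_iff₀ hj]
    exact h1.trans (le_of_eq (by ring))
  · have := Complex.hasSum_taylorSeries_on_ball (hline z hz) (z := s)
      (by rw [mem_ball_zero_iff]; linarith)
    refine this.congr_fun fun j => ?_
    rw [hit j z hz, sub_zero, smul_comm]

/-- An analytic map that vanishes on a hyperplane is divisible by the equation of the
hyperplane. -/
theorem AnalyticAt.exists_eq_smul_of_eq_zero [FiniteDimensional ℂ E] [CompleteSpace F] {f : E → F}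
    (hf : AnalyticAt ℂ f 0) (l : E →L[ℂ] ℂ) {v : E} (hv : l v = 1)
    (h0 : ∀ᶠ z in 𝓝 0, l z = 0 → f z = 0) :
    ∃ g : E → F, AnalyticAt ℂ g 0 ∧ ∀ᶠ z in 𝓝 0, f z = l z • g z := by
  obtain ⟨c, r, M, hr, hM, hc, hb, hs⟩ := hf.exists_hasSum_direction v
  obtain ⟨r', hr', h0'⟩ := Metric.eventually_nhds_iff_ball.mp h0
  -- The projection onto the kernel of `l` along `v`. The Taylor series at `π z` in the direction
  -- `v`, evaluated at `s = l z`, has no constant term because `f` vanishes on the kernel; hence a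
  -- factor `l z` splits off.
  let π : E →L[ℂ] E := ContinuousLinearMap.id ℂ E - l.smulRight v
  have hπ : ∀ z, π z = z - l z • v := fun z => by simp [π]
  have hlπ : ∀ z, l (π z) = 0 := fun z => by simp [hπ, hv]
  set U : Set E := {z | π z ∈ ball 0 r ∧ π z ∈ ball 0 r' ∧ ‖l z‖ < r / 2} with hUdef
  have hU : IsOpen U :=
    (isOpen_ball.preimage π.continuous).inter ((isOpen_ball.preimage π.continuous).inter
      (isOpen_lt l.continuous.norm continuous_const))
  have h0U : (0 : E) ∈ U := by simp [hUdef, hr, hr']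
  have hbd : ∀ j, ∀ z ∈ U, ‖l z ^ j • c (j + 1) (π z)‖ ≤ M / r * (1 / 2) ^ j := by
    intro j z hz
    rw [norm_smul, norm_pow]
    calc ‖l z‖ ^ j * ‖c (j + 1) (π z)‖ ≤ (r / 2) ^ j * (M / r ^ (j + 1)) := by
          gcongr
          · exact hz.2.2.le
          · exact hb _ _ hz.1
      _ = _ := by rw [div_pow, pow_succ, one_div, inv_pow]; field_simp
  have han := analyticOnNhd_tsum_of_bound hU (f := fun j z => l z ^ j • c (j + 1) (π z))
    (fun j z hz => ((l.analyticAt z).pow j).smul ((hc (j + 1) _ hz.1).comp (π.analyticAt z)))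
    ((summable_geometric_two).mul_left (M / r)) hbd
  refine ⟨_, han 0 h0U, ?_⟩
  filter_upwards [hU.mem_nhds h0U] with z hz
  have h1 := hs (π z) hz.1 (l z) (by linarith [hz.2.2])
  have hc0 : c 0 (π z) = 0 := by
    have h2 := hs (π z) hz.1 0 (by simpa using hr)
    have h3 := h2.unique (hasSum_single 0 fun j hj => by simp [hj])
    have h4 := h0' (π z) hz.2.1 (hlπ z)
    simp only [zero_smul, add_zero, pow_zero, one_smul] at h3
    rw [← h3, h4]
  rw [hπ, sub_add_cancel] at h1
  rw [← hπ] at h1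
  have h5 := (hasSum_nat_add_iff' 1).mpr h1
  simp only [Finset.range_one, Finset.sum_singleton, hc0, smul_zero, sub_zero] at h5
  rw [← h5.tsum_eq, ← tsum_const_smul'']
  congr 1
  ext j
  rw [smul_smul, pow_succ']

/-- An analytic function of two variables is a power series in the first variable, the
coefficients of which are analytic in the second. -/
theorem AnalyticAt.exists_hasSum_pow_fst {g : ℂ × ℂ → ℂ} (hg : AnalyticAt ℂ g 0) :
    ∃ a : ℕ → ℂ → ℂ, (∀ j, AnalyticAt ℂ (a j) 0) ∧
      ∀ᶠ w in 𝓝 (0 : ℂ × ℂ), HasSum (fun j => a j w.2 * w.1 ^ j) (g w) := by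
  obtain ⟨c, r, M, hr, hM, hc, hb, hs⟩ := hg.exists_hasSum_direction ((1, 0) : ℂ × ℂ)
  refine ⟨fun j y => c j (0, y), fun j => ?_, ?_⟩
  · exact AnalyticAt.fun_comp (g := c j) (f := fun y : ℂ => ((0 : ℂ), y))
      (hc j _ (mem_ball_self hr)) (by fun_prop)
  · filter_upwards [ball_mem_nhds (0 : ℂ × ℂ) hr] with w hw
    rw [mem_ball_zero_iff, Prod.norm_def, max_lt_iff] at hw
    have := hs (0, w.2) (by simpa using hw.2) w.1 hw.1
    have e : ((0, w.2) : ℂ × ℂ) + w.1 • ((1, 0) : ℂ × ℂ) = w := by ext <;> simp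
    rw [e] at this
    exact this.congr_fun fun j => by rw [smul_eq_mul, mul_comm]

end SeveralVariablesAnalytic

/-! ### The cohomological equation and the elimination of nonresonant terms. -/

section NormalFormAlgebra

/-- Solves `b (t, y) - μ t * b (t, ν t * y) = R (t, y)` for `R` vanishing on `y = 0`. -/
theorem exists_analyticAt_sub_mul_comp_eq {μ ν : ℂ → ℂ} {R : ℂ × ℂ → ℂ}
    (hμ : AnalyticAt ℂ μ 0) (hν : AnalyticAt ℂ ν 0) (hR : AnalyticAt ℂ R 0) (hν0 : ‖ν 0‖ < 1)
    (hμν : ‖μ 0‖ * ‖ν 0‖ < 1) (hR0 : ∀ᶠ t in 𝓝 0, R (t, 0) = 0) :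
    ∃ b : ℂ × ℂ → ℂ, AnalyticAt ℂ b 0 ∧ (∀ᶠ t in 𝓝 0, b (t, 0) = 0) ∧
      ∀ᶠ p in 𝓝 (0 : ℂ × ℂ), b p - μ p.1 * b (p.1, ν p.1 * p.2) = R p := by
  have hfst : Filter.Tendsto (Prod.fst : ℂ × ℂ → ℂ) (𝓝 0) (𝓝 0) := continuous_fst.tendsto' _ _ rfl
  -- The solution will be the series of `μ^k * R (t, ν^k * y)`. Writing `R = y * R₁` supplies a
  -- factor `ν^k`, so the terms decay like a geometric series of ratio below 1 even if `‖μ 0‖ ≥ 1`.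
  obtain ⟨R₁, hR₁, hRR⟩ := hR.exists_eq_smul_of_eq_zero (ContinuousLinearMap.snd ℂ ℂ ℂ)
    (v := (0, 1)) (by simp) (by
      filter_upwards [hfst.eventually hR0] with p hp h
      have : p = (p.1, 0) := Prod.ext rfl (by simpa using h)
      rw [this]; exact hp)
  obtain ⟨r₁, M, hr₁, hM, -, hM₁⟩ := hR₁.exists_ball_bound
  obtain ⟨κ, hκ, hκ1⟩ := exists_between hμν
  have hκ0 : 0 ≤ κ := (by positivity : 0 ≤ ‖μ 0‖ * ‖ν 0‖).trans hκ.le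
  have e1 : ∀ᶠ t in 𝓝 (0 : ℂ), ‖ν t‖ < 1 := hν.continuousAt.norm.eventually_lt_const hν0
  have e2 : ∀ᶠ t in 𝓝 (0 : ℂ), ‖μ t‖ * ‖ν t‖ < κ :=
    (hμ.continuousAt.norm.mul hν.continuousAt.norm).eventually_lt_const hκ
  obtain ⟨r₂, hr₂, h₂⟩ := Metric.eventually_nhds_iff_ball.mp
    (hRR.and (hR.eventually_analyticAt.and (hfst.eventually (e1.and (e2.and
      (hμ.eventually_analyticAt.and hν.eventually_analyticAt))))))
  set r := min r₁ r₂
  have hr : 0 < r := lt_min hr₁ hr₂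
  have h₂' : ∀ p ∈ Metric.ball (0 : ℂ × ℂ) r, _ := fun p hp =>
    h₂ p (Metric.ball_subset_ball (min_le_right _ _) hp)
  have hM₁' : ∀ p ∈ Metric.ball (0 : ℂ × ℂ) r, _ := fun p hp =>
    hM₁ p (Metric.ball_subset_ball (min_le_left _ _) hp)
  have hpow : ∀ k : ℕ, ∀ p ∈ Metric.ball (0 : ℂ × ℂ) r, ‖ν p.1 ^ k * p.2‖ ≤ ‖ν p.1‖ ^ k * r ∧
      (p.1, ν p.1 ^ k * p.2) ∈ Metric.ball (0 : ℂ × ℂ) r := by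
    intro k p hp
    have hν1 := (h₂' p hp).2.2.1
    rw [mem_ball_zero_iff, Prod.norm_def, max_lt_iff] at hp ⊢
    rw [norm_mul, norm_pow]
    refine ⟨by gcongr; exact hp.2.le, hp.1, ?_⟩
    calc _ = ‖ν p.1‖ ^ k * ‖p.2‖ := by simp
      _ ≤ 1 * ‖p.2‖ := by gcongr; exact pow_le_one₀ (norm_nonneg _) hν1.le
      _ < r := by linarith [hp.2]
  have hbd : ∀ k : ℕ, ∀ p ∈ Metric.ball (0 : ℂ × ℂ) r,
      ‖μ p.1 ^ k * R (p.1, ν p.1 ^ k * p.2)‖ ≤ r * M * κ ^ k := by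
    intro k p hp
    obtain ⟨hle, hmem⟩ := hpow k p hp
    rw [(h₂' _ hmem).1, norm_mul, norm_pow, smul_eq_mul, norm_mul]
    calc ‖μ p.1‖ ^ k * (‖ν p.1 ^ k * p.2‖ * ‖R₁ (p.1, ν p.1 ^ k * p.2)‖)
        ≤ ‖μ p.1‖ ^ k * (‖ν p.1‖ ^ k * r * M) := by
          gcongr
          exact hM₁' _ hmem
      _ = r * M * (‖μ p.1‖ * ‖ν p.1‖) ^ k := by rw [mul_pow]; ring
      _ ≤ r * M * κ ^ k := by
          gcongr
          exact (h₂' p hp).2.2.2.1.le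
  have hsum : Summable fun k : ℕ => r * M * κ ^ k :=
    (summable_geometric_of_lt_one hκ0 hκ1).mul_left _
  have h0 : (0 : ℂ × ℂ) ∈ Metric.ball (0 : ℂ × ℂ) r := Metric.mem_ball_self hr
  have han : AnalyticOnNhd ℂ (fun p : ℂ × ℂ => ∑' k : ℕ, μ p.1 ^ k * R (p.1, ν p.1 ^ k * p.2))
      (Metric.ball 0 r) := by
    refine analyticOnNhd_tsum_of_bound Metric.isOpen_ball (fun k p hp => ?_) hsum hbd
    have hm := hpow k p hp
    have h1 : AnalyticAt ℂ (fun p : ℂ × ℂ => μ p.1) p :=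
      AnalyticAt.fun_comp (g := μ) (h₂' p hp).2.2.2.2.1 analyticAt_fst
    have h2 : AnalyticAt ℂ (fun p : ℂ × ℂ => ν p.1) p :=
      AnalyticAt.fun_comp (g := ν) (h₂' p hp).2.2.2.2.2 analyticAt_fst
    have h3 : AnalyticAt ℂ (fun p : ℂ × ℂ => R (p.1, ν p.1 ^ k * p.2)) p :=
      AnalyticAt.fun_comp (g := R) (f := fun p : ℂ × ℂ => (p.1, ν p.1 ^ k * p.2))
        (h₂' _ hm.2).2.1 (analyticAt_fst.prod ((h2.pow k).mul analyticAt_snd))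
    exact (h1.pow k).mul h3
  refine ⟨_, han 0 h0, ?_, ?_⟩
  · filter_upwards [hR0] with t ht
    simp [ht]
  · filter_upwards [Metric.ball_mem_nhds (0 : ℂ × ℂ) hr] with p hp
    have hs : Summable fun k : ℕ => μ p.1 ^ k * R (p.1, ν p.1 ^ k * p.2) :=
      Summable.of_norm_bounded hsum fun k => hbd k p hp
    rw [hs.tsum_eq_zero_add, ← tsum_mul_left]
    have : ∀ k : ℕ, μ p.1 * (μ p.1 ^ k * R (p.1, ν p.1 ^ k * (ν p.1 * p.2)))
        = μ p.1 ^ (k + 1) * R (p.1, ν p.1 ^ (k + 1) * p.2) := fun k => by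
      rw [pow_succ (ν p.1), mul_assoc (ν p.1 ^ k), pow_succ' (μ p.1)]; ring
    simp [this]

/-- Formal elimination of the nonresonant terms: if `φ ξ = lam ξ` modulo `ξ ^ 2` and the linearized
equations can be solved modulo `ξ`, then `ξ` can be corrected to an element on which `φ` is in
normal form modulo `ξ ^ (2 * q + 2)`. -/
theorem exists_normalForm_mod {R : Type*} [CommRing R] (φ : R →+* R) {q : ℕ} (hq : 0 < q)
    {lam ξ : R} (hξ : ξ ^ 2 ∣ φ ξ - lam * ξ) (S : AddSubgroup R)
    (hsolve : ∀ j, 2 ≤ j → j ≤ 2 * q + 1 → ∀ r, ∃ b, ∃ c ∈ S, (¬ q ∣ j - 1 → c = 0) ∧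
      ξ ∣ lam * b - lam ^ j * φ b + lam * c - r) :
    ∃ P, ∃ A ∈ S, ∃ C ∈ S, ξ ^ 2 ∣ P - ξ ∧
      ξ ^ (2 * q + 2) ∣ φ P - lam * (P + A * P ^ (q + 1) + C * P ^ (2 * q + 1)) := by
  suffices H : ∀ j, 2 ≤ j → j ≤ 2 * q + 2 → ∃ P, ∃ A ∈ S, ∃ C ∈ S, ξ ^ 2 ∣ P - ξ ∧
      ξ ^ j ∣ φ P - lam * (P + A * P ^ (q + 1) + C * P ^ (2 * q + 1)) from
    H _ (by omega) le_rfl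
  intro j hj
  induction j, hj using Nat.le_induction with
  | base =>
    intro _
    exact ⟨ξ, 0, S.zero_mem, 0, S.zero_mem, by simp, by simpa using hξ⟩
  | succ j hj ih =>
    intro hj'
    obtain ⟨P, A, hA, C, hC, hP, r, hr⟩ := ih (by omega)
    obtain ⟨b, c, hc, hcq, s, hs⟩ := hsolve j hj (by omega) (-r)
    have hξP : ξ ∣ P := by
      have h1 : ξ ∣ P - ξ := (Dvd.intro_left (ξ ^ 1) (by ring)).trans hP
      simpa using dvd_add h1 (dvd_refl ξ)
    obtain ⟨e, he⟩ := hξ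
    have hφξ : φ ξ = ξ * (lam + ξ * e) := by linear_combination he
    -- This changes the error at order `j` by `lam * b - lam ^ j * φ b`. By the choice of `b` what
    -- remains there is `-lam * c`, which at a resonant order is absorbed into `A` or `C`.
    set P' := P - b * ξ ^ j with hP'
    have hPP' : ξ ^ 2 ∣ P' - ξ := by
      rw [hP', sub_right_comm]
      exact dvd_sub hP (dvd_mul_of_dvd_right (pow_dvd_pow _ hj) _)
    have hξP' : ξ ∣ P' := by
      rw [hP']
      exact dvd_sub hξP (dvd_mul_of_dvd_right (dvd_pow_self _ (by omega)) _)
    -- The nonlinear terms do not see the correction at order `j`: `P` and `P'` differ by a multiple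
    -- of `ξ ^ j`, and for `k ≥ 2` the cofactor of `P - P'` is divisible by `ξ`.
    have hpow : ∀ k, 2 ≤ k → ξ ^ (j + 1) ∣ P ^ k - P' ^ k := by
      intro k hk
      rw [← Commute.geom_sum₂_mul (Commute.all P P') k, show P - P' = b * ξ ^ j by rw [hP']; ring]
      have h1 : ξ ∣ ∑ i ∈ Finset.range k, P ^ i * P' ^ (k - 1 - i) := by
        refine Finset.dvd_sum fun i hi => ?_
        rcases Nat.eq_zero_or_pos i with rfl | hi0
        · exact dvd_mul_of_dvd_right (dvd_pow hξP' (by omega)) _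
        · exact dvd_mul_of_dvd_left (dvd_pow hξP (by omega)) _
      obtain ⟨w, hw⟩ := h1
      exact ⟨w * b, by rw [hw]; ring⟩
    have hcj : ξ ^ (j + 1) ∣ c * ξ ^ j - c * P' ^ j := by
      rw [← mul_sub]
      refine dvd_mul_of_dvd_right ?_ _
      rw [← Commute.geom_sum₂_mul (Commute.all ξ P') j]
      have h1 : ξ ^ (j - 1) ∣ ∑ i ∈ Finset.range j, ξ ^ i * P' ^ (j - 1 - i) := by
        refine Finset.dvd_sum fun i hi => ?_
        have : j - 1 = i + (j - 1 - i) := by have := Finset.mem_range.mp hi; omega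
        conv_lhs => rw [this, pow_add]
        exact mul_dvd_mul_left _ (pow_dvd_pow_of_dvd hξP' _)
      rw [show j + 1 = (j - 1) + 2 by omega, pow_add]
      exact mul_dvd_mul h1 ((dvd_neg.mpr hPP').trans (by simp))
    have hφj : ξ ^ (j + 1) ∣ φ b * ξ ^ j * lam ^ j - φ (b * ξ ^ j) := by
      rw [map_mul, map_pow, hφξ, mul_pow, mul_assoc, ← mul_sub, ← mul_sub]
      refine dvd_mul_of_dvd_right ?_ _
      rw [pow_succ]
      refine mul_dvd_mul_left _ ?_
      have h1 : lam - (lam + ξ * e) ∣ lam ^ j - (lam + ξ * e) ^ j := sub_dvd_pow_sub_pow _ _ _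
      exact (Dvd.intro (-e) (by ring)).trans h1
    have main : ξ ^ (j + 1) ∣ φ P' - lam * (P' + A * P' ^ (q + 1) + C * P' ^ (2 * q + 1)
        - c * P' ^ j) := by
      have e1 := dvd_mul_of_dvd_right (hpow (q + 1) (by omega)) (lam * A)
      have e2 := dvd_mul_of_dvd_right (hpow (2 * q + 1) (by omega)) (lam * C)
      have e3 := dvd_mul_of_dvd_right hcj lam
      have e4 : ξ ^ (j + 1) ∣ ξ ^ (j + 1) * s := dvd_mul_right _ _
      have hφP' : φ P' = φ P - φ (b * ξ ^ j) := by rw [hP', map_sub]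
      have : φ P' - lam * (P' + A * P' ^ (q + 1) + C * P' ^ (2 * q + 1) - c * P' ^ j)
          = lam * A * (P ^ (q + 1) - P' ^ (q + 1)) + lam * C * (P ^ (2 * q + 1) - P' ^ (2 * q + 1))
            - lam * (c * ξ ^ j - c * P' ^ j) + ξ ^ (j + 1) * s
            + (φ b * ξ ^ j * lam ^ j - φ (b * ξ ^ j)) := by
        rw [hφP', hP']
        linear_combination hr + ξ ^ j * hs
      rw [this]
      exact dvd_add (dvd_add (dvd_sub (dvd_add e1 e2) e3) e4) hφj
    by_cases h1 : j = q + 1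
    · refine ⟨P', A - c, S.sub_mem hA hc, C, hC, hPP', ?_⟩
      rw [h1] at main ⊢
      convert main using 1
      ring
    by_cases h2 : j = 2 * q + 1
    · refine ⟨P', A, hA, C - c, S.sub_mem hC hc, hPP', ?_⟩
      rw [h2] at main ⊢
      convert main using 1
      ring
    -- For `2 ≤ j ≤ 2 * q + 1` the only multiples of `q` that `j - 1` can equal are `q` and `2 * q`,
    -- both excluded here.
    · have h3 : ¬ q ∣ j - 1 := by
        rintro ⟨k, hk⟩
        have hk0 : k ≠ 0 := by rintro rfl; omega
        have hk3 : k < 3 := by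
          by_contra h
          have : q * 3 ≤ q * k := Nat.mul_le_mul_left q (by omega)
          omega
        interval_cases k <;> omega
      refine ⟨P', A, hA, C, hC, hPP', ?_⟩
      rw [hcq h3] at main
      simpa using main

end NormalFormAlgebra

/-! ### Normal form of the first coordinate, computed in the ring of germs. -/

section NormalFormFunction

open Filter

/-- Functions on a complex normed space that are analytic at the origin. -/
def analyticAtZero (E : Type*) [NormedAddCommGroup E] [NormedSpace ℂ E] : Subring (E → ℂ) where
  carrier := {f | AnalyticAt ℂ f 0}
  mul_mem' := fun hf hg => hf.mul hg
  add_mem' := fun hf hg => hf.add hg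
  one_mem' := analyticAt_const
  zero_mem' := analyticAt_const
  neg_mem' := fun hf => hf.neg

/-- The ideal of the functions that vanish near the origin. -/
def germNull (E : Type*) [NormedAddCommGroup E] [NormedSpace ℂ E] : Ideal (analyticAtZero E) where
  carrier := {f | ∀ᶠ z in 𝓝 (0 : E), (f : E → ℂ) z = 0}
  add_mem' := fun hf hg => by
    filter_upwards [hf, hg] with z h1 h2
    simp [h1, h2]
  zero_mem' := by simp
  smul_mem' := fun c f hf => by
    filter_upwards [hf] with z h1
    simp [h1]

/-- Composition with a map that is analytic at the origin and fixes it. -/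
def analyticAtZeroComp {E : Type*} [NormedAddCommGroup E] [NormedSpace ℂ E] (F : E → E)
    (hF : AnalyticAt ℂ F 0) (hF0 : F 0 = 0) : analyticAtZero E →+* analyticAtZero E where
  toFun f := ⟨fun z => (f : E → ℂ) (F z), by
    have hf : AnalyticAt ℂ (f : E → ℂ) 0 := f.2
    rw [← hF0] at hf
    exact AnalyticAt.fun_comp hf hF⟩
  map_one' := rfl
  map_mul' _ _ := rfl
  map_zero' := rfl
  map_add' _ _ := rfl

theorem analyticAtZero_mk_eq_mk {E : Type*} [NormedAddCommGroup E] [NormedSpace ℂ E]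
    {f g : analyticAtZero E} : Ideal.Quotient.mk (germNull E) f = Ideal.Quotient.mk (germNull E) g ↔
      ∀ᶠ z in 𝓝 (0 : E), (f : E → ℂ) z = (g : E → ℂ) z := by
  rw [Ideal.Quotient.eq]
  change (∀ᶠ z in 𝓝 (0 : E), (f : E → ℂ) z - (g : E → ℂ) z = 0) ↔ _
  simp only [sub_eq_zero]

/-- The parameterized normal form for a family of maps in coordinates in which the strong stable
manifold is `x = 0` and the family is linear along it. -/
theorem exists_normalForm_coordinate {q : ℕ} (hq : 0 < q) {lam : ℂ} (hlam : IsPrimitiveRoot lam q)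
    {ν : ℂ → ℂ} (hν : AnalyticAt ℂ ν 0) (hν0 : ‖ν 0‖ < 1) {a h : ℂ × ℂ × ℂ → ℂ}
    (ha : AnalyticAt ℂ a 0) (hh : AnalyticAt ℂ h 0)
    (ha0 : ∀ᶠ t in 𝓝 (0 : ℂ), a (t, 0, 0) = (1 + t) * lam) :
    ∃ (U G : ℂ × ℂ × ℂ → ℂ) (A C : ℂ → ℂ), AnalyticAt ℂ U 0 ∧ U 0 ≠ 0 ∧ AnalyticAt ℂ G 0 ∧
      AnalyticAt ℂ A 0 ∧ AnalyticAt ℂ C 0 ∧ ∀ᶠ p in 𝓝 (0 : ℂ × ℂ × ℂ),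
        (p.2.1 * a p) * U (p.1, p.2.1 * a p, ν p.1 * p.2.2 + p.2.1 * h p)
          = (1 + p.1) * lam * (p.2.1 * U p + A p.1 * (p.2.1 * U p) ^ (q + 1)
            + C p.1 * (p.2.1 * U p) ^ (2 * q + 1)) + p.2.1 ^ (2 * q + 2) * G p := by
  have hlam0 : lam ≠ 0 := hlam.ne_zero hq.ne'
  have hlam1 : ‖lam‖ = 1 := hlam.norm'_eq_one hq.ne'
  have hlamt : AnalyticAt ℂ (fun t : ℂ => (1 + t) * lam) 0 := by fun_prop
  have hlamt0 : ∀ᶠ t in 𝓝 (0 : ℂ), (1 + t) * lam ≠ 0 :=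
    hlamt.continuousAt.eventually_ne (by simpa using hlam0)
  have hνE : AnalyticAt ℂ (fun p : ℂ × ℂ × ℂ => ν p.1) 0 :=
    AnalyticAt.fun_comp (g := ν) (f := fun p : ℂ × ℂ × ℂ => p.1) hν analyticAt_fst
  let F : ℂ × ℂ × ℂ → ℂ × ℂ × ℂ := fun p => (p.1, p.2.1 * a p, ν p.1 * p.2.2 + p.2.1 * h p)
  have hF : AnalyticAt ℂ F 0 := by
    refine analyticAt_fst.prod (AnalyticAt.prod (AnalyticAt.mul (by fun_prop) ha) ?_)
    exact (hνE.mul (by fun_prop)).add (AnalyticAt.mul (by fun_prop) hh)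
  have hF0 : F 0 = 0 := by simp [F]
  have hFt : Tendsto F (𝓝 0) (𝓝 0) := by simpa [hF0] using hF.continuousAt.tendsto
  have hfst : Tendsto (fun p : ℂ × ℂ × ℂ => p.1) (𝓝 0) (𝓝 0) := continuous_fst.tendsto' _ _ rfl
  have hty : Tendsto (fun p : ℂ × ℂ × ℂ => (p.1, p.2.2)) (𝓝 0) (𝓝 0) :=
    Continuous.tendsto' (by fun_prop) _ _ rfl
  -- restriction to `x = 0` and extension from it
  have hres : ∀ f : ℂ × ℂ × ℂ → ℂ, AnalyticAt ℂ f 0 → AnalyticAt ℂ (fun p : ℂ × ℂ => f (p.1, 0, p.2)) 0 :=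
    fun f hf => AnalyticAt.fun_comp (g := f) (f := fun p : ℂ × ℂ => (p.1, (0 : ℂ), p.2)) hf
      (by fun_prop)
  have hres0 : ∀ f : ℂ × ℂ × ℂ → ℂ, AnalyticAt ℂ f 0 → AnalyticAt ℂ (fun t : ℂ => f (t, 0, 0)) 0 :=
    fun f hf => AnalyticAt.fun_comp (g := f) (f := fun p : ℂ => (p, (0 : ℂ), (0 : ℂ))) hf
      (by fun_prop)
  have hext : ∀ f : ℂ × ℂ → ℂ, AnalyticAt ℂ f 0 → AnalyticAt ℂ (fun p : ℂ × ℂ × ℂ => f (p.1, p.2.2)) 0 :=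
    fun f hf => AnalyticAt.fun_comp (g := f) (f := fun p : ℂ × ℂ × ℂ => (p.1, p.2.2)) hf (by fun_prop)
  have hext0 : ∀ f : ℂ → ℂ, AnalyticAt ℂ f 0 → AnalyticAt ℂ (fun p : ℂ × ℂ × ℂ => f p.1) 0 :=
    fun f hf => AnalyticAt.fun_comp (g := f) (f := fun p : ℂ × ℂ × ℂ => p.1) hf (by fun_prop)
  have hdiv : ∀ f : ℂ × ℂ × ℂ → ℂ, AnalyticAt ℂ f 0 → (∀ᶠ p in 𝓝 (0 : ℂ × ℂ), f (p.1, 0, p.2) = 0) →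
      ∃ g : ℂ × ℂ × ℂ → ℂ, AnalyticAt ℂ g 0 ∧ ∀ᶠ p in 𝓝 (0 : ℂ × ℂ × ℂ), f p = p.2.1 * g p := by
    intro f hf h0
    obtain ⟨g, hg, hfg⟩ := hf.exists_eq_smul_of_eq_zero
      ((ContinuousLinearMap.fst ℂ ℂ ℂ).comp (ContinuousLinearMap.snd ℂ ℂ (ℂ × ℂ)))
      (v := (0, 1, 0)) (by simp) (by
        filter_upwards [hty.eventually h0] with p hp hp0
        have : p = (p.1, 0, p.2.2) := by
          refine Prod.ext rfl (Prod.ext ?_ rfl)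
          simpa using hp0
        rw [this]; exact hp)
    exact ⟨g, hg, hfg⟩
  -- the ring of germs
  let N := germNull (ℂ × ℂ × ℂ)
  let φA := analyticAtZeroComp F hF hF0
  have hφN : N ≤ N.comap φA := fun f hf => hFt.eventually hf
  let φ : (analyticAtZero (ℂ × ℂ × ℂ) ⧸ N) →+* (analyticAtZero (ℂ × ℂ × ℂ) ⧸ N) := Ideal.quotientMap N φA hφN
  let mk : (f : ℂ × ℂ × ℂ → ℂ) → AnalyticAt ℂ f 0 → analyticAtZero (ℂ × ℂ × ℂ) ⧸ N := fun f hf =>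
    Ideal.Quotient.mk N ⟨f, hf⟩
  have hmk : ∀ {f g : ℂ × ℂ × ℂ → ℂ} (hf : AnalyticAt ℂ f 0) (hg : AnalyticAt ℂ g 0),
      mk f hf = mk g hg ↔ ∀ᶠ z in 𝓝 (0 : ℂ × ℂ × ℂ), f z = g z := fun hf hg => analyticAtZero_mk_eq_mk
  have hsurj : ∀ r : analyticAtZero (ℂ × ℂ × ℂ) ⧸ N, ∃ (f : ℂ × ℂ × ℂ → ℂ) (hf : AnalyticAt ℂ f 0), r = mk f hf := by
    intro r
    obtain ⟨f, rfl⟩ := Ideal.Quotient.mk_surjective r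
    exact ⟨f, f.2, rfl⟩
  -- linearization of the `x`-coordinate along `x = 0`
  obtain ⟨v, hv, -, hveq⟩ := exists_analyticAt_sub_mul_comp_eq (μ := fun _ => 1) (ν := ν)
    (R := fun p => Complex.log (a (p.1, 0, p.2) / ((1 + p.1) * lam))) analyticAt_const hν
    (by
      refine AnalyticAt.clog ((hres a ha).div (by fun_prop) (by simpa using hlam0)) ?_
      have : a (0, 0, 0) = lam := by simpa using ha0.self_of_nhds
      simp [this, hlam0]) hν0 (by simpa using hν0) (by
      filter_upwards [ha0, hlamt0] with t h1 h2
      simp only [h1, div_self h2, Complex.log_one])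
  let u : ℂ × ℂ × ℂ → ℂ := fun p => Complex.exp (v (p.1, p.2.2))
  have hu : AnalyticAt ℂ u 0 := (hext v hv).cexp
  have hune : ∀ p, u p ≠ 0 := fun p => Complex.exp_ne_zero _
  have hui : AnalyticAt ℂ (fun p => (u p)⁻¹) 0 := hu.inv (hune 0)
  have hx : AnalyticAt ℂ (fun p : ℂ × ℂ × ℂ => p.2.1) 0 := by fun_prop
  have hcomp : ∀ {f : ℂ × ℂ × ℂ → ℂ}, AnalyticAt ℂ f 0 → AnalyticAt ℂ (fun p => f (F p)) 0 := fun {f} hf =>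
    (analyticAtZeroComp F hF hF0 ⟨f, hf⟩).2
  have hL : AnalyticAt ℂ (fun p : ℂ × ℂ × ℂ => (1 + p.1) * lam) 0 := by fun_prop
  let ξ := mk _ (hx.mul hu)
  let Λ := mk _ hL
  have hφ : ∀ {f : ℂ × ℂ × ℂ → ℂ} (hf : AnalyticAt ℂ f 0), φ (mk f hf) = mk _ (hcomp hf) := fun hf => rfl
  have hmul : ∀ {f g : ℂ × ℂ × ℂ → ℂ} (hf : AnalyticAt ℂ f 0) (hg : AnalyticAt ℂ g 0),
    mk f hf * mk g hg = mk _ (hf.mul hg) := fun _ _ => rfl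
  have hadd : ∀ {f g : ℂ × ℂ × ℂ → ℂ} (hf : AnalyticAt ℂ f 0) (hg : AnalyticAt ℂ g 0),
    mk f hf + mk g hg = mk _ (hf.add hg) := fun _ _ => rfl
  have hsub : ∀ {f g : ℂ × ℂ × ℂ → ℂ} (hf : AnalyticAt ℂ f 0) (hg : AnalyticAt ℂ g 0),
    mk f hf - mk g hg = mk _ (hf.sub hg) := fun _ _ => rfl
  have hpow : ∀ {f : ℂ × ℂ × ℂ → ℂ} (hf : AnalyticAt ℂ f 0) (n : ℕ),
    mk f hf ^ n = mk _ (hf.pow n) := fun _ _ => rfl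
  -- `ξ` is `x` times the unit `u`, so divisibility by powers of `ξ` and of `x` agree; this
  -- direction and `hξx` translate between the ring and functions.
  have hxξ : ∀ {f : ℂ × ℂ × ℂ → ℂ} (hf : AnalyticAt ℂ f 0) (k : ℕ),
      (∃ g : ℂ × ℂ × ℂ → ℂ, AnalyticAt ℂ g 0 ∧ ∀ᶠ p in 𝓝 (0 : ℂ × ℂ × ℂ), f p = p.2.1 ^ k * g p) →
      ξ ^ k ∣ mk f hf := by
    rintro f hf k ⟨g, hg, hfg⟩
    refine ⟨mk _ ((hui.pow k).mul hg), ?_⟩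
    simp only [ξ, hpow, hmul]
    rw [hmk]
    filter_upwards [hfg] with p hp
    have := hune p
    have h1 : u p ^ k * (u p)⁻¹ ^ k = 1 := by rw [← mul_pow, mul_inv_cancel₀ this, one_pow]
    simp only [Pi.mul_apply, Pi.pow_apply, hp]
    linear_combination -(p.2.1 ^ k * g p) * h1
  have hξx : ∀ {f : ℂ × ℂ × ℂ → ℂ} (hf : AnalyticAt ℂ f 0) (k : ℕ), ξ ^ k ∣ mk f hf →
      ∃ g : ℂ × ℂ × ℂ → ℂ, AnalyticAt ℂ g 0 ∧ ∀ᶠ p in 𝓝 (0 : ℂ × ℂ × ℂ), f p = p.2.1 ^ k * g p := by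
    rintro f hf k ⟨w, hw⟩
    obtain ⟨g, hg, rfl⟩ := hsurj w
    simp only [ξ, hpow, hmul, hmk] at hw
    refine ⟨_, (hu.pow k).mul hg, ?_⟩
    filter_upwards [hw] with p hp
    rw [hp]
    simp only [Pi.mul_apply, Pi.pow_apply]
    ring
  -- With `u = exp v`, the equation for `v` says `a * (u ∘ F) = (1 + t) * lam * u` on `x = 0`. The
  -- difference is thus divisible by `x`, in addition to the factor `x` carried by `ξ`.
  have hξ : ξ ^ 2 ∣ φ ξ - Λ * ξ := by
    simp only [ξ, Λ, hφ, hmul, hsub]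
    refine hxξ _ 2 ?_
    obtain ⟨g, hg, hfg⟩ := hdiv (fun p => a p * u (F p) - (1 + p.1) * lam * u p)
      ((ha.mul (hcomp hu)).sub (hL.mul hu)) (by
        have h1 : ∀ᶠ p in 𝓝 (0 : ℂ × ℂ), a (p.1, 0, p.2) ≠ 0 :=
          (hres a ha).continuousAt.eventually_ne (by
            have : a (0, 0, 0) = lam := by simpa using ha0.self_of_nhds
            simpa [this] using hlam0)
        have h2 : ∀ᶠ p in 𝓝 (0 : ℂ × ℂ), (1 + p.1) * lam ≠ 0 :=
          (continuous_fst.tendsto' (0 : ℂ × ℂ) 0 rfl).eventually hlamt0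
        filter_upwards [hveq, h1, h2] with p hp h1 h2
        have h3 : v p = v (p.1, ν p.1 * p.2) + Complex.log (a (p.1, 0, p.2) / ((1 + p.1) * lam)) := by
          linear_combination hp
        simp only [u, F, zero_mul, add_zero]
        rw [show v (p.1, p.2) = _ from h3, Complex.exp_add, Complex.exp_log (div_ne_zero h1 h2)]
        have h4 := mul_div_cancel₀ (a (p.1, 0, p.2)) h2
        linear_combination -Complex.exp (v (p.1, ν p.1 * p.2)) * h4)
    refine ⟨g, hg, ?_⟩
    filter_upwards [hfg] with p hp
    simp only [Pi.mul_apply, Pi.sub_apply]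
    simp only [F] at hp ⊢
    linear_combination p.2.1 * hp
  -- Germs depending on `t` alone: the coefficients kept in the normal form may not depend on `x` or
  -- `y`.
  let S : AddSubgroup (analyticAtZero (ℂ × ℂ × ℂ) ⧸ N) :=
    { carrier := {c | ∃ (f : ℂ → ℂ) (hf : AnalyticAt ℂ f 0), c = mk _ (hext0 f hf)}
      add_mem' := by
        rintro _ _ ⟨f, hf, rfl⟩ ⟨g, hg, rfl⟩
        exact ⟨_, hf.add hg, rfl⟩
      zero_mem' := ⟨fun _ => 0, analyticAt_const, rfl⟩
      neg_mem' := by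
        rintro _ ⟨f, hf, rfl⟩
        exact ⟨_, hf.neg, rfl⟩ }
  have hsolve : ∀ j, 2 ≤ j → j ≤ 2 * q + 1 → ∀ r, ∃ b, ∃ c ∈ S, (¬ q ∣ j - 1 → c = 0) ∧
      ξ ∣ Λ * b - Λ ^ j * φ b + Λ * c - r := by
    intro j hj2 hj r
    obtain ⟨r, hr, rfl⟩ := hsurj r
    -- The part of `r` on `x = 0` that vanishes at `y = 0`. At `t = 0` the factor `μ` has modulus 1,
    -- so the condition on `μ * ν` reduces to `‖ν 0‖ < 1`.
    obtain ⟨b₁, hb₁, -, hb₁eq⟩ := exists_analyticAt_sub_mul_comp_eq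
      (μ := fun t => ((1 + t) * lam) ^ (j - 1)) (ν := ν)
      (R := fun p => (r (p.1, 0, p.2) - r (p.1, 0, 0)) / ((1 + p.1) * lam)) (hlamt.pow _) hν
      (by
        refine AnalyticAt.div ((hres r hr).sub ?_) (by fun_prop) (by simpa using hlam0)
        exact AnalyticAt.fun_comp (g := fun t : ℂ => r (t, 0, 0)) (f := fun p : ℂ × ℂ => p.1)
          (hres0 r hr) analyticAt_fst)
      hν0 (by simpa [hlam1] using hν0) (by simp)
    -- The part of `r` constant in `y`. The divisor λ_t - λ_t^j is a unit at `t = 0` exactly off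
    -- resonance; at resonance the whole term goes into `c₀` for all `t`, so no small divisor
    -- appears.
    obtain ⟨b₀, hb₀, c₀, hc₀, hcq, hbc⟩ : ∃ b₀ : ℂ → ℂ, AnalyticAt ℂ b₀ 0 ∧
        ∃ c₀ : ℂ → ℂ, AnalyticAt ℂ c₀ 0 ∧ (¬ q ∣ j - 1 → c₀ = 0) ∧ ∀ᶠ t in 𝓝 (0 : ℂ),
          (1 + t) * lam * b₀ t - ((1 + t) * lam) ^ j * b₀ t + (1 + t) * lam * c₀ t
            = r (t, 0, 0) := by
      by_cases hqj : q ∣ j - 1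
      · refine ⟨0, analyticAt_const, fun t => r (t, 0, 0) / ((1 + t) * lam),
          (hres0 r hr).div hlamt (by simpa using hlam0), fun h => absurd hqj h, ?_⟩
        filter_upwards [hlamt0] with t ht
        simp only [Pi.zero_apply]
        rw [mul_div_cancel₀ _ ht]
        ring
      · have hne : (1 + (0 : ℂ)) * lam - ((1 + 0) * lam) ^ j ≠ 0 := by
          intro h0
          apply hqj
          rw [← hlam.pow_eq_one_iff_dvd]
          obtain ⟨k, rfl⟩ : ∃ k, j = k + 1 := ⟨j - 1, by omega⟩
          simp only [add_zero, one_mul, pow_succ] at h0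
          have : lam * (1 - lam ^ k) = 0 := by linear_combination h0
          rcases mul_eq_zero.mp this with h | h
          · exact absurd h hlam0
          · simpa using (sub_eq_zero.mp h).symm
        have hd : AnalyticAt ℂ (fun t : ℂ => (1 + t) * lam - ((1 + t) * lam) ^ j) 0 := by fun_prop
        refine ⟨fun t => r (t, 0, 0) / ((1 + t) * lam - ((1 + t) * lam) ^ j),
          (hres0 r hr).div hd hne, 0, analyticAt_const, fun _ => rfl, ?_⟩
        filter_upwards [hd.continuousAt.eventually_ne hne] with t ht
        simp only [Pi.zero_apply]
        field_simp
        ring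
    refine ⟨mk _ ((hext b₁ hb₁).add (hext0 b₀ hb₀)), mk _ (hext0 c₀ hc₀), ⟨c₀, hc₀, rfl⟩, ?_, ?_⟩
    · intro hn
      obtain rfl := hcq hn
      rfl
    · simp only [Λ, hφ, hmul, hsub, hadd, hpow]
      have := hxξ (((hL.mul ((hext b₁ hb₁).add (hext0 b₀ hb₀))).sub
        ((hL.pow j).mul (hcomp ((hext b₁ hb₁).add (hext0 b₀ hb₀))))).add
          (hL.mul (hext0 c₀ hc₀)) |>.sub hr) 1 (by
        simp only [pow_one]
        refine hdiv _ (((hL.mul ((hext b₁ hb₁).add (hext0 b₀ hb₀))).sub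
        ((hL.pow j).mul (hcomp ((hext b₁ hb₁).add (hext0 b₀ hb₀))))).add
          (hL.mul (hext0 c₀ hc₀)) |>.sub hr) ?_
        have hf : Tendsto (Prod.fst : ℂ × ℂ → ℂ) (𝓝 0) (𝓝 0) := continuous_fst.tendsto' _ _ rfl
        filter_upwards [hb₁eq, hf.eventually hbc, hf.eventually hlamt0] with p h1 h2 h3
        simp only [Pi.add_apply, Pi.sub_apply, Pi.mul_apply, Pi.pow_apply, F, zero_mul, add_zero,
          Prod.mk.eta]
        obtain ⟨k, rfl⟩ : ∃ k, j = k + 1 := ⟨j - 1, by omega⟩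
        rw [Nat.add_sub_cancel, eq_div_iff h3] at h1
        linear_combination h1 + h2)
      simpa only [pow_one] using this
  obtain ⟨P, A, ⟨A, hA, rfl⟩, C, ⟨C, hC, rfl⟩, hP, hmain⟩ :=
    exists_normalForm_mod φ hq hξ S hsolve
  obtain ⟨k, hk⟩ := hP
  obtain ⟨k, hk', rfl⟩ := hsurj k
  -- From `P = ξ + ξ ^ 2 * k` with `ξ = x * u`: the new coordinate is `x` times this unit.
  have hU : AnalyticAt ℂ (fun p : ℂ × ℂ × ℂ => u p * (1 + p.2.1 * u p * k p)) 0 :=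
    hu.mul (analyticAt_const.add ((hx.mul hu).mul hk'))
  have hPU : P = mk _ (hx.mul hU) := by
    rw [sub_eq_iff_eq_add.mp hk]
    simp only [ξ, hpow, hmul, hadd]
    rw [hmk]
    filter_upwards with p
    simp only [Pi.add_apply, Pi.mul_apply, Pi.pow_apply]
    ring
  rw [hPU] at hmain
  simp only [Λ, hφ, hpow, hmul, hadd, hsub] at hmain
  obtain ⟨G, hG, hGeq⟩ := hξx _ _ hmain
  refine ⟨_, G, A, C, hU, by simpa using hune 0, hG, hA, hC, ?_⟩
  filter_upwards [hGeq] with p hp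
  simp only [Pi.add_apply, Pi.sub_apply, Pi.mul_apply, Pi.pow_apply, F] at hp ⊢
  linear_combination hp

end NormalFormFunction

/-! ### Families of germs and families of local charts. -/

section FamilyGerms

open Filter

/-- A germ at the origin of a map `(t, z) ↦ (t, f t z)`, where `f t` is an analytic family of germs
of maps of `ℂ²` that fix the origin. -/
structure FamilyGerm (f : ℂ × ℂ × ℂ → ℂ × ℂ × ℂ) : Prop where
  analyticAt : AnalyticAt ℂ f 0
  fst_eq : ∀ᶠ p in 𝓝 (0 : ℂ × ℂ × ℂ), (f p).1 = p.1
  map_zero : ∀ᶠ t in 𝓝 (0 : ℂ), f (t, 0) = (t, 0)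

/-- The derivative at the origin of the member `t` of a family of germs. -/
noncomputable def vderiv (f : ℂ × ℂ × ℂ → ℂ × ℂ × ℂ) (t : ℂ) : ℂ × ℂ →L[ℂ] ℂ × ℂ :=
  fderiv ℂ (fun z => (f (t, z)).2) 0

theorem eventually_section {Q : ℂ × ℂ × ℂ → Prop} (h : ∀ᶠ p in 𝓝 (0 : ℂ × ℂ × ℂ), Q p) :
    ∀ᶠ t in 𝓝 (0 : ℂ), Q (t, 0) :=
  (Continuous.tendsto' (f := fun t : ℂ => (t, (0 : ℂ × ℂ))) (by fun_prop) 0 0 rfl).eventually h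

theorem eventually_fiber {Q : ℂ × ℂ × ℂ → Prop} (h : ∀ᶠ p in 𝓝 (0 : ℂ × ℂ × ℂ), Q p) :
    ∀ᶠ t in 𝓝 (0 : ℂ), ∀ᶠ z in 𝓝 (0 : ℂ × ℂ), Q (t, z) :=
  Eventually.curry_nhds (x := (0 : ℂ)) (y := (0 : ℂ × ℂ)) h

theorem AnalyticAt.fiber {F : Type*} [NormedAddCommGroup F] [NormedSpace ℂ F]
    {f : ℂ × ℂ × ℂ → F} {t : ℂ} {z : ℂ × ℂ} (hf : AnalyticAt ℂ f (t, z)) :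
    AnalyticAt ℂ (fun z => f (t, z)) z :=
  AnalyticAt.fun_comp (g := f) (f := fun z => (t, z)) hf (by fun_prop)

namespace FamilyGerm

variable {f g : ℂ × ℂ × ℂ → ℂ × ℂ × ℂ}

theorem apply_zero (hf : FamilyGerm f) : f 0 = 0 := hf.map_zero.self_of_nhds

theorem tendsto (hf : FamilyGerm f) : Tendsto f (𝓝 0) (𝓝 0) := by
  simpa [hf.apply_zero] using hf.analyticAt.continuousAt.tendsto

theorem comp (hf : FamilyGerm f) (hg : FamilyGerm g) : FamilyGerm (fun p => f (g p)) where
  analyticAt := AnalyticAt.fun_comp (by rw [hg.apply_zero]; exact hf.analyticAt) hg.analyticAt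
  fst_eq := by
    filter_upwards [hg.fst_eq, hg.tendsto.eventually hf.fst_eq] with p h1 h2
    rw [h2, h1]
  map_zero := by
    filter_upwards [hg.map_zero, hf.map_zero] with t h1 h2
    rw [h1, h2]

theorem eq_mk (hf : FamilyGerm f) : ∀ᶠ p in 𝓝 (0 : ℂ × ℂ × ℂ), f p = (p.1, (f p).2) :=
  hf.fst_eq.mono fun _ h => Prod.ext h rfl

theorem hasFDerivAt (hf : FamilyGerm f) :
    ∀ᶠ t in 𝓝 (0 : ℂ), HasFDerivAt (fun z => (f (t, z)).2) (vderiv f t) 0 := by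
  filter_upwards [eventually_section hf.analyticAt.eventually_analyticAt] with t ht
  exact (ht.fiber.snd_apply).differentiableAt.hasFDerivAt

theorem vderiv_comp (hf : FamilyGerm f) (hg : FamilyGerm g) :
    ∀ᶠ t in 𝓝 (0 : ℂ), vderiv (fun p => f (g p)) t = (vderiv f t).comp (vderiv g t) := by
  filter_upwards [hf.hasFDerivAt, hg.hasFDerivAt, hg.map_zero, eventually_fiber hg.eq_mk]
    with t h1 h2 h3 h4
  have h5 : HasFDerivAt (fun z => (f (t, (g (t, z)).2)).2) ((vderiv f t).comp (vderiv g t)) 0 :=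
    HasFDerivAt.comp (g := fun z => (f (t, z)).2) (f := fun z => (g (t, z)).2) 0
      (by rw [h3]; exact h1) h2
  refine (h5.congr_of_eventuallyEq ?_).fderiv
  filter_upwards [h4] with z hz
  conv_lhs => rw [hz]

theorem vderiv_congr (h : ∀ᶠ p in 𝓝 (0 : ℂ × ℂ × ℂ), f p = g p) :
    ∀ᶠ t in 𝓝 (0 : ℂ), vderiv f t = vderiv g t := by
  filter_upwards [eventually_fiber h] with t ht
  refine EventuallyEq.fderiv_eq ?_
  filter_upwards [ht] with z hz
  rw [hz]

/-- The derivative is block diagonal because the section `z = 0` is fixed pointwise, which kills the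
`t`-derivative of the second component. Invertibility of a family thus depends only on its member at
`t = 0`. -/
theorem fderiv_apply (hf : FamilyGerm f) (v : ℂ × ℂ × ℂ) :
    fderiv ℂ f 0 v = (v.1, vderiv f 0 v.2) := by
  have hd := hf.analyticAt.differentiableAt.hasFDerivAt
  have h1 : (fderiv ℂ f 0 v).1 = v.1 := by
    have h2 : HasFDerivAt (fun p => (f p).1) ((ContinuousLinearMap.fst ℂ ℂ (ℂ × ℂ)).comp
      (fderiv ℂ f 0)) 0 := hd.fst
    have h3 : HasFDerivAt (fun p => (f p).1) (ContinuousLinearMap.fst ℂ ℂ (ℂ × ℂ)) 0 :=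
      hasFDerivAt_fst.congr_of_eventuallyEq hf.fst_eq
    exact DFunLike.congr_fun (h2.unique h3) v
  have h2 : (fderiv ℂ f 0 (0, v.2)).2 = vderiv f 0 v.2 := by
    have h3 : HasFDerivAt (fun z : ℂ × ℂ => (f ((0 : ℂ), z)).2)
        (((ContinuousLinearMap.snd ℂ ℂ (ℂ × ℂ)).comp (fderiv ℂ f 0)).comp
          (ContinuousLinearMap.inr ℂ ℂ (ℂ × ℂ))) 0 :=
      HasFDerivAt.comp (g := fun p => (f p).2) (f := fun z : ℂ × ℂ => ((0 : ℂ), z)) 0 hd.snd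
        (ContinuousLinearMap.inr ℂ ℂ (ℂ × ℂ)).hasFDerivAt
    rw [vderiv, h3.fderiv]
    simp
  have h3 : (fderiv ℂ f 0 (v.1, 0)).2 = 0 := by
    have h4 : HasFDerivAt (fun s : ℂ => f (s, (0 : ℂ × ℂ))) ((fderiv ℂ f 0).comp
        (ContinuousLinearMap.inl ℂ ℂ (ℂ × ℂ))) 0 :=
      HasFDerivAt.comp (g := f) (f := fun s : ℂ => (s, (0 : ℂ × ℂ))) 0 hd
        (ContinuousLinearMap.inl ℂ ℂ (ℂ × ℂ)).hasFDerivAt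
    have h5 : HasFDerivAt (fun s : ℂ => f (s, (0 : ℂ × ℂ)))
        (ContinuousLinearMap.inl ℂ ℂ (ℂ × ℂ)) 0 :=
      ((ContinuousLinearMap.inl ℂ ℂ (ℂ × ℂ)).hasFDerivAt).congr_of_eventuallyEq hf.map_zero
    have := DFunLike.congr_fun (h4.unique h5) v.1
    simp only [ContinuousLinearMap.comp_apply, ContinuousLinearMap.inl_apply] at this
    rw [this]
  refine Prod.ext h1 ?_
  have : v = (v.1, 0) + (0, v.2) := by simp
  conv_lhs => rw [this, _root_.map_add, Prod.snd_add, h3, h2, zero_add]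

end FamilyGerm

/-- Analytic local inverses. -/
theorem AnalyticAt.exists_local_inverse {E : Type*} [NormedAddCommGroup E] [NormedSpace ℂ E]
    [FiniteDimensional ℂ E] {f : E → E} (hf : AnalyticAt ℂ f 0) (hf0 : f 0 = 0)
    (hinj : Function.Injective (fderiv ℂ f 0)) :
    ∃ g : E → E, AnalyticAt ℂ g 0 ∧ g 0 = 0 ∧ (∀ᶠ z in 𝓝 0, g (f z) = z) ∧
      ∀ᶠ z in 𝓝 0, f (g z) = z := by
  have : CompleteSpace E := FiniteDimensional.complete ℂ E
  let i : E ≃L[ℂ] E :=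
    (LinearEquiv.ofInjectiveEndo (fderiv ℂ f 0).toLinearMap hinj).toContinuousLinearEquiv
  have hi : (i : E →L[ℂ] E) = fderiv ℂ f 0 := by ext; rfl
  have hfd : HasStrictFDerivAt f (i : E →L[ℂ] E) 0 := by rw [hi]; exact hf.hasStrictFDerivAt
  let R : OpenPartialHomeomorph E E := hfd.toOpenPartialHomeomorph f
  have hx : (0 : E) ∈ R.source := HasStrictFDerivAt.mem_toOpenPartialHomeomorph_source _
  obtain ⟨p, hp⟩ := hf
  have hp1 : p 1 = (continuousMultilinearCurryFin1 ℂ E E).symm i := by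
    have := hp.hasFDerivAt.unique hfd.hasFDerivAt
    rw [← this]; simp
  have han := (R.hasFPowerSeriesAt_symm hx hp hp1).analyticAt
  have h0 : R 0 = 0 := hf0
  refine ⟨R.symm, by rwa [h0] at han, by have := R.left_inv hx; rwa [h0] at this,
    R.eventually_left_inverse hx, ?_⟩
  have := R.eventually_right_inverse (R.map_source hx)
  rwa [h0] at this

/-- A family of germs of changes of coordinates, with its inverse. -/
structure FamilyChart (Θ Ψ : ℂ × ℂ × ℂ → ℂ × ℂ × ℂ) : Prop where
  germ : FamilyGerm Θ
  germ_inv : FamilyGerm Ψ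
  left_inv : ∀ᶠ p in 𝓝 (0 : ℂ × ℂ × ℂ), Ψ (Θ p) = p
  right_inv : ∀ᶠ p in 𝓝 (0 : ℂ × ℂ × ℂ), Θ (Ψ p) = p

namespace FamilyChart

variable {Θ Ψ Θ' Ψ' : ℂ × ℂ × ℂ → ℂ × ℂ × ℂ}

theorem symm (h : FamilyChart Θ Ψ) : FamilyChart Ψ Θ :=
  ⟨h.germ_inv, h.germ, h.right_inv, h.left_inv⟩

theorem trans (h : FamilyChart Θ Ψ) (h' : FamilyChart Θ' Ψ') :
    FamilyChart (fun p => Θ' (Θ p)) (fun p => Ψ (Ψ' p)) where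
  germ := h'.germ.comp h.germ
  germ_inv := h.germ_inv.comp h'.germ_inv
  left_inv := by
    filter_upwards [h.left_inv, h.germ.tendsto.eventually h'.left_inv] with p h1 h2
    rw [h2, h1]
  right_inv := by
    filter_upwards [h'.right_inv, h'.germ_inv.tendsto.eventually h.right_inv] with p h1 h2
    rw [h2, h1]

theorem vderiv_comp_eq (h : FamilyChart Θ Ψ) :
    ∀ᶠ t in 𝓝 (0 : ℂ), (vderiv Ψ t).comp (vderiv Θ t) = ContinuousLinearMap.id ℂ (ℂ × ℂ) := by
  filter_upwards [h.germ_inv.vderiv_comp h.germ,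
    FamilyGerm.vderiv_congr (g := fun p => p) h.left_inv] with t h1 h2
  rw [← h1, h2]
  exact fderiv_id

end FamilyChart

/-- Inverting in `(t, z)` jointly inverts all nearby members at once, analytically in `t`; the
inverse preserves `t` and the zero section because the family does. -/
theorem FamilyGerm.exists_chart {f : ℂ × ℂ × ℂ → ℂ × ℂ × ℂ} (hf : FamilyGerm f)
    (hinj : Function.Injective (vderiv f 0)) : ∃ g, FamilyChart f g := by
  obtain ⟨g, hg, hg0, hl, hr⟩ := hf.analyticAt.exists_local_inverse hf.apply_zero (by
    intro v w hvw
    rw [hf.fderiv_apply, hf.fderiv_apply, Prod.mk.injEq] at hvw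
    exact Prod.ext hvw.1 (hinj hvw.2))
  have hgt : Tendsto g (𝓝 0) (𝓝 0) := by simpa [hg0] using hg.continuousAt.tendsto
  refine ⟨g, hf, ⟨hg, ?_, ?_⟩, hl, hr⟩
  · filter_upwards [hr, hgt.eventually hf.fst_eq] with p h1 h2
    rw [← h2, h1]
  · filter_upwards [eventually_section hl, hf.map_zero] with t h1 h2
    rw [h2] at h1
    exact h1

end FamilyGerms

/-! ### The strong stable manifold, by a contraction. -/

section InvariantCurve

open Filter Metric

/-- Uniform second order vanishing along the `y`-axis. -/
theorem exists_norm_le_mul_sq {N : ℂ × ℂ × ℂ → ℂ × ℂ} (hN : AnalyticAt ℂ N 0)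
    (hN0 : ∀ᶠ t in 𝓝 (0 : ℂ), N (t, 0) = 0)
    (hN1 : ∀ᶠ t in 𝓝 (0 : ℂ), fderiv ℂ (fun z => N (t, z)) 0 = 0) :
    ∃ C₀ : ℝ, 0 < C₀ ∧ ∀ᶠ p in 𝓝 (0 : ℂ × ℂ), ‖N (p.1, 0, p.2)‖ ≤ C₀ * ‖p.2‖ ^ 2 := by
  have hNr : AnalyticAt ℂ (fun p : ℂ × ℂ => N (p.1, 0, p.2)) 0 :=
    AnalyticAt.fun_comp (g := N) (f := fun p : ℂ × ℂ => (p.1, (0 : ℂ), p.2)) hN (by fun_prop)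
  have hfst : Tendsto (Prod.fst : ℂ × ℂ → ℂ) (𝓝 0) (𝓝 0) := continuous_fst.tendsto' _ _ rfl
  have key : ∀ f : ℂ × ℂ → ℂ × ℂ, AnalyticAt ℂ f 0 → (∀ᶠ t in 𝓝 (0 : ℂ), f (t, 0) = 0) →
      ∃ g : ℂ × ℂ → ℂ × ℂ, AnalyticAt ℂ g 0 ∧ ∀ᶠ p in 𝓝 (0 : ℂ × ℂ), f p = p.2 • g p := by
    intro f hf h0
    exact hf.exists_eq_smul_of_eq_zero (ContinuousLinearMap.snd ℂ ℂ ℂ) (v := (0, 1)) (by simp) (by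
      filter_upwards [hfst.eventually h0] with p hp h
      have : p = (p.1, 0) := Prod.ext rfl (by simpa using h)
      rw [this]; exact hp)
  obtain ⟨g, hg, hNg⟩ := key _ hNr hN0
  have hsec : Tendsto (fun t : ℂ => (t, (0 : ℂ))) (𝓝 0) (𝓝 0) :=
    Continuous.tendsto' (by fun_prop) _ _ rfl
  -- The `y`-derivative of `y • g` at 0 is `g (t, 0)`, while that of `N` is zero; so a second factor
  -- `y` can be split off.
  have hg0 : ∀ᶠ t in 𝓝 (0 : ℂ), g (t, 0) = 0 := by
    filter_upwards [hN1, Eventually.curry_nhds (x := (0 : ℂ)) (y := (0 : ℂ)) hNg,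
      hsec.eventually hg.eventually_analyticAt,
      eventually_section hN.eventually_analyticAt] with t h1 h2 h3 h4
    have d1 : HasDerivAt (fun y : ℂ => y • g (t, y)) (g (t, 0)) 0 := by
      have h5 : DifferentiableAt ℂ (fun y : ℂ => g (t, y)) 0 :=
        (AnalyticAt.fun_comp (g := g) (f := fun y : ℂ => (t, y)) h3 (by fun_prop)).differentiableAt
      have h6 := (hasDerivAt_id (0 : ℂ)).smul h5.hasDerivAt
      simp only [id_eq, zero_smul, zero_add, one_smul] at h6
      exact h6
    have d2 : HasDerivAt (fun y : ℂ => N (t, 0, y)) 0 0 := by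
      have h6 := h4.fiber.differentiableAt.hasFDerivAt
      rw [h1] at h6
      have h7 : HasDerivAt (fun y : ℂ => ((0 : ℂ), y)) ((0 : ℂ), (1 : ℂ)) 0 :=
        (hasDerivAt_const _ _).prodMk (hasDerivAt_id _)
      exact HasFDerivAt.comp_hasDerivAt (l := fun z => N (t, z)) (0 : ℂ) h6 h7
    exact d1.unique (d2.congr_of_eventuallyEq (h2.mono fun y hy => hy.symm))
  obtain ⟨k, hk, hgk⟩ := key g hg hg0
  obtain ⟨r, M, hr, hM, -, hkM⟩ := hk.exists_ball_bound
  refine ⟨M, hM, ?_⟩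
  filter_upwards [hNg, hgk, ball_mem_nhds (0 : ℂ × ℂ) hr] with p h1 h2 h3
  rw [h1, h2, norm_smul, norm_smul]
  nlinarith [hkM p h3, norm_nonneg p.2, mul_nonneg (norm_nonneg p.2) (norm_nonneg p.2)]

set_option maxHeartbeats 1000000 in
/-- The strong stable manifold of a family of maps with diagonal linear parts, in the
parameterization that linearizes the family. -/
theorem exists_invariant_curve {l ν : ℂ → ℂ} (hl : AnalyticAt ℂ l 0) (hν : AnalyticAt ℂ ν 0)
    (hν0 : ν 0 ≠ 0) (hν1 : ‖ν 0‖ < 1) (hl0 : ‖ν 0‖ < ‖l 0‖)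
    {N : ℂ × ℂ × ℂ → ℂ × ℂ} (hN : AnalyticAt ℂ N 0) (hdN : fderiv ℂ N 0 = 0)
    (hN0 : ∀ᶠ t in 𝓝 (0 : ℂ), N (t, 0) = 0)
    (hN1 : ∀ᶠ t in 𝓝 (0 : ℂ), fderiv ℂ (fun z => N (t, z)) 0 = 0) :
    ∃ (γ : ℂ × ℂ → ℂ × ℂ) (C : ℝ), 0 < C ∧ AnalyticAt ℂ γ 0 ∧
      (∀ᶠ p in 𝓝 (0 : ℂ × ℂ), ‖γ p - (0, p.2)‖ ≤ C * ‖p.2‖ ^ 2) ∧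
      ∀ᶠ p in 𝓝 (0 : ℂ × ℂ), (l p.1 * (γ p).1, ν p.1 * (γ p).2) + N (p.1, γ p)
        = γ (p.1, ν p.1 * p.2) := by
  have hl0' : 0 < ‖l 0‖ := (norm_nonneg _).trans_lt hl0
  have hν0' : 0 < ‖ν 0‖ := norm_pos_iff.mpr hν0
  -- the constants of the contraction
  obtain ⟨ε, hε, hε1, hε2⟩ : ∃ ε : ℝ, 0 < ε ∧ ‖ν 0‖ + ε < 1 ∧
      (‖ν 0‖⁻¹ + ε) * ((‖ν 0‖ + ε) ^ 2 + ε) < 1 := by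
    -- At `ε = 0` the contraction factor is ‖ν 0‖⁻¹ * ‖ν 0‖² = ‖ν 0‖ < 1. The margin `ε` pays for
    -- the variation of `t` and for the Lipschitz constant of `N`.
    have h1 : Tendsto (fun ε : ℝ => (‖ν 0‖⁻¹ + ε) * ((‖ν 0‖ + ε) ^ 2 + ε)) (𝓝 0) (𝓝 ‖ν 0‖) :=
      Continuous.tendsto' (by fun_prop) _ _ (by field_simp; ring)
    have h2 : Tendsto (fun ε : ℝ => ‖ν 0‖ + ε) (𝓝 0) (𝓝 ‖ν 0‖) :=
      Continuous.tendsto' (by fun_prop) _ _ (by ring)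
    have h3 := (h1.eventually_lt_const hν1).and (h2.eventually_lt_const hν1)
    obtain ⟨ε, h, hε⟩ := ((h3.filter_mono nhdsWithin_le_nhds).and
      (self_mem_nhdsWithin : Set.Ioi (0 : ℝ) ∈ 𝓝[>] 0)).exists
    exact ⟨ε, hε, h.2, h.1⟩
  set m := ‖ν 0‖⁻¹ + ε with hm
  set n := ‖ν 0‖ + ε with hn
  set κ := m * (n ^ 2 + ε) with hκ
  have hm0 : 0 < m := by positivity
  have hn0 : 0 < n := by positivity
  have hκ0 : 0 ≤ κ := by positivity
  obtain ⟨C₀, hC₀, hNy⟩ := exists_norm_le_mul_sq hN hN0 hN1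
  -- a common domain
  obtain ⟨r₁, hr₁, hlip⟩ : ∃ r₁ > 0, ∀ p ∈ ball (0 : ℂ × ℂ × ℂ) r₁, ∀ p' ∈ ball (0 : ℂ × ℂ × ℂ) r₁,
      ‖N p - N p'‖ ≤ ε * ‖p - p'‖ := by
    have h1 := hN.hasStrictFDerivAt
    rw [hdN] at h1
    have h2 := h1.isLittleO.def hε
    obtain ⟨r₁, hr₁, h⟩ := Metric.eventually_nhds_iff_ball.mp h2
    refine ⟨r₁, hr₁, fun p hp p' hp' => ?_⟩
    have := h (p, p') (by rw [mem_ball, Prod.dist_eq, max_lt_iff]; exact ⟨hp, hp'⟩)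
    simpa using this
  obtain ⟨r₂, hr₂, hNan⟩ := Metric.eventually_nhds_iff_ball.mp hN.eventually_analyticAt
  obtain ⟨r₃, hr₃, hNy'⟩ := Metric.eventually_nhds_iff_ball.mp hNy
  have ev : ∀ᶠ t in 𝓝 (0 : ℂ), AnalyticAt ℂ l t ∧ AnalyticAt ℂ ν t ∧ l t ≠ 0 ∧ ν t ≠ 0 ∧
      ‖ν t‖ < n ∧ ‖l t‖⁻¹ < m ∧ ‖ν t‖⁻¹ < m := by
    have h1 : ‖l 0‖⁻¹ < m := by
      have : ‖l 0‖⁻¹ < ‖ν 0‖⁻¹ := inv_strictAnti₀ hν0' hl0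
      linarith
    filter_upwards [hl.eventually_analyticAt, hν.eventually_analyticAt,
      hl.continuousAt.eventually_ne (norm_pos_iff.mp hl0'), hν.continuousAt.eventually_ne hν0,
      hν.continuousAt.norm.eventually_lt_const (show ‖ν 0‖ < n by linarith),
      (hl.continuousAt.norm.inv₀ hl0'.ne').eventually_lt_const h1,
      (hν.continuousAt.norm.inv₀ hν0'.ne').eventually_lt_const (show ‖ν 0‖⁻¹ < m by linarith)]
      with t a1 a2 a3 a4 a5 a6 a7
    exact ⟨a1, a2, a3, a4, a5, a6, a7⟩
  obtain ⟨r₄, hr₄, ht⟩ := Metric.eventually_nhds_iff_ball.mp ev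
  -- The first increment is at most `m * C₀ * ‖y‖ ^ 2`, and later ones shrink by `κ`; their
  -- geometric sum is `C * ‖y‖ ^ 2`.
  set C := m * C₀ / (1 - κ) with hC
  have hκ1 : 0 < 1 - κ := by linarith
  have hC0 : 0 < C := by positivity
  set r := min (min r₁ r₂) (min r₃ r₄)
  have hr : 0 < r := by positivity
  have hrr₁ : r ≤ r₁ := (min_le_left _ _).trans (min_le_left _ _)
  have hrr₂ : r ≤ r₂ := (min_le_left _ _).trans (min_le_right _ _)
  have hrr₃ : r ≤ r₃ := (min_le_right _ _).trans (min_le_left _ _)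
  have hrr₄ : r ≤ r₄ := (min_le_right _ _).trans (min_le_right _ _)
  -- The bound `1 / C` gives `C * ‖y‖ ^ 2 ≤ ‖y‖`, so the iterates have norm at most `2 * ‖y‖ < r`
  -- and stay in the domain of `N`.
  set ρ := min (r / 2) (1 / C)
  have hρ : 0 < ρ := by positivity
  have hρr : 2 * ρ ≤ r := by have := min_le_left (r / 2) (1 / C); linarith
  have hρC : C * ρ ≤ 1 := by
    calc C * ρ ≤ C * (1 / C) := by gcongr; exact min_le_right _ _
      _ = 1 := by field_simp
  -- the iteration
  let T : (ℂ × ℂ → ℂ × ℂ) → ℂ × ℂ → ℂ × ℂ := fun γ p =>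
    (((γ (p.1, ν p.1 * p.2) - N (p.1, γ p)).1 / l p.1),
      ((γ (p.1, ν p.1 * p.2) - N (p.1, γ p)).2 / ν p.1))
  let γs : ℕ → ℂ × ℂ → ℂ × ℂ := fun k => T^[k] fun p => (0, p.2)
  have hγs0 : ∀ p, γs 0 p = (0, p.2) := fun p => rfl
  have hγs : ∀ k, γs (k + 1) = T (γs k) := fun k => Function.iterate_succ_apply' T k _
  set U := ball (0 : ℂ × ℂ) ρ
  have hUt : ∀ p ∈ U, ‖p.1‖ < ρ ∧ ‖p.2‖ < ρ := fun p hp => by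
    rwa [mem_ball_zero_iff, Prod.norm_def, max_lt_iff] at hp
  have hUt' : ∀ p ∈ U, _ := fun p hp => ht p.1 (by
    rw [mem_ball_zero_iff]; linarith [(hUt p hp).1])
  have hUν : ∀ p ∈ U, (p.1, ν p.1 * p.2) ∈ U := fun p hp => by
    obtain ⟨h1, h2⟩ := hUt p hp
    rw [mem_ball_zero_iff, Prod.norm_def, max_lt_iff]
    refine ⟨h1, ?_⟩
    rw [norm_mul]
    have := (hUt' p hp).2.2.2.2.1
    nlinarith [norm_nonneg (ν p.1), norm_nonneg p.2]
  have hdom : ∀ p ∈ U, ∀ w : ℂ × ℂ, ‖w - (0, p.2)‖ ≤ C * ‖p.2‖ ^ 2 →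
      (p.1, w) ∈ ball (0 : ℂ × ℂ × ℂ) r := by
    intro p hp w hw
    obtain ⟨h1, h2⟩ := hUt p hp
    have h3 : ‖((0 : ℂ), p.2)‖ = ‖p.2‖ := by simp [Prod.norm_def]
    have h4 : ‖w‖ ≤ ‖w - (0, p.2)‖ + ‖((0 : ℂ), p.2)‖ := by
      have := norm_add_le (w - (0, p.2)) ((0 : ℂ), p.2)
      rwa [sub_add_cancel] at this
    rw [mem_ball_zero_iff, Prod.norm_def, max_lt_iff]
    refine ⟨by linarith, ?_⟩
    have h5 : C * ‖p.2‖ ^ 2 ≤ ‖p.2‖ := by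
      have : C * ‖p.2‖ ≤ 1 := (by gcongr : C * ‖p.2‖ ≤ C * ρ).trans hρC
      nlinarith [norm_nonneg p.2]
    change ‖w‖ < r
    linarith
  have hinv : ∀ p ∈ U, ∀ w : ℂ × ℂ, ‖(w.1 / l p.1, w.2 / ν p.1)‖ ≤ m * ‖w‖ := by
    intro p hp w
    obtain ⟨-, -, -, -, -, h1, h2⟩ := hUt' p hp
    rw [Prod.norm_def]
    refine max_le ?_ ?_
    · change ‖w.1 / l p.1‖ ≤ _
      rw [norm_div, div_eq_inv_mul]
      gcongr
      exact norm_fst_le w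
    · change ‖w.2 / ν p.1‖ ≤ _
      rw [norm_div, div_eq_inv_mul]
      gcongr
      exact norm_snd_le w
  -- Differences are measured against `‖y‖ ^ 2`: composing with `y ↦ ν y` gains `n ^ 2`, the
  -- nonlinear part costs `ε`, and inverting the linear part costs `m`, in total the factor `κ`.
  have hest : ∀ k, AnalyticOnNhd ℂ (γs k) U ∧
      (∀ p ∈ U, ‖γs k p - (0, p.2)‖ ≤ C * (1 - κ ^ k) * ‖p.2‖ ^ 2) ∧
      ∀ p ∈ U, ‖γs (k + 1) p - γs k p‖ ≤ C * (1 - κ) * κ ^ k * ‖p.2‖ ^ 2 := by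
    intro k
    induction k with
    | zero =>
      refine ⟨fun p _ => ?_, fun p _ => by simp [hγs0], fun p hp => ?_⟩
      · change AnalyticAt ℂ (fun p : ℂ × ℂ => ((0 : ℂ), p.2)) p
        fun_prop
      · obtain ⟨-, -, h3, h4, -⟩ := hUt' p hp
        have h1 : γs 1 p - γs 0 p = -((N (p.1, 0, p.2)).1 / l p.1, (N (p.1, 0, p.2)).2 / ν p.1) := by
          rw [hγs, hγs0]
          simp only [T, hγs0]
          ext
          · simp; ring
          · simp only [Prod.snd_sub, Prod.snd_neg]; field_simp; ring
        rw [zero_add, h1, norm_neg]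
        refine (hinv p hp _).trans ?_
        have h2 := hNy' p (ball_subset_ball (by linarith) hp)
        calc m * ‖N (p.1, 0, p.2)‖ ≤ m * (C₀ * ‖p.2‖ ^ 2) := by gcongr
          _ = C * (1 - κ) * κ ^ 0 * ‖p.2‖ ^ 2 := by rw [hC]; field_simp
    | succ k ih =>
      obtain ⟨ih1, ih2, ih3⟩ := ih
      have hle : ∀ j : ℕ, ∀ x : ℝ, C * (1 - κ ^ j) * x ^ 2 ≤ C * x ^ 2 := fun j x => by
        have : 0 ≤ κ ^ j := by positivity
        have : 0 ≤ C * κ ^ j * x ^ 2 := by positivity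
        nlinarith
      have hdomk : ∀ p ∈ U, (p.1, γs k p) ∈ ball (0 : ℂ × ℂ × ℂ) r := fun p hp =>
        hdom p hp _ ((ih2 p hp).trans (hle k _))
      have hb : ∀ p ∈ U, ‖γs (k + 1) p - (0, p.2)‖ ≤ C * (1 - κ ^ (k + 1)) * ‖p.2‖ ^ 2 := by
        intro p hp
        calc ‖γs (k + 1) p - (0, p.2)‖ = ‖(γs (k + 1) p - γs k p) + (γs k p - (0, p.2))‖ := by
              congr 1; abel
          _ ≤ C * (1 - κ) * κ ^ k * ‖p.2‖ ^ 2 + C * (1 - κ ^ k) * ‖p.2‖ ^ 2 :=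
              (norm_add_le _ _).trans (add_le_add (ih3 p hp) (ih2 p hp))
          _ = _ := by ring
      refine ⟨fun p hp => ?_, hb, fun p hp => ?_⟩
      · obtain ⟨h1, h2, h3, h4, -⟩ := hUt' p hp
        rw [hγs]
        have e1 : AnalyticAt ℂ (fun p : ℂ × ℂ => l p.1) p :=
          AnalyticAt.fun_comp (g := l) h1 analyticAt_fst
        have e2 : AnalyticAt ℂ (fun p : ℂ × ℂ => ν p.1) p :=
          AnalyticAt.fun_comp (g := ν) h2 analyticAt_fst
        have e3 : AnalyticAt ℂ (fun p : ℂ × ℂ => γs k (p.1, ν p.1 * p.2)) p :=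
          AnalyticAt.fun_comp (g := γs k) (f := fun p : ℂ × ℂ => (p.1, ν p.1 * p.2))
            (ih1 _ (hUν p hp)) (analyticAt_fst.prod (e2.mul analyticAt_snd))
        have e4 : AnalyticAt ℂ (fun p : ℂ × ℂ => N (p.1, γs k p)) p :=
          AnalyticAt.fun_comp (g := N) (f := fun p : ℂ × ℂ => (p.1, γs k p))
            (hNan _ (ball_subset_ball hrr₂ (hdomk p hp))) (analyticAt_fst.prod (ih1 p hp))
        exact ((e3.sub e4).fst_apply.div e1 h3).prod ((e3.sub e4).snd_apply.div e2 h4)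
      · have h1 : γs (k + 1 + 1) p - γs (k + 1) p =
            (((γs (k + 1) (p.1, ν p.1 * p.2) - γs k (p.1, ν p.1 * p.2)) -
                (N (p.1, γs (k + 1) p) - N (p.1, γs k p))).1 / l p.1,
              ((γs (k + 1) (p.1, ν p.1 * p.2) - γs k (p.1, ν p.1 * p.2)) -
                (N (p.1, γs (k + 1) p) - N (p.1, γs k p))).2 / ν p.1) := by
          rw [hγs (k + 1)]
          conv_lhs => rw [show γs (k + 1) p = T (γs k) p by rw [hγs]]
          simp only [T]
          ext
          · simp only [Prod.fst_sub]; ring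
          · simp only [Prod.snd_sub]; ring
        rw [h1]
        refine (hinv p hp _).trans ?_
        have h2 := ih3 _ (hUν p hp)
        have h3 : ‖N (p.1, γs (k + 1) p) - N (p.1, γs k p)‖ ≤ ε * ‖γs (k + 1) p - γs k p‖ := by
          have := hlip _ (ball_subset_ball hrr₁ (hdom p hp _ ((hb p hp).trans (hle _ _))))
            _ (ball_subset_ball hrr₁ (hdomk p hp))
          simpa [Prod.norm_def] using this
        have h4 : ‖ν p.1 * p.2‖ ^ 2 ≤ n ^ 2 * ‖p.2‖ ^ 2 := by
          rw [norm_mul, mul_pow]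
          gcongr
          exact (hUt' p hp).2.2.2.2.1.le
        calc m * _ ≤ m * (C * (1 - κ) * κ ^ k * (n ^ 2 * ‖p.2‖ ^ 2) +
              ε * (C * (1 - κ) * κ ^ k * ‖p.2‖ ^ 2)) := by
              gcongr
              refine (norm_sub_le _ _).trans (add_le_add (h2.trans ?_) (h3.trans ?_))
              · exact mul_le_mul_of_nonneg_left h4 (by positivity)
              · exact mul_le_mul_of_nonneg_left (ih3 p hp) hε.le
          _ = C * (1 - κ) * κ ^ (k + 1) * ‖p.2‖ ^ 2 := by rw [pow_succ, hκ]; ring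
  -- the limit
  have hbd : ∀ k, ∀ p ∈ U, ‖γs (k + 1) p - γs k p‖ ≤ C * (1 - κ) * ρ ^ 2 * κ ^ k := by
    intro k p hp
    refine ((hest k).2.2 p hp).trans ?_
    have : ‖p.2‖ ^ 2 ≤ ρ ^ 2 := by gcongr; exact (hUt p hp).2.le
    calc C * (1 - κ) * κ ^ k * ‖p.2‖ ^ 2 ≤ C * (1 - κ) * κ ^ k * ρ ^ 2 := by gcongr
      _ = _ := by ring
  have hsum : Summable fun k : ℕ => C * (1 - κ) * ρ ^ 2 * κ ^ k :=
    (summable_geometric_of_lt_one hκ0 hε2).mul_left _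
  have han := analyticOnNhd_tsum_of_bound (f := fun k p => γs (k + 1) p - γs k p)
    isOpen_ball (fun k => (hest (k + 1)).1.sub (hest k).1) hsum hbd
  set γ : ℂ × ℂ → ℂ × ℂ := fun p => γs 0 p + ∑' k, (γs (k + 1) p - γs k p) with hγ
  have hγan : AnalyticOnNhd ℂ γ U := (hest 0).1.add han
  have hlim : ∀ p ∈ U, Tendsto (fun k => γs k p) atTop (𝓝 (γ p)) := by
    intro p hp
    have h1 : Summable fun k => γs (k + 1) p - γs k p :=
      Summable.of_norm_bounded hsum fun k => hbd k p hp
    have h2 := (h1.hasSum.tendsto_sum_nat).const_add (γs 0 p)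
    refine h2.congr fun k => ?_
    rw [Finset.sum_range_sub (fun k => γs k p), add_sub_cancel]
  have hγb : ∀ p ∈ U, ‖γ p - (0, p.2)‖ ≤ C * ‖p.2‖ ^ 2 := by
    intro p hp
    refine le_of_tendsto ((hlim p hp).sub_const _).norm (Eventually.of_forall fun k => ?_)
    refine ((hest k).2.1 p hp).trans ?_
    have : 0 ≤ κ ^ k := by positivity
    have : 0 ≤ C * κ ^ k * ‖p.2‖ ^ 2 := by positivity
    nlinarith
  have h0U : U ∈ 𝓝 (0 : ℂ × ℂ) := ball_mem_nhds _ hρ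
  refine ⟨γ, C, hC0, hγan 0 (mem_ball_self hρ), by filter_upwards [h0U] with p hp using hγb p hp, ?_⟩
  filter_upwards [h0U] with p hp
  obtain ⟨-, -, h3, h4, -⟩ := hUt' p hp
  have hT : γ p = T γ p := by
    refine tendsto_nhds_unique ((tendsto_add_atTop_iff_nat 1).mpr (hlim p hp)) ?_
    have e1 := hlim _ (hUν p hp)
    have e2 : Tendsto (fun k => N (p.1, γs k p)) atTop (𝓝 (N (p.1, γ p))) := by
      have := (hNan _ (ball_subset_ball hrr₂ (hdom p hp _ (hγb p hp)))).continuousAt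
      exact this.tendsto.comp (tendsto_const_nhds.prodMk_nhds (hlim p hp))
    have e3 := e1.sub e2
    have e4 : Tendsto (fun k => γs (k + 1) p) atTop (𝓝 (T γ p)) := by
      simp only [hγs]
      exact ((continuous_fst.tendsto _).comp e3 |>.div_const _).prodMk_nhds
        ((continuous_snd.tendsto _).comp e3 |>.div_const _)
    exact e4
  have hT1 : l p.1 * (γ p).1 = (γ (p.1, ν p.1 * p.2) - N (p.1, γ p)).1 := by
    have := congrArg Prod.fst hT
    simp only [T] at this
    rw [eq_div_iff h3] at this
    rw [mul_comm]; exact this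
  have hT2 : ν p.1 * (γ p).2 = (γ (p.1, ν p.1 * p.2) - N (p.1, γ p)).2 := by
    have := congrArg Prod.snd hT
    simp only [T] at this
    rw [eq_div_iff h4] at this
    rw [mul_comm]; exact this
  rw [hT1, hT2, Prod.mk.eta, sub_add_cancel]

end InvariantCurve

/-! ### Diagonalizing the linear parts and straightening the strong stable manifold. -/

section Straightening

open Filter

/-- The diagonal endomorphism of `ℂ²` with the given entries. -/
noncomputable def diagCLM (a b : ℂ) : ℂ × ℂ →L[ℂ] ℂ × ℂ :=
  (a • ContinuousLinearMap.fst ℂ ℂ ℂ).prod (b • ContinuousLinearMap.snd ℂ ℂ ℂ)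

@[simp]
theorem diagCLM_apply (a b : ℂ) (z : ℂ × ℂ) : diagCLM a b z = (a * z.1, b * z.2) := rfl

/-- Conjugating a family by a chart conjugates the derivatives at the origin. -/
theorem FamilyChart.vderiv_conj {Θ Ψ f : ℂ × ℂ × ℂ → ℂ × ℂ × ℂ} (h : FamilyChart Θ Ψ)
    (hf : FamilyGerm f) : ∀ᶠ t in 𝓝 (0 : ℂ),
      vderiv (fun p => Ψ (f (Θ p))) t = (vderiv Ψ t).comp ((vderiv f t).comp (vderiv Θ t)) := by
  filter_upwards [h.germ_inv.vderiv_comp (hf.comp h.germ), hf.vderiv_comp h.germ] with t h1 h2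
  rw [h1, h2]

/-- Diagonalization of the linear parts of a family. -/
theorem FamilyGerm.exists_chart_diag {f : ℂ × ℂ × ℂ → ℂ × ℂ × ℂ} (hf : FamilyGerm f) {l ν : ℂ → ℂ}
    {e₁ e₂ : ℂ → ℂ × ℂ} (he₁ : AnalyticAt ℂ e₁ 0) (he₂ : AnalyticAt ℂ e₂ 0)
    (hinj : Function.Injective fun z : ℂ × ℂ => z.1 • e₁ 0 + z.2 • e₂ 0)
    (h₁ : ∀ᶠ t in 𝓝 (0 : ℂ), vderiv f t (e₁ t) = l t • e₁ t)
    (h₂ : ∀ᶠ t in 𝓝 (0 : ℂ), vderiv f t (e₂ t) = ν t • e₂ t) :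
    ∃ Θ Ψ, FamilyChart Θ Ψ ∧
      ∀ᶠ t in 𝓝 (0 : ℂ), vderiv (fun p => Ψ (f (Θ p))) t = diagCLM (l t) (ν t) := by
  let M : ℂ → ℂ × ℂ →L[ℂ] ℂ × ℂ := fun t =>
    (ContinuousLinearMap.fst ℂ ℂ ℂ).smulRight (e₁ t) +
      (ContinuousLinearMap.snd ℂ ℂ ℂ).smulRight (e₂ t)
  have hM : ∀ t z, M t z = z.1 • e₁ t + z.2 • e₂ t := fun t z => rfl
  let Θ : ℂ × ℂ × ℂ → ℂ × ℂ × ℂ := fun p => (p.1, p.2.1 • e₁ p.1 + p.2.2 • e₂ p.1)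
  have hΘ : FamilyGerm Θ := by
    refine ⟨?_, Eventually.of_forall fun p => rfl, Eventually.of_forall fun t => by simp [Θ]⟩
    have a1 : AnalyticAt ℂ (fun p : ℂ × ℂ × ℂ => e₁ p.1) 0 :=
      AnalyticAt.fun_comp (g := e₁) (f := fun p : ℂ × ℂ × ℂ => p.1) he₁ analyticAt_fst
    have a2 : AnalyticAt ℂ (fun p : ℂ × ℂ × ℂ => e₂ p.1) 0 :=
      AnalyticAt.fun_comp (g := e₂) (f := fun p : ℂ × ℂ × ℂ => p.1) he₂ analyticAt_fst
    have b1 : AnalyticAt ℂ (fun p : ℂ × ℂ × ℂ => p.2.1) 0 := by fun_prop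
    have b2 : AnalyticAt ℂ (fun p : ℂ × ℂ × ℂ => p.2.2) 0 := by fun_prop
    exact analyticAt_fst.prod ((b1.smul a1).add (b2.smul a2))
  have hv : ∀ t, vderiv Θ t = M t := fun t => (M t).fderiv
  obtain ⟨Ψ, hc⟩ := hΘ.exists_chart (by rw [hv]; exact hinj)
  refine ⟨Θ, Ψ, hc, ?_⟩
  filter_upwards [hc.vderiv_conj hf, hc.vderiv_comp_eq, h₁, h₂] with t a1 a2 a3 a4
  rw [a1]
  refine ContinuousLinearMap.ext fun z => ?_
  have : vderiv f t (M t z) = M t (diagCLM (l t) (ν t) z) := by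
    rw [hM, _root_.map_add, map_smul, map_smul, a3, a4, hM, diagCLM_apply, smul_smul, smul_smul,
      mul_comm, mul_comm z.2]
  rw [ContinuousLinearMap.comp_apply, ContinuousLinearMap.comp_apply, hv, this, ← hv,
    ← ContinuousLinearMap.comp_apply, a2]
  rfl

/-- Coordinates in which the strong stable manifold is `x = 0` and the family is linear on it. -/
theorem FamilyGerm.exists_chart_straight {f : ℂ × ℂ × ℂ → ℂ × ℂ × ℂ} (hf : FamilyGerm f)
    {l ν : ℂ → ℂ} (hl : AnalyticAt ℂ l 0) (hν : AnalyticAt ℂ ν 0)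
    (hν0 : ν 0 ≠ 0) (hν1 : ‖ν 0‖ < 1) (hl0 : ‖ν 0‖ < ‖l 0‖)
    (hd : ∀ᶠ t in 𝓝 (0 : ℂ), vderiv f t = diagCLM (l t) (ν t)) :
    ∃ Θ Ψ, FamilyChart Θ Ψ ∧ ∃ a h : ℂ × ℂ × ℂ → ℂ, AnalyticAt ℂ a 0 ∧ AnalyticAt ℂ h 0 ∧
      (∀ᶠ t in 𝓝 (0 : ℂ), a (t, 0, 0) = l t) ∧ (∀ᶠ t in 𝓝 (0 : ℂ), h (t, 0, 0) = 0) ∧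
      ∀ᶠ p in 𝓝 (0 : ℂ × ℂ × ℂ), Ψ (f (Θ p)) =
        (p.1, p.2.1 * a p, ν p.1 * p.2.2 + p.2.1 * h p) := by
  have hl3 : AnalyticAt ℂ (fun p : ℂ × ℂ × ℂ => l p.1) 0 :=
    AnalyticAt.fun_comp (g := l) (f := fun p : ℂ × ℂ × ℂ => p.1) hl analyticAt_fst
  have hν3 : AnalyticAt ℂ (fun p : ℂ × ℂ × ℂ => ν p.1) 0 :=
    AnalyticAt.fun_comp (g := ν) (f := fun p : ℂ × ℂ × ℂ => p.1) hν analyticAt_fst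
  have hν2 : AnalyticAt ℂ (fun p : ℂ × ℂ => ν p.1) 0 :=
    AnalyticAt.fun_comp (g := ν) (f := fun p : ℂ × ℂ => p.1) hν analyticAt_fst
  -- the nonlinear part
  let N : ℂ × ℂ × ℂ → ℂ × ℂ := fun p => (f p).2 - (l p.1 * p.2.1, ν p.1 * p.2.2)
  have hN : AnalyticAt ℂ N 0 := hf.analyticAt.snd_apply.sub
    ((hl3.mul (by fun_prop)).prod (hν3.mul (by fun_prop)))
  have hN0 : ∀ᶠ t in 𝓝 (0 : ℂ), N (t, 0) = 0 := by
    filter_upwards [hf.map_zero] with t ht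
    simp [N, ht]
  have hN1 : ∀ᶠ t in 𝓝 (0 : ℂ), fderiv ℂ (fun z => N (t, z)) 0 = 0 := by
    filter_upwards [hf.hasFDerivAt, hd] with t h1 h2
    rw [h2] at h1
    have := (h1.sub (diagCLM (l t) (ν t)).hasFDerivAt).fderiv
    rw [sub_self] at this
    exact this
  have hdN : fderiv ℂ N 0 = 0 := by
    let K : ℂ × ℂ × ℂ → ℂ × ℂ × ℂ := fun p => (p.1, N p)
    have hK : FamilyGerm K := ⟨analyticAt_fst.prod hN, Eventually.of_forall fun p => rfl,
      hN0.mono fun t ht => by simp [K, ht]⟩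
    have hv : vderiv K 0 = 0 := hN1.self_of_nhds
    have h1 : HasFDerivAt N ((ContinuousLinearMap.snd ℂ ℂ (ℂ × ℂ)).comp (fderiv ℂ K 0)) 0 :=
      hK.analyticAt.differentiableAt.hasFDerivAt.snd
    rw [h1.fderiv]
    refine ContinuousLinearMap.ext fun v => ?_
    rw [ContinuousLinearMap.comp_apply, hK.fderiv_apply, hv]
    rfl
  obtain ⟨γ, C, hC, hγ, hγb, hγeq⟩ := exists_invariant_curve hl hν hν0 hν1 hl0 hN hdN hN0 hN1
  -- the chart
  let Θ : ℂ × ℂ × ℂ → ℂ × ℂ × ℂ := fun p => (p.1, γ (p.1, p.2.2) + (p.2.1, 0))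
  have hγb' := Eventually.curry_nhds (x := (0 : ℂ)) (y := (0 : ℂ)) hγb
  have hγ0 : ∀ᶠ t in 𝓝 (0 : ℂ), γ (t, 0) = 0 := by
    filter_upwards [hγb'] with t ht
    exact sub_eq_zero.mp (norm_le_zero_iff.mp (ht.self_of_nhds.trans_eq (by simp)))
  have hΘ : FamilyGerm Θ := by
    refine ⟨?_, Eventually.of_forall fun p => rfl, ?_⟩
    · have : AnalyticAt ℂ (fun p : ℂ × ℂ × ℂ => γ (p.1, p.2.2)) 0 :=
        AnalyticAt.fun_comp (g := γ) (f := fun p : ℂ × ℂ × ℂ => (p.1, p.2.2)) hγ (by fun_prop)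
      exact analyticAt_fst.prod (this.add (by fun_prop))
    · filter_upwards [hγ0] with t ht
      simp [Θ, ht]
  -- The curve is tangent to the `y`-axis to second order, so the chart is the identity to first
  -- order and the linear parts remain diagonal.
  have hvΘ : ∀ᶠ t in 𝓝 (0 : ℂ), vderiv Θ t = ContinuousLinearMap.id ℂ (ℂ × ℂ) := by
    filter_upwards [hγb'] with t ht
    have h1 : HasFDerivAt (fun z : ℂ × ℂ => γ (t, z.2) - (0, z.2))
        (0 : ℂ × ℂ →L[ℂ] ℂ × ℂ) 0 := by
      refine Asymptotics.IsBigO.hasFDerivAt (n := 2) ?_ (by norm_num)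
      refine Asymptotics.IsBigO.of_bound C ?_
      filter_upwards [(continuous_snd.tendsto' (0 : ℂ × ℂ) 0 rfl).eventually ht] with z hz
      refine hz.trans ?_
      rw [sub_zero, Real.norm_of_nonneg (by positivity)]
      gcongr
      exact norm_snd_le z
    have h2 := h1.add (hasFDerivAt_id (𝕜 := ℂ) (0 : ℂ × ℂ))
    rw [zero_add] at h2
    refine (h2.congr_of_eventuallyEq (Eventually.of_forall fun z => ?_)).fderiv
    simp only [Θ, Pi.add_apply, id]
    ext <;> simp
  obtain ⟨Ψ, hc⟩ := hΘ.exists_chart (by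
    rw [hvΘ.self_of_nhds]; exact fun _ _ h => h)
  have hg := (hc.germ_inv.comp (hf.comp hc.germ))
  have hdiag : ∀ᶠ t in 𝓝 (0 : ℂ), vderiv (fun p => Ψ (f (Θ p))) t = diagCLM (l t) (ν t) := by
    filter_upwards [hc.vderiv_conj hf, hd, hvΘ, hc.vderiv_comp_eq] with t h1 h2 h3 h4
    rw [h3, ContinuousLinearMap.comp_id] at h4
    rw [h1, h2, h3, h4, ContinuousLinearMap.comp_id, ContinuousLinearMap.id_comp]
  -- On `x = 0` the chart is the parameterized curve, so the invariance equation says that the map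
  -- is `y ↦ ν y` there.
  have hx0 : ∀ᶠ p in 𝓝 (0 : ℂ × ℂ), Ψ (f (Θ (p.1, 0, p.2))) = (p.1, 0, ν p.1 * p.2) := by
    have ht1 : Tendsto (fun p : ℂ × ℂ => (p.1, (0 : ℂ), ν p.1 * p.2)) (𝓝 0) (𝓝 0) := by
      have : AnalyticAt ℂ (fun p : ℂ × ℂ => (p.1, (0 : ℂ), ν p.1 * p.2)) 0 :=
        analyticAt_fst.prod (analyticAt_const.prod (hν2.mul analyticAt_snd))
      have h := this.continuousAt.tendsto
      rwa [show ((0 : ℂ × ℂ).1, (0 : ℂ), ν (0 : ℂ × ℂ).1 * (0 : ℂ × ℂ).2) = 0 from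
        Prod.ext rfl (Prod.ext rfl (mul_zero _))] at h
    have ht2 : Tendsto (fun p : ℂ × ℂ => (p.1, (0 : ℂ), p.2)) (𝓝 0) (𝓝 0) :=
      Continuous.tendsto' (by fun_prop) _ _ rfl
    filter_upwards [hγeq, ht1.eventually hc.left_inv,
      (hc.germ.tendsto.comp ht2).eventually hf.eq_mk] with p h1 h2 h3
    simp only [Function.comp_apply] at h3
    have h4 : f (Θ (p.1, 0, p.2)) = Θ (p.1, 0, ν p.1 * p.2) := by
      rw [h3]
      have h5 : ((f (Θ (p.1, 0, p.2))).2 : ℂ × ℂ) = γ (p.1, ν p.1 * p.2) := by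
        rw [← h1, show Θ (p.1, 0, p.2) = (p.1, γ p) from Prod.ext rfl (add_zero (γ p))]
        simp [N]
      rw [h5]
      simp [Θ]
    rw [h4, h2]
  have hdiv : ∀ k : ℂ × ℂ × ℂ → ℂ, AnalyticAt ℂ k 0 →
      (∀ᶠ p in 𝓝 (0 : ℂ × ℂ), k (p.1, 0, p.2) = 0) →
      ∃ g : ℂ × ℂ × ℂ → ℂ, AnalyticAt ℂ g 0 ∧ ∀ᶠ p in 𝓝 (0 : ℂ × ℂ × ℂ), k p = p.2.1 * g p := by
    intro k hk h0
    have hty : Tendsto (fun p : ℂ × ℂ × ℂ => (p.1, p.2.2)) (𝓝 0) (𝓝 0) :=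
      Continuous.tendsto' (by fun_prop) _ _ rfl
    exact hk.exists_eq_smul_of_eq_zero
      ((ContinuousLinearMap.fst ℂ ℂ ℂ).comp (ContinuousLinearMap.snd ℂ ℂ (ℂ × ℂ)))
      (v := (0, 1, 0)) (by simp) (by
        filter_upwards [hty.eventually h0] with p hp hp0
        have : p = (p.1, 0, p.2.2) := by
          refine Prod.ext rfl (Prod.ext ?_ rfl)
          simpa using hp0
        rw [this]; exact hp)
  obtain ⟨a, ha, haeq⟩ := hdiv _ hg.analyticAt.snd_apply.fst_apply (hx0.mono fun p hp => by
    rw [hp])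
  obtain ⟨h, hh, hheq⟩ := hdiv _ (hg.analyticAt.snd_apply.snd_apply.sub
    (hν3.mul (by fun_prop : AnalyticAt ℂ (fun p : ℂ × ℂ × ℂ => p.2.2) 0)))
    (hx0.mono fun p hp => by simp [hp])
  have hah : ∀ᶠ t in 𝓝 (0 : ℂ), a (t, 0, 0) = l t ∧ h (t, 0, 0) = 0 := by
    filter_upwards [hg.hasFDerivAt, hdiag, eventually_fiber haeq, eventually_fiber hheq,
      eventually_section ha.eventually_analyticAt, eventually_section hh.eventually_analyticAt]
      with t h1 h2 h3 h4 h5 h6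
    rw [h2] at h1
    have hline : HasDerivAt (fun x : ℂ => (x, (0 : ℂ))) ((1 : ℂ), (0 : ℂ)) 0 :=
      (hasDerivAt_id _).prodMk (hasDerivAt_const _ _)
    have hlt : Tendsto (fun x : ℂ => (x, (0 : ℂ))) (𝓝 0) (𝓝 0) :=
      Continuous.tendsto' (by fun_prop) _ _ rfl
    have h7 := HasFDerivAt.comp_hasDerivAt_of_eq
      (l := fun z => (Ψ (f (Θ (t, z)))).2) (0 : ℂ) h1 hline rfl
    have hprod : ∀ k : ℂ × ℂ × ℂ → ℂ, AnalyticAt ℂ k (t, 0) →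
        HasDerivAt (fun x : ℂ => x * k (t, x, 0)) (k (t, 0, 0)) 0 := by
      intro k hk
      have h8 : DifferentiableAt ℂ (fun x : ℂ => k (t, x, 0)) 0 :=
        (AnalyticAt.fun_comp (g := k) (f := fun x : ℂ => (t, x, (0 : ℂ))) hk
          (by fun_prop)).differentiableAt
      exact ((hasDerivAt_id (0 : ℂ)).mul h8.hasDerivAt).congr_deriv (by simp)
    have e1 := (hprod a h5).congr_of_eventuallyEq (hlt.eventually h3)
    have e2 := (hprod h h6).congr_of_eventuallyEq (hlt.eventually h4)
    have f1 : HasDerivAt (fun x : ℂ => (Ψ (f (Θ (t, x, 0)))).2.1) (l t) 0 :=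
      (HasFDerivAt.hasDerivAt (HasFDerivAtFilter.fst h7)).congr_deriv (by simp)
    have f2 : HasDerivAt (fun x : ℂ => (Ψ (f (Θ (t, x, 0)))).2.2 - ν t * 0) 0 0 :=
      ((HasFDerivAt.hasDerivAt (HasFDerivAtFilter.snd h7)).congr_deriv (by simp)).sub_const _
    exact ⟨e1.unique f1, e2.unique f2⟩
  refine ⟨Θ, Ψ, hc, a, h, ha, hh, hah.mono fun t h => h.1, hah.mono fun t h => h.2, ?_⟩
  filter_upwards [hg.fst_eq, haeq, hheq] with p h1 h2 h3
  refine Prod.ext h1 (Prod.ext h2 ?_)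
  simp only [Pi.sub_apply, Pi.mul_apply] at h3
  exact sub_eq_iff_eq_add'.mp h3

end Straightening

/-! ### Complexifying the parameter, with the second eigenvalue and the eigenvectors. -/

section Complexification

open Filter

/-- A family that is analytic in a real or complex parameter extends to a family that is
holomorphic in the parameter near `t = 0`. -/
theorem IsAnalyticFamily.exists_extension {K : Set ℂ} {δ : ℝ} (hδ : 0 < δ) (hK0 : (0 : ℂ) ∈ K)
    {H : ℂ → ℂ × ℂ → ℂ × ℂ} (hH : IsAnalyticFamily (K ∩ Metric.ball 0 δ) H) :
    ∃ g : ℂ × ℂ × ℂ → ℂ × ℂ, AnalyticAt ℂ g 0 ∧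
      ∀ᶠ p in 𝓝 (0 : ℂ × ℂ × ℂ), p.1 ∈ K → H p.1 p.2 = g p := by
  have h0 : (0 : ℂ) ∈ K ∩ Metric.ball 0 δ := ⟨hK0, Metric.mem_ball_self hδ⟩
  obtain ⟨g, hHg, hg⟩ := analyticWithinAt_iff_exists_analyticAt.mp (hH 0 h0)
  refine ⟨g, hg, ?_⟩
  have hball : ∀ᶠ p in 𝓝 (0 : ℂ × ℂ × ℂ), p.1 ∈ Metric.ball (0 : ℂ) δ :=
    (continuous_fst.tendsto' (0 : ℂ × ℂ × ℂ) 0 rfl).eventually (Metric.ball_mem_nhds _ hδ)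
  have h1 := eventually_nhdsWithin_iff.mp hHg
  filter_upwards [hball, h1] with p hp hp1 hpK
  exact hp1 (Set.mem_insert_of_mem _ ⟨⟨hpK, hp⟩, Set.mem_univ _⟩)

/-- The identity theorem on a subset of the plane that contains the real line. -/
theorem AnalyticAt.eventually_eq_zero_of_real_subset {E : Type*} [NormedAddCommGroup E]
    [NormedSpace ℂ E] {K : Set ℂ} (hK : Set.range Complex.ofReal ⊆ K) {g : ℂ → E}
    (hg : AnalyticAt ℂ g 0) (h : ∀ᶠ t in 𝓝 (0 : ℂ), t ∈ K → g t = 0) :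
    ∀ᶠ t in 𝓝 (0 : ℂ), g t = 0 := by
  refine hg.frequently_zero_iff_eventually_zero.mp ?_
  have h1 : Tendsto Complex.ofReal (𝓝[≠] 0) (𝓝[≠] 0) := by
    refine tendsto_nhdsWithin_iff.mpr ⟨?_, ?_⟩
    · exact (Complex.continuous_ofReal.tendsto' 0 0 rfl).mono_left nhdsWithin_le_nhds
    · filter_upwards [self_mem_nhdsWithin] with x hx
      simpa using hx
  refine h1.frequently (Eventually.frequently ?_)
  filter_upwards [h1.eventually (h.filter_mono nhdsWithin_le_nhds)] with x hx
  exact hx (hK ⟨x, rfl⟩)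

theorem FamilyGerm.analyticAt_vderiv_apply {f : ℂ × ℂ × ℂ → ℂ × ℂ × ℂ} (hf : FamilyGerm f)
    (v : ℂ × ℂ) : AnalyticAt ℂ (fun t => vderiv f t v) 0 := by
  have h1 : AnalyticAt ℂ (fun p => fderiv ℂ f p) 0 := hf.analyticAt.fderiv
  have h2 : AnalyticAt ℂ (fun t : ℂ => fderiv ℂ f (t, 0)) 0 :=
    AnalyticAt.fun_comp (g := fun p => fderiv ℂ f p) (f := fun t : ℂ => (t, (0 : ℂ × ℂ))) h1
      (by fun_prop)
  have h3 : AnalyticAt ℂ (fun t : ℂ => (fderiv ℂ f (t, 0) (0, v)).2) 0 :=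
    ((ContinuousLinearMap.apply ℂ (ℂ × ℂ × ℂ) ((0 : ℂ), v)).analyticAt _ |>.fun_comp h2).snd_apply
  refine h3.congr ?_
  filter_upwards [eventually_section hf.analyticAt.eventually_analyticAt] with t ht
  have h4 : HasFDerivAt (fun z : ℂ × ℂ => (f (t, z)).2)
      (((ContinuousLinearMap.snd ℂ ℂ (ℂ × ℂ)).comp (fderiv ℂ f (t, 0))).comp
        (ContinuousLinearMap.inr ℂ ℂ (ℂ × ℂ))) 0 :=
    HasFDerivAt.comp (g := fun p => (f p).2) (f := fun z : ℂ × ℂ => (t, z)) 0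
      ht.differentiableAt.hasFDerivAt.snd (hasFDerivAt_prodMk_right t 0)
  rw [vderiv, h4.fderiv]
  simp

theorem ContinuousLinearMap.apply_prod_eq (A : ℂ × ℂ →L[ℂ] ℂ × ℂ) (v : ℂ × ℂ) :
    A v = (v.1 * (A (1, 0)).1 + v.2 * (A (0, 1)).1, v.1 * (A (1, 0)).2 + v.2 * (A (0, 1)).2) := by
  have : v = v.1 • (1, 0) + v.2 • (0, 1) := by ext <;> simp
  conv_lhs => rw [this, _root_.map_add, map_smul, map_smul]
  ext <;> simp

theorem charpoly_eq_zero_of_hasEigenvalue {A : ℂ × ℂ →L[ℂ] ℂ × ℂ} {μ : ℂ}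
    (h : Module.End.HasEigenvalue A.toLinearMap μ) :
    ((A (1, 0)).1 - μ) * ((A (0, 1)).2 - μ) - (A (0, 1)).1 * (A (1, 0)).2 = 0 := by
  obtain ⟨v, hv⟩ := h.exists_hasEigenvector
  have h1 : A v = μ • v := hv.apply_eq_smul
  rw [A.apply_prod_eq] at h1
  have e1 := congrArg Prod.fst h1
  have e2 := congrArg Prod.snd h1
  simp only [Prod.smul_fst, Prod.smul_snd, smul_eq_mul] at e1 e2
  by_contra hne
  apply hv.2
  have f1 : (((A (1, 0)).1 - μ) * ((A (0, 1)).2 - μ) - (A (0, 1)).1 * (A (1, 0)).2) * v.1 = 0 := by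
    linear_combination ((A (0, 1)).2 - μ) * e1 - (A (0, 1)).1 * e2
  have f2 : (((A (1, 0)).1 - μ) * ((A (0, 1)).2 - μ) - (A (0, 1)).1 * (A (1, 0)).2) * v.2 = 0 := by
    linear_combination ((A (1, 0)).1 - μ) * e2 - (A (1, 0)).2 * e1
  exact Prod.ext ((mul_eq_zero.mp f1).resolve_left hne) ((mul_eq_zero.mp f2).resolve_left hne)

/-- The Cayley-Hamilton theorem for an endomorphism of `ℂ²` with eigenvalues `μ` and `ν`. -/
theorem apply_apply_eq_of_charpoly {A : ℂ × ℂ →L[ℂ] ℂ × ℂ} {μ ν : ℂ}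
    (h1 : ((A (1, 0)).1 - μ) * ((A (0, 1)).2 - μ) - (A (0, 1)).1 * (A (1, 0)).2 = 0)
    (h2 : ν = (A (1, 0)).1 + (A (0, 1)).2 - μ) (v : ℂ × ℂ) :
    A (A v) = (μ + ν) • A v - (μ * ν) • v := by
  subst h2
  rw [A.apply_prod_eq (A v), A.apply_prod_eq v]
  ext
  · simp only [Prod.fst_sub, Prod.smul_fst, smul_eq_mul]
    linear_combination -v.1 * h1
  · simp only [Prod.snd_sub, Prod.smul_snd, smul_eq_mul]
    linear_combination -v.2 * h1

/-- The two vectors are `(l - n) • v` and `(n - l) • w`, nonzero multiples of eigenvectors for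
distinct eigenvalues. It shows that the analytic eigenframe built below is a basis at `t = 0`. -/
theorem injective_smul_add_smul_of_eigenvectors {A : ℂ × ℂ →L[ℂ] ℂ × ℂ} {l n : ℂ} (hne : l ≠ n)
    {v w : ℂ × ℂ} (hv : A v = l • v) (hw : A w = n • w) (hv0 : v ≠ 0) (hw0 : w ≠ 0) :
    Function.Injective fun z : ℂ × ℂ => z.1 • (A v - n • v) + z.2 • (A w - l • w) := by
  intro z z' hz
  have hne' : l - n ≠ 0 := sub_ne_zero.mpr hne
  simp only [hv, hw] at hz
  have h1 : ((z.1 - z'.1) * (l - n)) • v - ((z.2 - z'.2) * (l - n)) • w = 0 := by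
    rw [← sub_eq_zero.mpr hz]
    module
  have h2 := congrArg A h1
  simp only [map_sub, map_smul, hv, hw, _root_.map_zero] at h2
  have k1 : ((z.2 - z'.2) * (l - n) * (l - n)) • w = 0 := by
    have : ((z.2 - z'.2) * (l - n) * (l - n)) • w =
        (((z.1 - z'.1) * (l - n)) • l • v - ((z.2 - z'.2) * (l - n)) • n • w) -
        l • (((z.1 - z'.1) * (l - n)) • v - ((z.2 - z'.2) * (l - n)) • w) := by module
    rw [this, h1, h2, smul_zero, sub_zero]
  have k2 : ((z.1 - z'.1) * (l - n) * (l - n)) • v = 0 := by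
    have : ((z.1 - z'.1) * (l - n) * (l - n)) • v =
        (((z.1 - z'.1) * (l - n)) • l • v - ((z.2 - z'.2) * (l - n)) • n • w) -
        n • (((z.1 - z'.1) * (l - n)) • v - ((z.2 - z'.2) * (l - n)) • w) := by module
    rw [this, h1, h2, smul_zero, sub_zero]
  have k1' := (smul_eq_zero.mp k1).resolve_right hw0
  have k2' := (smul_eq_zero.mp k2).resolve_right hv0
  simp only [mul_eq_zero, hne', or_false] at k1' k2'
  exact Prod.ext (sub_eq_zero.mp k2') (sub_eq_zero.mp k1')

/-- The holomorphic extension of the family, with its second eigenvalue and eigenvectors. -/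
theorem exists_familyGerm {lam : ℂ} {K : Set ℂ} (hK : Set.range Complex.ofReal ⊆ K)
    {δ : ℝ} (hδ : 0 < δ) {H : ℂ → ℂ × ℂ → ℂ × ℂ} {nu : ℂ → ℂ}
    (hH : IsAnalyticFamily (K ∩ Metric.ball 0 δ) H)
    (hdiffeo : ∀ t ∈ K ∩ Metric.ball 0 δ, IsGermDiffeo (H t))
    (heig₁ : ∀ t ∈ K ∩ Metric.ball 0 δ,
      Module.End.HasEigenvalue (fderiv ℂ (H t) 0).toLinearMap ((1 + t) * lam))
    (heig₂ : ∀ t ∈ K ∩ Metric.ball 0 δ,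
      Module.End.HasEigenvalue (fderiv ℂ (H t) 0).toLinearMap (nu t))
    (hnu : ∀ t ∈ K ∩ Metric.ball 0 δ, ‖nu t‖ < ‖(1 + t) * lam‖) :
    ∃ f, FamilyGerm f ∧ (∀ᶠ p in 𝓝 (0 : ℂ × ℂ × ℂ), p.1 ∈ K → (f p).2 = H p.1 p.2) ∧
      ∃ ν : ℂ → ℂ, AnalyticAt ℂ ν 0 ∧ (∀ᶠ t in 𝓝 (0 : ℂ), t ∈ K → ν t = nu t) ∧ ν 0 ≠ 0 ∧
      ∃ e₁ e₂ : ℂ → ℂ × ℂ, AnalyticAt ℂ e₁ 0 ∧ AnalyticAt ℂ e₂ 0 ∧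
        (Function.Injective fun z : ℂ × ℂ => z.1 • e₁ 0 + z.2 • e₂ 0) ∧
        (∀ᶠ t in 𝓝 (0 : ℂ), vderiv f t (e₁ t) = ((1 + t) * lam) • e₁ t) ∧
        ∀ᶠ t in 𝓝 (0 : ℂ), vderiv f t (e₂ t) = ν t • e₂ t := by
  have hK0 : (0 : ℂ) ∈ K := hK ⟨0, rfl⟩
  have h0 : (0 : ℂ) ∈ K ∩ Metric.ball 0 δ := ⟨hK0, Metric.mem_ball_self hδ⟩
  have hball : ∀ᶠ t in 𝓝 (0 : ℂ), t ∈ Metric.ball (0 : ℂ) δ := Metric.ball_mem_nhds _ hδ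
  obtain ⟨g, hg, hHg⟩ := hH.exists_extension hδ hK0
  let f : ℂ × ℂ × ℂ → ℂ × ℂ × ℂ := fun p => (p.1, g p)
  have hg0 : ∀ᶠ t in 𝓝 (0 : ℂ), g (t, 0) = 0 := by
    refine AnalyticAt.eventually_eq_zero_of_real_subset hK
      (AnalyticAt.fun_comp (g := g) (f := fun t : ℂ => (t, (0 : ℂ × ℂ))) hg (by fun_prop)) ?_
    filter_upwards [eventually_section hHg, hball] with t h1 h2 h3
    rw [← h1 h3]
    exact (hdiffeo t ⟨h3, h2⟩).2.1
  have hf : FamilyGerm f := ⟨analyticAt_fst.prod hg, Eventually.of_forall fun _ => rfl,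
    hg0.mono fun t ht => by simp [f, ht]⟩
  have hvd : ∀ᶠ t in 𝓝 (0 : ℂ), t ∈ K → fderiv ℂ (H t) 0 = vderiv f t := by
    filter_upwards [eventually_fiber hHg] with t ht hK'
    exact EventuallyEq.fderiv_eq (ht.mono fun z hz => hz hK')
  have hvd0 : fderiv ℂ (H 0) 0 = vderiv f 0 := hvd.self_of_nhds hK0
  have hl : AnalyticAt ℂ (fun t : ℂ => (1 + t) * lam) 0 := by fun_prop
  have hA := hf.analyticAt_vderiv_apply
  -- Trace minus the known eigenvalue: analytic in complex `t`, whereas `nu` is controlled only on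
  -- `K`.
  let ν : ℂ → ℂ := fun t => (vderiv f t (1, 0)).1 + (vderiv f t (0, 1)).2 - (1 + t) * lam
  have hν : AnalyticAt ℂ ν 0 := ((hA (1, 0)).fst_apply.add (hA (0, 1)).snd_apply).sub hl
  have hchar : ∀ᶠ t in 𝓝 (0 : ℂ), ((vderiv f t (1, 0)).1 - (1 + t) * lam) *
      ((vderiv f t (0, 1)).2 - (1 + t) * lam) - (vderiv f t (0, 1)).1 * (vderiv f t (1, 0)).2 = 0 := by
    refine AnalyticAt.eventually_eq_zero_of_real_subset hK
      ((((hA (1, 0)).fst_apply.sub hl).mul ((hA (0, 1)).snd_apply.sub hl)).sub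
        ((hA (0, 1)).fst_apply.mul (hA (1, 0)).snd_apply)) ?_
    filter_upwards [hvd, hball] with t h1 h2 h3
    have := charpoly_eq_zero_of_hasEigenvalue (heig₁ t ⟨h3, h2⟩)
    rwa [h1 h3] at this
  have hνnu : ∀ᶠ t in 𝓝 (0 : ℂ), t ∈ K → ν t = nu t := by
    filter_upwards [hvd, hball, hchar] with t h1 h2 h4 h3
    have h5 := charpoly_eq_zero_of_hasEigenvalue (heig₂ t ⟨h3, h2⟩)
    rw [h1 h3] at h5
    have h6 : (1 + t) * lam - nu t ≠ 0 := fun h => by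
      have := hnu t ⟨h3, h2⟩
      rw [sub_eq_zero.mp h] at this
      exact lt_irrefl _ this
    refine sub_eq_zero.mp ((mul_eq_zero.mp ?_).resolve_left h6)
    simp only [ν]
    linear_combination h5 - h4
  have hν0 : ν 0 = nu 0 := hνnu.self_of_nhds hK0
  obtain ⟨v, hv⟩ := (heig₁ 0 h0).exists_hasEigenvector
  obtain ⟨w, hw⟩ := (heig₂ 0 h0).exists_hasEigenvector
  have hv1 : vderiv f 0 v = ((1 + 0) * lam) • v := by rw [← hvd0]; exact hv.apply_eq_smul
  have hw1 : vderiv f 0 w = ν 0 • w := by rw [← hvd0, hν0]; exact hw.apply_eq_smul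
  have hne : (1 + 0) * lam - ν 0 ≠ 0 := fun h => by
    have := hnu 0 h0
    rw [sub_eq_zero.mp h, hν0] at this
    exact lt_irrefl _ this
  -- With `v`, `w` fixed eigenvectors at `t = 0`, Cayley-Hamilton makes `(A_t - ν_t) v` and `(A_t -
  -- λ_t) w` eigenvectors for `λ_t` and `ν_t`; they are analytic in `t` by construction.
  refine ⟨f, hf, hHg.mono fun p hp hK' => (hp hK').symm, ν, hν, hνnu, ?_,
    fun t => vderiv f t v - ν t • v, fun t => vderiv f t w - ((1 + t) * lam) • w,
    (hA v).sub (hν.smul analyticAt_const), (hA w).sub (hl.smul analyticAt_const), ?_, ?_, ?_⟩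
  · intro h
    rw [h, zero_smul, ← hvd0] at hw1
    obtain ⟨e, he⟩ := (hdiffeo 0 h0).2.2
    rw [← he] at hw1
    exact hw.2 (e.map_eq_zero_iff.mp hw1)
  · exact injective_smul_add_smul_of_eigenvectors (sub_ne_zero.mp hne) hv1 hw1 hv.2 hw.2
  · filter_upwards [hchar] with t ht
    rw [map_sub, map_smul, apply_apply_eq_of_charpoly ht rfl, smul_sub, smul_smul]
    module
  · filter_upwards [hchar] with t ht
    rw [map_sub, map_smul, apply_apply_eq_of_charpoly ht rfl, smul_sub, smul_smul]
    module

end Complexification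

/-! ### Lower bounds for the multiplicity of a fixed point. -/

section Multiplicity

open Filter

/-- A polynomial of degree less than `m` that vanishes to order `m` at the origin is zero. -/
theorem Polynomial.eq_zero_of_eval_eq_pow_mul {P : Polynomial ℂ} {m : ℕ} (hP : P.degree < m)
    {g : ℂ → ℂ} (hg : ContinuousAt g 0) (h : ∀ᶠ x in 𝓝 (0 : ℂ), P.eval x = x ^ m * g x) :
    P = 0 := by
  by_contra hne
  obtain ⟨R, hR, hR0⟩ := P.exists_eq_pow_rootMultiplicity_mul_and_not_dvd hne 0
  set k := P.rootMultiplicity 0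
  rw [Polynomial.C_0, sub_zero] at hR hR0
  have hR1 : R.eval 0 ≠ 0 := by
    rwa [Polynomial.X_dvd_iff, Polynomial.coeff_zero_eq_eval_zero] at hR0
  have hk : k < m := by
    have h1 : k ≤ P.natDegree := by
      rw [hR, Polynomial.natDegree_X_pow_mul]
      · omega
      · rintro rfl
        simp at hR1
    exact lt_of_le_of_lt h1 ((Polynomial.natDegree_lt_iff_degree_lt hne).mpr hP)
  obtain ⟨d, rfl⟩ := Nat.exists_eq_add_of_lt hk
  have h1 : ∀ᶠ x in 𝓝[≠] (0 : ℂ), R.eval x = x ^ (d + 1) * g x := by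
    filter_upwards [h.filter_mono nhdsWithin_le_nhds, self_mem_nhdsWithin] with x hx hx0
    rw [hR, Polynomial.eval_mul, Polynomial.eval_pow, Polynomial.eval_X] at hx
    have hx1 : x ^ k ≠ 0 := pow_ne_zero _ hx0
    refine mul_left_cancel₀ hx1 ?_
    rw [hx]
    ring
  have h2 : Tendsto (fun x => R.eval x) (𝓝[≠] (0 : ℂ)) (𝓝 (R.eval 0)) :=
    (R.continuous.tendsto 0).mono_left nhdsWithin_le_nhds
  have h3 : Tendsto (fun x => x ^ (d + 1) * g x) (𝓝[≠] (0 : ℂ)) (𝓝 ((0 : ℂ) ^ (d + 1) * g 0)) :=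
    (((continuousAt_id.pow _).mul hg).tendsto).mono_left nhdsWithin_le_nhds
  apply hR1
  rw [tendsto_nhds_unique (h2.congr' h1) h3]
  simp

/-- The germs that vanish to order `m` along the curve `c`. -/
def vanishingIdeal {c : ℂ → ℂ × ℂ} (hc : AnalyticAt ℂ c 0) (hc0 : c 0 = 0) (m : ℕ) :
    Ideal holoAtZero where
  carrier := {f | ∃ g : ℂ → ℂ, AnalyticAt ℂ g 0 ∧
    ∀ᶠ x in 𝓝 (0 : ℂ), (f : ℂ × ℂ → ℂ) (c x) = x ^ m * g x}
  zero_mem' := ⟨0, analyticAt_const, Eventually.of_forall fun x => by simp⟩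
  add_mem' := by
    rintro f f' ⟨g, hg, h⟩ ⟨g', hg', h'⟩
    refine ⟨_, hg.add hg', ?_⟩
    filter_upwards [h, h'] with x hx hx'
    simp [hx, hx', mul_add]
  smul_mem' := by
    rintro f f' ⟨g, hg, h⟩
    refine ⟨fun x => (f : ℂ × ℂ → ℂ) (c x) * g x, ?_, ?_⟩
    · exact (AnalyticAt.fun_comp (g := (f : ℂ × ℂ → ℂ)) (by rw [hc0]; exact f.2) hc).mul hg
    · filter_upwards [h] with x hx
      simp [hx, mul_left_comm]

theorem componentIdeal_le_vanishingIdeal {F : ℂ × ℂ → ℂ × ℂ} {c : ℂ → ℂ × ℂ}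
    (hc : AnalyticAt ℂ c 0) (hc0 : c 0 = 0) {m : ℕ} {g : ℂ → ℂ × ℂ} (hg : AnalyticAt ℂ g 0)
    (h : ∀ᶠ x in 𝓝 (0 : ℂ), F (c x) = x ^ m • g x) :
    componentIdeal F ≤ vanishingIdeal hc hc0 m := by
  have hct : Tendsto c (𝓝 0) (𝓝 0) := by simpa [hc0] using hc.continuousAt.tendsto
  refine Ideal.span_le.mpr ?_
  rintro f (hf | hf | hf)
  · exact ⟨0, analyticAt_const, (hct.eventually hf).mono fun x hx => by simpa using hx⟩
  · refine ⟨fun x => (g x).1, hg.fst_apply, ?_⟩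
    filter_upwards [hct.eventually hf, h] with x h1 h2
    rw [h1, h2]
    simp
  · refine ⟨fun x => (g x).2, hg.snd_apply, ?_⟩
    filter_upwards [hct.eventually hf, h] with x h1 h2
    rw [h1, h2]
    simp

/-- A smooth curve along which `G - id` vanishes to order `m` bounds the multiplicity of the fixed
point from below. -/
theorem HasFixedPointMultiplicity.le_of_curve {G : ℂ × ℂ → ℂ × ℂ} {n m : ℕ}
    (hG : HasFixedPointMultiplicity G n) {c g : ℂ → ℂ × ℂ} (hc : AnalyticAt ℂ c 0) (hc0 : c 0 = 0)
    (hg : AnalyticAt ℂ g 0) (h : ∀ᶠ x in 𝓝 (0 : ℂ), G (c x) - c x = x ^ m • g x)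
    {l : ℂ × ℂ → ℂ} (hl : AnalyticAt ℂ l 0) (hlc : ∀ᶠ x in 𝓝 (0 : ℂ), l (c x) = x) : m ≤ n := by
  let l' : holoAtZero := ⟨l, hl⟩
  let I := componentIdeal fun z => G z - z
  -- Polynomials in `l` of degree below `m` are independent in the local algebra: on the curve `l`
  -- becomes `x`, and elements of the ideal become divisible by `x ^ m`.
  let T : Polynomial.degreeLT ℂ m →ₗ[ℂ] holoAtZero ⧸ I :=
    (Ideal.Quotient.mkₐ ℂ I).toLinearMap ∘ₗ (Polynomial.aeval l').toLinearMap ∘ₗ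
      (Polynomial.degreeLT ℂ m).subtype
  have hT : Function.Injective T := by
    refine (injective_iff_map_eq_zero T).mpr fun P hP => ?_
    have h1 : Polynomial.aeval l' (P : Polynomial ℂ) ∈ I := Ideal.Quotient.eq_zero_iff_mem.mp hP
    obtain ⟨r, hr, h2⟩ := componentIdeal_le_vanishingIdeal hc hc0 hg h h1
    refine Subtype.ext (Polynomial.eq_zero_of_eval_eq_pow_mul
      (Polynomial.mem_degreeLT.mp P.2) hr.continuousAt ?_)
    filter_upwards [h2, hlc] with x hx hx'
    rw [← hx]
    let e : holoAtZero →ₐ[ℂ] ℂ := (Pi.evalAlgHom ℂ _ (c x)).comp holoAtZero.val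
    have h3 := Polynomial.aeval_algHom_apply e l' (P : Polynomial ℂ)
    have h4 : e l' = x := hx'
    rw [h4, Polynomial.coe_aeval_eq_eval] at h3
    exact h3
  have h1 := LinearMap.rank_le_of_injective T hT
  rw [(Polynomial.degreeLTEquiv ℂ m).rank_eq, rank_fin_fun, hG] at h1
  exact_mod_cast h1

/-- Since `x = 0` is invariant, `x ∘ N` is a multiple of `x`, and a remainder divisible by `x ^ (m +
1)` stays so under composition. -/
theorem exists_iterate_eq {N : ℂ × ℂ → ℂ × ℂ} {l n : ℂ} {m : ℕ} {r k : ℂ × ℂ → ℂ}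
    (hr : AnalyticAt ℂ r 0) (hk : AnalyticAt ℂ k 0)
    (hN : ∀ᶠ z in 𝓝 (0 : ℂ × ℂ),
      N z = (l * z.1 + z.1 ^ (m + 1) * r z, n * z.2 + z.1 * k z)) (j : ℕ) :
    ∃ r' k' : ℂ × ℂ → ℂ, AnalyticAt ℂ r' 0 ∧ AnalyticAt ℂ k' 0 ∧ ∀ᶠ z in 𝓝 (0 : ℂ × ℂ),
      N^[j] z = (l ^ j * z.1 + z.1 ^ (m + 1) * r' z, n ^ j * z.2 + z.1 * k' z) := by
  have hNa : AnalyticAt ℂ N 0 := by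
    refine AnalyticAt.congr (AnalyticAt.prod ?_ ?_) (EventuallyEq.symm hN)
    · exact AnalyticAt.add (by fun_prop) (AnalyticAt.mul (by fun_prop) hr)
    · exact AnalyticAt.add (by fun_prop) (AnalyticAt.mul (by fun_prop) hk)
  have hN0 : N 0 = 0 := by
    rw [hN.self_of_nhds]
    simp
  have hNt : Tendsto N (𝓝 0) (𝓝 0) := by simpa [hN0] using hNa.continuousAt.tendsto
  induction j with
  | zero => exact ⟨0, 0, analyticAt_const, analyticAt_const, Eventually.of_forall fun z => by simp⟩
  | succ j ih =>
    obtain ⟨r', k', hr', hk', h⟩ := ih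
    have hr2 : AnalyticAt ℂ (fun z => r' (N z)) 0 :=
      AnalyticAt.fun_comp (by rw [hN0]; exact hr') hNa
    have hk2 : AnalyticAt ℂ (fun z => k' (N z)) 0 :=
      AnalyticAt.fun_comp (by rw [hN0]; exact hk') hNa
    have hu : AnalyticAt ℂ (fun z : ℂ × ℂ => l + z.1 ^ m * r z) 0 :=
      AnalyticAt.add analyticAt_const (AnalyticAt.mul (by fun_prop) hr)
    refine ⟨fun z => l ^ j * r z + (l + z.1 ^ m * r z) ^ (m + 1) * r' (N z),
      fun z => n ^ j * k z + (l + z.1 ^ m * r z) * k' (N z),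
      (analyticAt_const.mul hr).add ((hu.pow _).mul hr2),
      (analyticAt_const.mul hk).add (hu.mul hk2), ?_⟩
    filter_upwards [hNt.eventually h, hN] with z h1 h2
    rw [Function.iterate_succ_apply, h1]
    have e1 : (N z).1 = z.1 * (l + z.1 ^ m * r z) := by
      rw [h2]
      ring
    have e2 : (N z).2 = n * z.2 + z.1 * k z := by rw [h2]
    rw [e1, e2]
    ext
    · rw [mul_pow z.1]
      ring
    · ring

theorem eventually_iterate_conj {H Φ Φ' : ℂ × ℂ → ℂ × ℂ} (hH : Tendsto H (𝓝 0) (𝓝 0))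
    (hΦ : Tendsto Φ (𝓝 0) (𝓝 0)) (hΦ' : Tendsto Φ' (𝓝 0) (𝓝 0))
    (hl : ∀ᶠ z in 𝓝 0, Φ' (Φ z) = z) (j : ℕ) :
    ∀ᶠ z in 𝓝 0, H^[j] (Φ' z) = Φ' ((fun z => Φ (H (Φ' z)))^[j] z) := by
  have hHΦ := hH.comp hΦ'
  induction j with
  | zero => exact Eventually.of_forall fun z => rfl
  | succ j ih =>
    filter_upwards [(hΦ.comp hHΦ).eventually ih, hHΦ.eventually hl] with z h1 h2
    simp only [Function.comp_apply] at h1 h2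
    rw [Function.iterate_succ_apply, Function.iterate_succ_apply, ← h1, h2]

/-- If `H` is conjugate to `(x, y) ↦ (l x + O(x^(m+1)), n y + O(x))` with `l ^ q = 1` and
`n ^ q ≠ 1`, then the multiplicity of the origin as a fixed point of `H^[q]` is at least `m + 1`. -/
theorem HasFixedPointMultiplicity.le_of_conj {H Φ Φ' : ℂ × ℂ → ℂ × ℂ} {q d : ℕ}
    (hmult : HasFixedPointMultiplicity H^[q] d)
    (hH : Tendsto H (𝓝 0) (𝓝 0)) (hΦ : AnalyticAt ℂ Φ 0) (hΦ' : AnalyticAt ℂ Φ' 0)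
    (hΦ0 : Φ 0 = 0) (hΦ0' : Φ' 0 = 0) (hl : ∀ᶠ z in 𝓝 0, Φ' (Φ z) = z)
    (hr : ∀ᶠ z in 𝓝 0, Φ (Φ' z) = z) {l n : ℂ} (hlq : l ^ q = 1) (hnq : n ^ q ≠ 1) {m : ℕ}
    {r k : ℂ × ℂ → ℂ} (hra : AnalyticAt ℂ r 0) (hk : AnalyticAt ℂ k 0)
    (hN : ∀ᶠ z in 𝓝 (0 : ℂ × ℂ),
      Φ (H (Φ' z)) = (l * z.1 + z.1 ^ (m + 1) * r z, n * z.2 + z.1 * k z)) : m + 1 ≤ d := by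
  obtain ⟨r', k', hr', hk', hj⟩ := exists_iterate_eq hra hk hN q
  have hΦt : Tendsto Φ (𝓝 0) (𝓝 0) := by simpa [hΦ0] using hΦ.continuousAt.tendsto
  have hΦt' : Tendsto Φ' (𝓝 0) (𝓝 0) := by simpa [hΦ0'] using hΦ'.continuousAt.tendsto
  have hconj := eventually_iterate_conj hH hΦt hΦt' hl q
  -- the curve on which the second coordinate is fixed
  let E : ℂ × ℂ → ℂ × ℂ := fun z => (z.1, (1 - n ^ q) * z.2 - z.1 * k' z)
  have hE : AnalyticAt ℂ E 0 := by
    refine analyticAt_fst.prod (AnalyticAt.sub (by fun_prop) (AnalyticAt.mul (by fun_prop) hk'))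
  have hE0 : E 0 = 0 := by simp [E]
  have hEd : ∀ v, fderiv ℂ E 0 v = (v.1, (1 - n ^ q) * v.2 - v.1 * k' 0) := by
    have h1 : HasFDerivAt (fun z : ℂ × ℂ => z.1) (ContinuousLinearMap.fst ℂ ℂ ℂ) 0 :=
      hasFDerivAt_fst
    have h2 : HasFDerivAt (fun z : ℂ × ℂ => z.2) (ContinuousLinearMap.snd ℂ ℂ ℂ) 0 :=
      hasFDerivAt_snd
    have h3 := h1.prodMk ((h2.const_mul (1 - n ^ q)).sub
      (h1.mul hk'.differentiableAt.hasFDerivAt))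
    intro v
    have h4 : fderiv ℂ E 0 = _ := h3.fderiv
    rw [h4]
    simp [mul_comm]
  -- `E` is invertible because its derivative is triangular with diagonal entries `1` and `1 - n ^ q
  -- ≠ 0`; the curve is the preimage of the `x`-axis.
  obtain ⟨g, hg, hg0, -, hgr⟩ := hE.exists_local_inverse hE0 (by
    intro v w hvw
    rw [hEd, hEd, Prod.mk.injEq] at hvw
    obtain ⟨h1, h2⟩ := hvw
    rw [h1, sub_left_inj] at h2
    exact Prod.ext h1 (mul_left_cancel₀ (sub_ne_zero.mpr hnq.symm) h2))
  let c : ℂ → ℂ × ℂ := fun x => g (x, 0)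
  have hc : AnalyticAt ℂ c 0 :=
    AnalyticAt.fun_comp (g := g) (f := fun x : ℂ => (x, (0 : ℂ))) hg (by fun_prop)
  have hc0 : c 0 = 0 := hg0
  have hct : Tendsto c (𝓝 0) (𝓝 0) := by simpa [hc0] using hc.continuousAt.tendsto
  have hEc : ∀ᶠ x in 𝓝 (0 : ℂ), E (c x) = (x, 0) :=
    (Continuous.tendsto' (f := fun x : ℂ => (x, (0 : ℂ))) (by fun_prop) 0 0 rfl).eventually hgr
  -- differences of values of the inverse chart
  let D : (ℂ × ℂ) × ℂ → ℂ × ℂ := fun p => Φ' (p.1 + (p.2, 0)) - Φ' p.1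
  have hD : AnalyticAt ℂ D 0 := by
    refine AnalyticAt.sub (AnalyticAt.fun_comp (g := Φ')
      (f := fun p : (ℂ × ℂ) × ℂ => p.1 + (p.2, 0)) ?_ (by fun_prop))
      (AnalyticAt.fun_comp (g := Φ') hΦ' analyticAt_fst)
    rwa [show (0 : (ℂ × ℂ) × ℂ).1 + ((0 : (ℂ × ℂ) × ℂ).2, (0 : ℂ)) = 0 from add_zero _]
  obtain ⟨b, hb, hDb⟩ := hD.exists_eq_smul_of_eq_zero (ContinuousLinearMap.snd ℂ (ℂ × ℂ) ℂ)
    (v := (0, 1)) rfl (Eventually.of_forall fun p hp => by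
      have : p.2 = 0 := hp
      rw [show D p = Φ' (p.1 + (p.2, 0)) - Φ' p.1 from rfl, this,
        show p.1 + ((0 : ℂ), (0 : ℂ)) = p.1 from add_zero _, sub_self])
  have hrc : AnalyticAt ℂ (fun x => r' (c x)) 0 :=
    AnalyticAt.fun_comp (by rw [hc0]; exact hr') hc
  have hp : AnalyticAt ℂ (fun x => (c x, x ^ (m + 1) * r' (c x))) 0 :=
    hc.prod (AnalyticAt.mul (by fun_prop) hrc)
  have hp0 : (c 0, (0 : ℂ) ^ (m + 1) * r' (c 0)) = 0 := by simp [hc0]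
  have hpt : Tendsto (fun x => (c x, x ^ (m + 1) * r' (c x))) (𝓝 0) (𝓝 0) := by
    have := hp.continuousAt.tendsto
    rwa [hp0] at this
  have hbp : AnalyticAt ℂ (fun x => b (c x, x ^ (m + 1) * r' (c x))) 0 :=
    AnalyticAt.fun_comp (g := b) (by rw [hp0]; exact hb) hp
  -- On the curve the `q`-th iterate moves only the first normal coordinate, by `x ^ (m + 1) * r'`.
  -- Divisibility of `D` by its shift carries this order of vanishing back to `H`; the first
  -- coordinate of `Φ` parameterizes the curve.
  refine hmult.le_of_curve (c := fun x => Φ' (c x))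
    (g := fun x => r' (c x) • b (c x, x ^ (m + 1) * r' (c x)))
    (AnalyticAt.fun_comp (by rw [hc0]; exact hΦ') hc) (by rw [hc0, hΦ0']) (hrc.smul hbp) ?_
    (l := fun z => (Φ z).1) hΦ.fst_apply ?_
  · filter_upwards [hct.eventually hj, hct.eventually hconj, hEc, hpt.eventually hDb]
      with x h1 h2 h3 h4
    have e1 : (c x).1 = x := congrArg Prod.fst h3
    have e2 : (1 - n ^ q) * (c x).2 - (c x).1 * k' (c x) = 0 := congrArg Prod.snd h3
    simp only [ContinuousLinearMap.coe_snd'] at h4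
    rw [smul_smul, ← h4, h2]
    have e3 : (fun z => Φ (H (Φ' z)))^[q] (c x) = c x + (x ^ (m + 1) * r' (c x), 0) := by
      rw [h1, hlq, e1]
      ext
      · simp [e1]
      · simp only [Prod.snd_add]
        linear_combination -e2 - k' (c x) * e1
    rw [e3]
  · filter_upwards [hct.eventually hr, hEc] with x h1 h2
    rw [h1]
    exact congrArg Prod.fst h2

end Multiplicity

/-! ### Normal form charts, nonvanishing of the leading coefficient, rescaling. -/

section NormalForm

open Filter

/-- In the coordinates `Θ`, with inverse `Ψ`, the family `f` has the form
`(t, x, y) ↦ (t, l t * (x + A t * x^(q+1) + C t * x^(2q+1) + O(x^(2q+2))), ν t * y + x * h (t, x, y))`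
with `h (t, 0, 0) = 0`. -/
structure NormalFormChart (q : ℕ) (l ν A C : ℂ → ℂ) (G h : ℂ × ℂ × ℂ → ℂ)
    (Θ Ψ f : ℂ × ℂ × ℂ → ℂ × ℂ × ℂ) : Prop where
  chart : FamilyChart Θ Ψ
  analyticAt_coeff : AnalyticAt ℂ A 0
  analyticAt_resonant : AnalyticAt ℂ C 0
  analyticAt_remainder : AnalyticAt ℂ G 0
  analyticAt_snd : AnalyticAt ℂ h 0
  snd_eq_zero : ∀ᶠ t in 𝓝 (0 : ℂ), h (t, 0) = 0
  eq : ∀ᶠ p in 𝓝 (0 : ℂ × ℂ × ℂ), Θ (f (Ψ p)) =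
    (p.1, l p.1 * (p.2.1 + A p.1 * p.2.1 ^ (q + 1) + C p.1 * p.2.1 ^ (2 * q + 1)
      + p.2.1 ^ (2 * q + 2) * G p), ν p.1 * p.2.2 + p.2.1 * h p)

/-- Multiplication of the first coordinate by a unit is a chart. -/
theorem exists_chart_of_unit {U : ℂ × ℂ × ℂ → ℂ} (hU : AnalyticAt ℂ U 0) (hU0 : U 0 ≠ 0) :
    ∃ Ψ, FamilyChart (fun p => (p.1, p.2.1 * U p, p.2.2)) Ψ := by
  have hΘ : FamilyGerm (fun p : ℂ × ℂ × ℂ => (p.1, p.2.1 * U p, p.2.2)) := by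
    refine ⟨analyticAt_fst.prod (AnalyticAt.prod (AnalyticAt.mul (by fun_prop) hU) (by fun_prop)),
      Eventually.of_forall fun p => rfl, Eventually.of_forall fun t => by simp⟩
  refine hΘ.exists_chart ?_
  have h1 : HasFDerivAt (fun z : ℂ × ℂ => z.1) (ContinuousLinearMap.fst ℂ ℂ ℂ) 0 := hasFDerivAt_fst
  have h2 : HasFDerivAt (fun z : ℂ × ℂ => z.2) (ContinuousLinearMap.snd ℂ ℂ ℂ) 0 := hasFDerivAt_snd
  have h3 : AnalyticAt ℂ (fun z : ℂ × ℂ => U (0, z)) 0 := AnalyticAt.fiber hU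
  have h4 := ((h1.mul h3.differentiableAt.hasFDerivAt).prodMk h2).fderiv
  intro v w hvw
  rw [vderiv] at hvw
  erw [h4] at hvw
  have h5 : U ((0 : ℂ), (0 : ℂ × ℂ)) ≠ 0 := hU0
  simpa [Prod.ext_iff, h5] using hvw

/-- A family with diagonalizable linear parts has a chart in normal form. -/
theorem FamilyGerm.exists_normalFormChart {q : ℕ} (hq : 0 < q) {lam : ℂ}
    (hlam : IsPrimitiveRoot lam q) {f : ℂ × ℂ × ℂ → ℂ × ℂ × ℂ} (hf : FamilyGerm f) {ν : ℂ → ℂ}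
    (hν : AnalyticAt ℂ ν 0) (hν0 : ν 0 ≠ 0) (hν1 : ‖ν 0‖ < 1) {e₁ e₂ : ℂ → ℂ × ℂ}
    (he₁ : AnalyticAt ℂ e₁ 0) (he₂ : AnalyticAt ℂ e₂ 0)
    (hinj : Function.Injective fun z : ℂ × ℂ => z.1 • e₁ 0 + z.2 • e₂ 0)
    (h₁ : ∀ᶠ t in 𝓝 (0 : ℂ), vderiv f t (e₁ t) = ((1 + t) * lam) • e₁ t)
    (h₂ : ∀ᶠ t in 𝓝 (0 : ℂ), vderiv f t (e₂ t) = ν t • e₂ t) :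
    ∃ A C G h Θ Ψ, NormalFormChart q (fun t => (1 + t) * lam) ν A C G h Θ Ψ f := by
  have hlam0 : lam ≠ 0 := hlam.ne_zero hq.ne'
  have hlam1 : ‖lam‖ = 1 := hlam.norm'_eq_one hq.ne'
  have hl : AnalyticAt ℂ (fun t : ℂ => (1 + t) * lam) 0 := by fun_prop
  obtain ⟨Θ₁, Ψ₁, c₁, hd⟩ := hf.exists_chart_diag he₁ he₂ hinj h₁ h₂
  obtain ⟨Θ₂, Ψ₂, c₂, a, h, ha, hh, ha0, hh0, hF⟩ :=
    (c₁.germ_inv.comp (hf.comp c₁.germ)).exists_chart_straight hl hν hν0 hν1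
      (by simpa [hlam1] using hν1) hd
  obtain ⟨U, G, A, C, hU, hU0, hG, hA, hC, hN⟩ := exists_normalForm_coordinate hq hlam hν hν1 ha hh ha0
  obtain ⟨Ψ₃, c₃⟩ := exists_chart_of_unit hU hU0
  have hΨ0 := c₃.germ_inv.apply_zero
  have comp : ∀ {g : ℂ × ℂ × ℂ → ℂ}, AnalyticAt ℂ g 0 → AnalyticAt ℂ (fun p => g (Ψ₃ p)) 0 :=
    fun hg => AnalyticAt.fun_comp (by rw [hΨ0]; exact hg) c₃.germ_inv.analyticAt
  have hU3 : U (Ψ₃ 0) ≠ 0 := by rwa [hΨ0]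
  have hl3 : AnalyticAt ℂ (fun p : ℂ × ℂ × ℂ => (1 + p.1) * lam) 0 := by fun_prop
  -- In terms of the new coordinate `x * U`, the remainder acquires `U ^ (2 * q + 2)` in the
  -- denominator, along with the multiplier since it is placed inside the bracket; similarly `h` is
  -- divided by `U`.
  refine ⟨A, C, fun p => G (Ψ₃ p) / (U (Ψ₃ p) ^ (2 * q + 2) * ((1 + p.1) * lam)),
    fun p => h (Ψ₃ p) / U (Ψ₃ p), _, _, ⟨(c₁.symm.trans c₂.symm).trans c₃, hA, hC,
      (comp hG).div (((comp hU).pow _).mul hl3)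
        (mul_ne_zero (pow_ne_zero _ hU3) (by simpa using hlam0)),
      (comp hh).div (comp hU) hU3, ?_, ?_⟩⟩
  · filter_upwards [c₃.germ_inv.map_zero, hh0] with t h1 h2
    have h3 : h (t, 0) = 0 := h2
    rw [h1, h3, zero_div]
  · have hlt : ∀ᶠ p in 𝓝 (0 : ℂ × ℂ × ℂ), (1 + p.1) * lam ≠ 0 :=
      hl3.continuousAt.eventually_ne (by simpa using hlam0)
    filter_upwards [c₃.germ_inv.tendsto.eventually hF, c₃.germ_inv.tendsto.eventually hN,
      c₃.right_inv, (comp hU).continuousAt.eventually_ne hU3, hlt] with p k1 k2 k3 k4 k5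
    rw [k1]
    generalize Ψ₃ p = w at *
    subst k3
    simp only at k5 ⊢
    rw [k2]
    generalize (1 + w.1) * lam = L at *
    refine Prod.ext rfl (Prod.ext ?_ ?_)
    · simp only
      rw [mul_pow _ _ (2 * q + 2)]
      field_simp
    · simp only
      field_simp

/-- The coefficient of `x^(q+1)` in the normal form does not vanish if the semi-parabolic
multiplicity is `1`. -/
theorem NormalFormChart.coeff_ne_zero {q : ℕ} (hq : 0 < q) {l ν A C : ℂ → ℂ}
    {G h : ℂ × ℂ × ℂ → ℂ} {Θ Ψ f : ℂ × ℂ × ℂ → ℂ × ℂ × ℂ}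
    (H : NormalFormChart q l ν A C G h Θ Ψ f) (hf : FamilyGerm f)
    (hl : l 0 ^ q = 1) (hν : ν 0 ^ q ≠ 1)
    {H₀ : ℂ × ℂ → ℂ × ℂ} (hH₀ : ∀ᶠ z in 𝓝 (0 : ℂ × ℂ), (f (0, z)).2 = H₀ z)
    (hmult : HasSemiParabolicMultiplicity q H₀ 1) : A 0 ≠ 0 := by
  intro hA
  obtain ⟨q, rfl⟩ := Nat.exists_eq_add_of_lt hq
  have slice : ∀ {F : ℂ × ℂ × ℂ → ℂ × ℂ × ℂ}, FamilyGerm F →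
      AnalyticAt ℂ (fun z : ℂ × ℂ => (F ((0 : ℂ), z)).2) 0 ∧
      (F ((0 : ℂ), (0 : ℂ × ℂ))).2 = 0 ∧ ∀ᶠ z in 𝓝 (0 : ℂ × ℂ), F (0, z) = (0, (F (0, z)).2) := by
    intro F hF
    refine ⟨AnalyticAt.snd_apply (AnalyticAt.fiber hF.analyticAt), ?_,
      (eventually_fiber hF.eq_mk).self_of_nhds⟩
    exact congrArg Prod.snd hF.apply_zero
  have slice_tendsto : ∀ {F : ℂ × ℂ × ℂ → ℂ × ℂ × ℂ}, FamilyGerm F →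
      Tendsto (fun z : ℂ × ℂ => (F ((0 : ℂ), z)).2) (𝓝 0) (𝓝 0) := by
    intro F hF
    have := (slice hF).1.continuousAt.tendsto
    rwa [(slice hF).2.1] at this
  obtain ⟨hΘa, hΘ0, hΘe⟩ := slice H.chart.germ
  obtain ⟨hΨa, hΨ0, hΨe⟩ := slice H.chart.germ_inv
  obtain ⟨-, -, hfe⟩ := slice hf
  have hle := HasFixedPointMultiplicity.le_of_conj hmult ((slice_tendsto hf).congr' hH₀) hΘa hΨa hΘ0 hΨ0
    (by
      filter_upwards [hΘe, (eventually_fiber H.chart.left_inv).self_of_nhds] with z h1 h2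
      rw [← h1, h2])
    (by
      filter_upwards [hΨe, (eventually_fiber H.chart.right_inv).self_of_nhds] with z h1 h2
      rw [← h1, h2])
    -- Here `m` is the original `q` plus 1: with `A 0 = 0` the remainder starts at order `m + 1`,
    -- forcing multiplicity at least `q + 2` in place of `q + 1`.
    hl hν (m := 0 + q + 1 + 1)
    (r := fun z => l 0 * (C 0 * z.1 ^ q + z.1 ^ (q + 1) * G (0, z))) (k := fun z => h (0, z))
    (AnalyticAt.mul analyticAt_const (AnalyticAt.add (by fun_prop)
      (AnalyticAt.mul (by fun_prop) (AnalyticAt.fiber H.analyticAt_remainder))))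
    (AnalyticAt.fiber H.analyticAt_snd) (by
      filter_upwards [hΨe, (slice_tendsto H.chart.germ_inv).eventually hfe,
        (slice_tendsto H.chart.germ_inv).eventually hH₀, (eventually_fiber H.eq).self_of_nhds] with z h1 h2 h4 h3
      rw [← h4, ← h2, ← h1, h3, hA]
      refine Prod.ext ?_ rfl
      simp only
      ring)
  omega

/-- A root of `A 0` times the principal root of `A t / A 0`, which is near 1 and so away from the
branch cut. -/
theorem exists_analyticAt_pow_eq {q : ℕ} (hq : 0 < q) {A : ℂ → ℂ} (hA : AnalyticAt ℂ A 0)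
    (hA0 : A 0 ≠ 0) :
    ∃ s : ℂ → ℂ, AnalyticAt ℂ s 0 ∧ s 0 ≠ 0 ∧ ∀ᶠ t in 𝓝 (0 : ℂ), s t ^ q = A t := by
  obtain ⟨c, hc⟩ := IsAlgClosed.exists_pow_nat_eq (A 0) hq
  have hc0 : c ≠ 0 := by
    rintro rfl
    rw [zero_pow hq.ne'] at hc
    exact hA0 hc.symm
  have hq' : (q : ℂ) ≠ 0 := Nat.cast_ne_zero.mpr hq.ne'
  refine ⟨fun t => c * Complex.exp (Complex.log (A t / A 0) / q), ?_,
    mul_ne_zero hc0 (Complex.exp_ne_zero _), ?_⟩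
  · refine analyticAt_const.mul (AnalyticAt.cexp (AnalyticAt.div_const
      (AnalyticAt.clog hA.div_const ?_)))
    rw [div_self hA0]
    exact Complex.one_mem_slitPlane
  · filter_upwards [hA.continuousAt.eventually_ne hA0] with t ht
    rw [mul_pow, hc, ← Complex.exp_nat_mul, mul_div_cancel₀ _ hq',
      Complex.exp_log (div_ne_zero ht hA0), mul_div_cancel₀ _ hA0]

/-- Rescaling the first coordinate makes the coefficient of `x^(q+1)` equal to `1`. -/
theorem NormalFormChart.exists_rescale {q : ℕ} (hq : 0 < q) {l ν A C : ℂ → ℂ}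
    {G h : ℂ × ℂ × ℂ → ℂ} {Θ Ψ f : ℂ × ℂ × ℂ → ℂ × ℂ × ℂ}
    (H : NormalFormChart q l ν A C G h Θ Ψ f) (hA0 : A 0 ≠ 0) :
    ∃ C' G' h' Θ' Ψ', NormalFormChart q l ν (fun _ => 1) C' G' h' Θ' Ψ' f := by
  obtain ⟨s, hs, hs0, hsA⟩ := exists_analyticAt_pow_eq hq H.analyticAt_coeff hA0
  have hs3 : AnalyticAt ℂ (fun p : ℂ × ℂ × ℂ => s p.1) 0 :=
    AnalyticAt.fun_comp (g := s) (f := fun p : ℂ × ℂ × ℂ => p.1) hs analyticAt_fst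
  obtain ⟨S, hS⟩ := exists_chart_of_unit hs3 hs0
  have hsne : ∀ᶠ p in 𝓝 (0 : ℂ × ℂ × ℂ), s p.1 ≠ 0 := hs3.continuousAt.eventually_ne hs0
  have hsA3 : ∀ᶠ p in 𝓝 (0 : ℂ × ℂ × ℂ), s p.1 ^ q = A p.1 :=
    (continuous_fst.tendsto' (0 : ℂ × ℂ × ℂ) 0 rfl).eventually hsA
  have comp : ∀ {g : ℂ × ℂ × ℂ → ℂ}, AnalyticAt ℂ g 0 → AnalyticAt ℂ (fun p => g (S p)) 0 :=
    fun hg => AnalyticAt.fun_comp (by rw [hS.germ_inv.apply_zero]; exact hg) hS.germ_inv.analyticAt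
  -- Under `x ↦ s * x` the coefficient of `x ^ i` inside the bracket is divided by `s ^ (i - 1)`; at
  -- `i = q + 1` this is division by `A`.
  refine ⟨fun t => C t / s t ^ (2 * q), fun p => G (S p) / s p.1 ^ (2 * q + 1),
    fun p => h (S p) / s p.1, _, _, ⟨H.chart.trans hS, analyticAt_const,
      H.analyticAt_resonant.div (hs.pow _) (pow_ne_zero _ hs0),
      (comp H.analyticAt_remainder).div (hs3.pow _) (pow_ne_zero _ hs0),
      (comp H.analyticAt_snd).div hs3 hs0, ?_, ?_⟩⟩
  · filter_upwards [hS.germ_inv.map_zero, H.snd_eq_zero] with t h1 h2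
    rw [h1, h2, zero_div]
  · filter_upwards [hS.germ_inv.tendsto.eventually H.eq, hS.right_inv, hsne, hsA3]
      with p k1 k2 k3 k4
    rw [k1]
    generalize S p = w at *
    subst k2
    simp only at k3 k4 ⊢
    rw [← k4]
    refine Prod.ext rfl (Prod.ext ?_ ?_)
    · simp only
      field_simp
      ring
    · simp only
      field_simp

end NormalForm

/-! ### From the chart of the family to its individual members. -/

section Assembly

open Filter

/-- The member `t` of a chart is an isomorphism on tangent spaces at the origin. -/
theorem FamilyChart.eventually_isInvertible {Θ Ψ : ℂ × ℂ × ℂ → ℂ × ℂ × ℂ} (h : FamilyChart Θ Ψ) :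
    ∀ᶠ t in 𝓝 (0 : ℂ), (vderiv Θ t).IsInvertible := by
  filter_upwards [h.vderiv_comp_eq, h.symm.vderiv_comp_eq] with t h1 h2
  exact ContinuousLinearMap.IsInvertible.of_inverse h2 h1

/-- The normal form of the member `t` of a family, with the remainder expanded in powers of `x`. -/
theorem exists_normalFormRel {q : ℕ} {l n c : ℂ} {G h : ℂ × ℂ → ℂ} (hG : AnalyticAt ℂ G 0) :
    ∃ a : ℕ → ℂ → ℂ, (∀ i, AnalyticAt ℂ (a i) 0) ∧ ∀ᶠ w in 𝓝 (0 : ℂ × ℂ),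
      NormalFormRel q l n c a h w (l * (w.1 + 1 * w.1 ^ (q + 1) + c * w.1 ^ (2 * q + 1)
        + w.1 ^ (2 * q + 2) * G w), n * w.2 + w.1 * h w) := by
  obtain ⟨a, ha, hs⟩ := hG.exists_hasSum_pow_fst
  -- The expansion of the remainder is reindexed to start at `2 * q + 2`. Below that index truncated
  -- subtraction returns `a 0`, but those coefficients never enter the sum.
  refine ⟨fun i => a (i - (2 * q + 2)), fun i => ha _, ?_⟩
  filter_upwards [hs] with w hw
  refine ⟨⟨w.1 ^ (2 * q + 2) * G w, ?_, by rw [one_mul]⟩, rfl⟩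
  refine (hw.mul_left (w.1 ^ (2 * q + 2))).congr_fun ?_
  intro j
  simp only [Nat.add_sub_cancel_left]
  ring

/-- Evaluating the chart identity at `Θ (t, z)` cancels the inverse chart, leaving a relation
between the coordinates of a point and of its image. -/
theorem NormalFormChart.eventually_exists_normalFormRel {q : ℕ} {l ν C : ℂ → ℂ}
    {G h : ℂ × ℂ × ℂ → ℂ} {Θ Ψ f : ℂ × ℂ × ℂ → ℂ × ℂ × ℂ}
    (H : NormalFormChart q l ν (fun _ => 1) C G h Θ Ψ f) :
    ∀ᶠ t in 𝓝 (0 : ℂ), ∃ (a : ℕ → ℂ → ℂ) (k : ℂ × ℂ → ℂ),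
      (∀ i, AnalyticAt ℂ (a i) 0) ∧ AnalyticAt ℂ k 0 ∧ k 0 = 0 ∧ ∀ᶠ z in 𝓝 (0 : ℂ × ℂ),
        NormalFormRel q (l t) (ν t) (C t) a k (Θ (t, z)).2 (Θ (f (t, z))).2 := by
  filter_upwards [eventually_section H.analyticAt_remainder.eventually_analyticAt,
    eventually_section H.analyticAt_snd.eventually_analyticAt, H.snd_eq_zero,
    eventually_fiber (H.chart.germ.tendsto.eventually H.eq), eventually_fiber H.chart.left_inv,
    eventually_section H.chart.germ.analyticAt.eventually_analyticAt, H.chart.germ.map_zero,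
    eventually_fiber H.chart.germ.eq_mk] with t h1 h2 h3 h4 h4' h5 h6 h7
  obtain ⟨a, ha, hs⟩ := exists_normalFormRel (q := q) (l := l t) (n := ν t) (c := C t)
    (h := fun z => h (t, z)) h1.fiber
  refine ⟨a, fun z => h (t, z), ha, h2.fiber, h3, ?_⟩
  have h8 : Tendsto (fun z => (Θ (t, z)).2) (𝓝 0) (𝓝 0) := by
    have := (AnalyticAt.snd_apply h5.fiber).continuousAt.tendsto
    rwa [h6] at this
  filter_upwards [h8.eventually hs, h4, h4', h7] with z k1 k2 k2' k3
  rw [k2'] at k2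
  rw [k2]
  rw [k3]
  exact k1

end Assembly

theorem mainTheorem11
    (q : ℕ) (hq : 0 < q) (lam : ℂ) (hlam : IsPrimitiveRoot lam q)
    -- the parameter `t` is complex or real, with `|t| < δ`
    (K : Set ℂ) (hK : K = Set.univ ∨ K = Set.range Complex.ofReal)
    (δ : ℝ) (hδ : 0 < δ)
    (H : ℂ → ℂ × ℂ → ℂ × ℂ) (nu : ℂ → ℂ)
    (hH : IsAnalyticFamily (K ∩ Metric.ball 0 δ) H)
    (hdiffeo : ∀ t ∈ K ∩ Metric.ball 0 δ, IsGermDiffeo (H t))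
    (heig₁ : ∀ t ∈ K ∩ Metric.ball 0 δ,
      Module.End.HasEigenvalue (fderiv ℂ (H t) 0).toLinearMap ((1 + t) * lam))
    (heig₂ : ∀ t ∈ K ∩ Metric.ball 0 δ,
      Module.End.HasEigenvalue (fderiv ℂ (H t) 0).toLinearMap (nu t))
    (hnu : ∀ t ∈ K ∩ Metric.ball 0 δ, ‖nu t‖ < min 1 ‖(1 + t) * lam‖)
    (hnu' : ∀ t ∈ K ∩ Metric.ball 0 δ, ‖nu t‖ * ‖(1 + t) * lam‖ ^ (2 * q) < 1)
    (hmult : HasSemiParabolicMultiplicity q (H 0) 1) :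
    ∃ ε : ℝ, 0 < ε ∧ ε ≤ δ ∧ ∃ ρ : ℝ, 0 < ρ ∧ ∃ φ : ℂ → ℂ × ℂ → ℂ × ℂ,
      -- the coordinates `φ t` are defined on a ball independent of `t` and depend smoothly on `t`
      ContDiffOn ℝ ∞ (fun p : ℂ × ℂ × ℂ => φ p.1 p.2)
        ((K ∩ Metric.ball 0 ε) ×ˢ Metric.ball 0 ρ) ∧
      ∀ t ∈ K ∩ Metric.ball 0 ε,
        IsGermDiffeo (φ t) ∧ AnalyticOnNhd ℂ (φ t) (Metric.ball 0 ρ) ∧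
        Set.InjOn (φ t) (Metric.ball 0 ρ) ∧
        ∃ (C : ℂ) (a : ℕ → ℂ → ℂ) (h : ℂ × ℂ → ℂ),
          (∀ i, AnalyticAt ℂ (a i) 0) ∧ AnalyticAt ℂ h 0 ∧ h 0 = 0 ∧
          ∀ᶠ z in 𝓝 (0 : ℂ × ℂ),
            NormalFormRel q ((1 + t) * lam) (nu t) C a h (φ t z) (φ t (H t z)) := by
  have hKR : Set.range Complex.ofReal ⊆ K := by
    rcases hK with rfl | rfl
    · exact Set.subset_univ _
    · exact subset_rfl
  have hK0 : (0 : ℂ) ∈ K := hKR ⟨0, rfl⟩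
  have h0 : (0 : ℂ) ∈ K ∩ Metric.ball 0 δ := ⟨hK0, Metric.mem_ball_self hδ⟩
  obtain ⟨f, hf, hfH, ν, hν, hνnu, hν0, e₁, e₂, he₁, he₂, hinj, h₁, h₂⟩ :=
    exists_familyGerm hKR hδ hH hdiffeo heig₁ heig₂
      fun t ht => (hnu t ht).trans_le (min_le_right _ _)
  have hν1 : ‖ν 0‖ < 1 := by
    rw [hνnu.self_of_nhds hK0]
    exact (hnu 0 h0).trans_le (min_le_left _ _)
  obtain ⟨A, C₀, G₀, h₀, Θ₀, Ψ₀, hN₀⟩ :=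
    hf.exists_normalFormChart hq hlam hν hν0 hν1 he₁ he₂ hinj h₁ h₂
  have hfH0 : ∀ᶠ z in 𝓝 (0 : ℂ × ℂ), (f (0, z)).2 = H 0 z :=
    (eventually_fiber hfH).self_of_nhds.mono fun z hz => hz hK0
  have hA : A 0 ≠ 0 := by
    refine hN₀.coeff_ne_zero hq hf ?_ ?_ hfH0 hmult
    · simp [hlam.pow_eq_one]
    · intro h
      have := congrArg norm h
      rw [norm_pow, norm_one] at this
      exact (pow_lt_one₀ (norm_nonneg _) hν1 hq.ne').ne this
  obtain ⟨C, G, h, Θ, Ψ, hN⟩ := hN₀.exists_rescale hq hA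
  have hΘ := hN.chart.germ
  -- A single ball in `(t, z)` on which the chart is analytic with a left inverse: it supplies a
  -- radius independent of `t`, joint smoothness, and injectivity of each member.
  obtain ⟨ρ, hρ, hball⟩ := Metric.eventually_nhds_iff_ball.mp
    (hΘ.analyticAt.eventually_analyticAt.and (hN.chart.left_inv.and hΘ.fst_eq))
  obtain ⟨ε, hε, hεt⟩ := Metric.eventually_nhds_iff_ball.mp
    (hΘ.map_zero.and (hN.chart.eventually_isInvertible.and
      (hN.eventually_exists_normalFormRel.and (hνnu.and
        ((eventually_fiber hfH).and (eventually_fiber hf.eq_mk))))))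
  have hmem : ∀ t ∈ Metric.ball (0 : ℂ) (min (min ε ρ) δ), ∀ z ∈ Metric.ball (0 : ℂ × ℂ) ρ,
      (t, z) ∈ Metric.ball (0 : ℂ × ℂ × ℂ) ρ := by
    intro t ht z hz
    rw [← Prod.mk_zero_zero, ← ball_prod_same]
    exact ⟨Metric.ball_subset_ball ((min_le_left _ _).trans (min_le_right _ _)) ht, hz⟩
  refine ⟨min (min ε ρ) δ, by positivity, min_le_right _ _, ρ, hρ, fun t z => (Θ (t, z)).2, ?_, ?_⟩
  · rintro ⟨t, z⟩ ⟨⟨-, ht⟩, hz⟩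
    have h1 : AnalyticAt ℂ (fun p => (Θ p).2) (t, z) := (hball _ (hmem t ht z hz)).1.snd_apply
    exact (h1.restrictScalars (𝕜 := ℝ)).contDiffAt.contDiffWithinAt
  rintro t ⟨htK, ht⟩
  obtain ⟨k1, k2, ⟨a, k, ha, hk, hk0, hrel⟩, k4, k5, k6⟩ :=
    hεt t (Metric.ball_subset_ball ((min_le_left _ _).trans (min_le_left _ _)) ht)
  have han : AnalyticOnNhd ℂ (fun z => (Θ (t, z)).2) (Metric.ball 0 ρ) := fun z hz =>
    AnalyticAt.snd_apply (hball _ (hmem t ht z hz)).1.fiber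
  refine ⟨⟨han 0 (Metric.mem_ball_self hρ), by simp [k1], k2⟩, han, ?_, C t, a, k, ha, hk, hk0, ?_⟩
  · intro z hz z' hz' hzz
    obtain ⟨-, b1, b2⟩ := hball _ (hmem t ht z hz)
    obtain ⟨-, b1', b2'⟩ := hball _ (hmem t ht z' hz')
    have : Θ (t, z) = Θ (t, z') := Prod.ext (b2.trans b2'.symm) hzz
    rw [this, b1'] at b1
    exact (congrArg Prod.snd b1).symm
  · filter_upwards [hrel, k5, k6] with z c1 c2 c3
    rw [← c2 htK, ← k4 htK]
    rw [c3] at c1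
    exact c1
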